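/- Let $k$ be a field and $\mathfrak g$ a finitely generated Lie algebra over $k$, with abelianization $\mathfrak g^{ab}=\mathfrak g/[\mathfrak g,\mathfrak g]$. For a commutative $k$-algebra $A$ put $\mathfrak g_A=A\otimes_k\mathfrak g$. A representation of $\mathfrak g_A$ on an $A$-module $E$ has an associated filtration: $\mathrm{Fil}_0=0$, and $\mathrm{Fil}_{i+1}$ is the preimage in $E$ of the vectors of $E/\mathrm{Fil}_i$ killed by $\mathfrak g_A$. The representation is *flag* of rank $n$ if $E$ is locally free of rank $n$, every $E/\mathrm{Fil}_i$ is locally free of finite rank, $\mathrm{Fil}_i$ has rank $i$ for $0\le i\le n$, and the formation of $\mathrm{Fil}$ commutes with every base change $A\to A'$ of $k$-algebras. *Nondegeneracy over a field.* A nilpotent representation of dimension $n$ over a field $K\supseteq k$ is nondegenerate if it is flag (its associated filtration is a full flag) and: for $n=1$ it is trivial; for $n\ge 2$, (i) the representations on $\mathrm{Fil}_{n-1}$ and on $E/\mathrm{Fil}_1$ are nondegenerate and (ii) the dimension of its automorphism group scheme is minimal among the $n$-dimensional flag nilpotent representations of $\mathfrak g$ over fields containing $k$ that satisfy (i). *Nondegeneracy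 in families.* A representation of $\mathfrak g_A$ of rank $n$ is nondegenerate nilpotent if it is flag of rank $n$ and, when $n\ge 1$, the representations on $\mathrm{Fil}_{n-1}$ and on $E/\mathrm{Fil}_1$ are nondegenerate nilpotent of rank $n-1$, its pullback to every field-valued point of $\operatorname{Spec}A$ is nondegenerate over that field, and its automorphism group scheme is flat over $\operatorname{Spec}A$. The moduli space $M_n^{\mathrm{nd}}(\mathfrak g)$ is the fppf sheaf on the category of affine $k$-schemes associated to the presheaf sending $\operatorname{Spec}A$ to the set of isomorphism classes of nondegenerate nilpotent representations of $\mathfrak g_A$ of rank $n$. Let $\mathbb P\mathfrak g^{ab}=\operatorname{Proj}\operatorname{Sym}_k\mathfrak g^{ab}$, regarded through its functor of points on affine $k$-schemes; a $k$-linear map $\lambda:\mathfrak g^{ab}\to A$ whose values generate the unit ideal of $A$ (i.e. an invertible quotient $A\otimes_k\mathfrak g^{ab}\twoheadrightarrow A$) defines a point $[\lambda]\in\mathbb P\mathfrak g^{ab}(A)$. Then $M_2^{\mathrm{nd}}(\mathfrak g)$ is canonically isomorphic to $\mathbb P\mathfrak g^{ab}$: there is exactly one isomorphism of functors $$\Phi: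 M_2^{\mathrm{nd}}(\mathfrak g)\;\xrightarrow{\ \sim\ }\;\mathbb P\mathfrak g^{ab}$$ such that, for every commutative $k$-algebra $A$, every nondegenerate nilpotent representation of $\mathfrak g_A$ of rank $2$ on a free module with a basis $e_1,e_2$, and every $k$-linear map $\lambda:\mathfrak g^{ab}\to A$ with $$x\,e_1=0,\qquad x\,e_2=\lambda(\bar x)\,e_1\qquad(x\in\mathfrak g),$$ the values of $\lambda$ generate the unit ideal of $A$ and $\Phi$ sends the class of the representation to $[\lambda]$. -/

import Mathlib

open CategoryTheory AlgebraicGeometry Opposite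
open scoped TensorProduct

universe u

noncomputable section

namespace NilpotentModuli

section Representations

variable (k : Type u) [Field k] (g : Type u) [LieRing g] [LieAlgebra k g]

/-- The associated filtration of a representation of `g_A = A ⊗ g` on an `A`-module `E`:
`Fil₀ = 0`, and `Fil_{i+1}` is the preimage in `E` of the vectors of `E / Fil_i` killed by `g_A`. -/
abbrev fil (A : Type u) [CommRing A] [Algebra k A] (E : Type u) [AddCommGroup E] [Module A E]
    [LieRingModule (A ⊗[k] g) E] [LieModule A (A ⊗[k] g) E] (i : ℕ) :
    LieSubmodule A (A ⊗[k] g) E :=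
  (⊥ : LieSubmodule A (A ⊗[k] g) E).ucs i

/-- `f : E → E'` exhibits the representation `E'` of `g_{A'}` as the pullback of the
representation `E` of `g_A` along `Spec A' → Spec A`. -/
structure IsPullback {A : Type u} (A' : Type u) [CommRing A] [Algebra k A] [CommRing A'] [Algebra k A']
    [Algebra A A'] {E E' : Type u} [AddCommGroup E] [Module A E]
    [LieRingModule (A ⊗[k] g) E] [AddCommGroup E'] [Module A E'] [Module A' E']
    [IsScalarTower A A' E'] [LieRingModule (A' ⊗[k] g) E'] (f : E →ₗ[A] E') : Prop where
  isBaseChange : IsBaseChange A' f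
  map_lie (x : g) (e : E) : f ⁅(1 : A) ⊗ₜ[k] x, e⁆ = ⁅(1 : A') ⊗ₜ[k] x, f e⁆

/-- Flag representations of rank `n` over `Spec A`. -/
structure IsFlag (n : ℕ) (A : Type u) [CommRing A] [Algebra k A] (E : Type u) [AddCommGroup E]
    [Module A E] [LieRingModule (A ⊗[k] g) E] [LieModule A (A ⊗[k] g) E] : Prop where
  /-- `E` is locally free of finite rank, -/
  finite : Module.Finite A E
  projective : Module.Projective A E
  /-- of constant rank `n`. -/
  rank (p : PrimeSpectrum A) : Module.rankAtStalk E p = n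
  /-- Each `E / Fil_i` is locally free of finite rank. -/
  finite_quotient (i : ℕ) : Module.Finite A (E ⧸ fil k g A E i)
  projective_quotient (i : ℕ) : Module.Projective A (E ⧸ fil k g A E i)
  /-- The filtration is a full flag. -/
  rank_fil (i : ℕ) (hi : i ≤ n) (p : PrimeSpectrum A) : Module.rankAtStalk (fil k g A E i) p = i
  /-- Formation of the filtration is compatible with base change. -/
  fil_pullback (A' : Type u) [CommRing A'] [Algebra k A'] [Algebra A A'] [IsScalarTower k A A']
    (E' : Type u) [AddCommGroup E'] [Module A E'] [Module A' E'] [IsScalarTower A A' E']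
    [LieRingModule (A' ⊗[k] g) E'] [LieModule A' (A' ⊗[k] g) E'] (f : E →ₗ[A] E')
    (hf : IsPullback k g A' f) (i : ℕ) :
    (fil k g A' E' i : Submodule A' E') = Submodule.span A' (f '' (fil k g A E i : Set E))

/-- A `B`-linear automorphism of `E_B = B ⊗ E` is an automorphism of the representation `r_B`
when it commutes with the action of `g` (which generates `g_B` over `B`). -/
def IsRepAut {A : Type u} [CommRing A] [Algebra k A] {E : Type u} [AddCommGroup E] [Module A E]
    [LieRingModule (A ⊗[k] g) E] [LieModule A (A ⊗[k] g) E]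
    {B : Type u} [CommRing B] [Algebra A B] (φ : (B ⊗[A] E) ≃ₗ[B] (B ⊗[A] E)) : Prop :=
  ∀ (x : g) (z : B ⊗[A] E),
    φ ((LieModule.toEnd A (A ⊗[k] g) E (1 ⊗ₜ[k] x)).baseChange B z) =
      (LieModule.toEnd A (A ⊗[k] g) E (1 ⊗ₜ[k] x)).baseChange B (φ z)

/-- `Spec R` represents the functor `B ↦ Aut (r_B)` of automorphisms of the representation `E`:
there is a universal automorphism `w` over `R`, of which every automorphism over an `A`-algebra
`B` is the base change along a unique homomorphism `R → B`. -/
def RepresentsAut (A : Type u) [CommRing A] [Algebra k A] (E : Type u) [AddCommGroup E]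
    [Module A E] [LieRingModule (A ⊗[k] g) E] [LieModule A (A ⊗[k] g) E]
    (R : Type u) [CommRing R] [Algebra A R] : Prop :=
  ∃ w : (R ⊗[A] E) ≃ₗ[R] (R ⊗[A] E), IsRepAut k g w ∧
    ∀ (B : Type u) [CommRing B] [Algebra A B] (φ : (B ⊗[A] E) ≃ₗ[B] (B ⊗[A] E)),
      IsRepAut k g φ →
        ∃! h : R →ₐ[A] B, ∀ e : E, φ (1 ⊗ₜ e) = h.toLinearMap.rTensor E (w (1 ⊗ₜ e))

/-- The automorphism group scheme of the representation `E` is flat over `Spec A`. -/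
def AutIsFlat (A : Type u) [CommRing A] [Algebra k A] (E : Type u) [AddCommGroup E]
    [Module A E] [LieRingModule (A ⊗[k] g) E] [LieModule A (A ⊗[k] g) E] : Prop :=
  ∃ (R : Type u) (_ : CommRing R) (_ : Algebra A R), RepresentsAut k g A E R ∧ Module.Flat A R

/-- `n`-dimensional flag representations over a field extension `K` of `k`: nilpotent
representations whose associated filtration is a full flag. -/
structure IsFlagOverField (n : ℕ) (K : Type u) [Field K] [Algebra k K] (E : Type u)
    [AddCommGroup E] [Module K E] [LieRingModule (K ⊗[k] g) E] [LieModule K (K ⊗[k] g) E] :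
    Prop where
  finite : Module.Finite K E
  finrank_eq : Module.finrank K E = n
  isNilpotent : LieModule.IsNilpotent (K ⊗[k] g) E
  finrank_fil (i : ℕ) (hi : i ≤ n) : Module.finrank K (fil k g K E i) = i

/-- `n`-dimensional nondegenerate nilpotent representations over a field extension `K` of `k`. -/
def IsNondegenerateOverField : (n : ℕ) → (K : Type u) → [Field K] → [Algebra k K] →
    (E : Type u) → [AddCommGroup E] → [Module K E] → [LieRingModule (K ⊗[k] g) E] →
    [LieModule K (K ⊗[k] g) E] → Prop
  | 0, K, _, _, E, _, _, _, _ => IsFlagOverField k g 0 K E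
  | 1, K, _, _, E, _, _, _, _ =>
      IsFlagOverField k g 1 K E ∧ LieModule.IsTrivial (K ⊗[k] g) E
  | n + 2, K, _, _, E, _, _, _, _ =>
      IsFlagOverField k g (n + 2) K E ∧
      IsNondegenerateOverField (n + 1) K (fil k g K E (n + 1)) ∧
      IsNondegenerateOverField (n + 1) K (E ⧸ fil k g K E 1) ∧
      ∃ (R : Type u) (_ : CommRing R) (_ : Algebra K R), RepresentsAut k g K E R ∧
        ∀ (K' : Type u) [Field K'] [Algebra k K'] (E' : Type u) [AddCommGroup E'] [Module K' E']
          [LieRingModule (K' ⊗[k] g) E'] [LieModule K' (K' ⊗[k] g) E']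
          (R' : Type u) [CommRing R'] [Algebra K' R'],
          IsFlagOverField k g (n + 2) K' E' →
          IsNondegenerateOverField (n + 1) K' (fil k g K' E' (n + 1)) →
          IsNondegenerateOverField (n + 1) K' (E' ⧸ fil k g K' E' 1) →
          RepresentsAut k g K' E' R' →
          ringKrullDim R ≤ ringKrullDim R'

/-- Nondegenerate nilpotent representations of rank `n` over `Spec A`. -/
def IsNondegenerate : (n : ℕ) → (A : Type u) → [CommRing A] → [Algebra k A] →
    (E : Type u) → [AddCommGroup E] → [Module A E] → [LieRingModule (A ⊗[k] g) E] →
    [LieModule A (A ⊗[k] g) E] → Prop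
  | 0, A, _, _, E, _, _, _, _ => IsFlag k g 0 A E
  | n + 1, A, _, _, E, _, _, _, _ =>
      IsFlag k g (n + 1) A E ∧
      IsNondegenerate n A (fil k g A E n) ∧
      IsNondegenerate n A (E ⧸ fil k g A E 1) ∧
      (∀ (K : Type u) [Field K] [Algebra k K] [Algebra A K] [IsScalarTower k A K]
        (E' : Type u) [AddCommGroup E'] [Module A E'] [Module K E'] [IsScalarTower A K E']
        [LieRingModule (K ⊗[k] g) E'] [LieModule K (K ⊗[k] g) E'] (f : E →ₗ[A] E'),
        IsPullback k g K f → IsNondegenerateOverField k g (n + 1) K E') ∧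
      AutIsFlat k g A E

end Representations

section Stability

set_option linter.unusedSectionVars false

variable (k : Type u) [Field k] (g : Type u) [LieRing g] [LieAlgebra k g]

variable {A A' : Type u} [CommRing A] [Algebra k A] [CommRing A'] [Algebra k A']
  [Algebra A A'] [IsScalarTower k A A']
  {E E' : Type u} [AddCommGroup E] [Module A E] [LieRingModule (A ⊗[k] g) E]
  [LieModule A (A ⊗[k] g) E] [AddCommGroup E'] [Module A E'] [Module A' E']
  [IsScalarTower A A' E'] [LieRingModule (A' ⊗[k] g) E'] [LieModule A' (A' ⊗[k] g) E']
  {f : E →ₗ[A] E'}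

/-- A pullback of a pullback is a pullback. -/
theorem IsPullback.trans {A'' : Type u} [CommRing A''] [Algebra k A''] [Algebra A' A'']
    [Algebra A A''] [IsScalarTower A A' A''] {E'' : Type u} [AddCommGroup E''] [Module A E'']
    [Module A' E''] [Module A'' E''] [IsScalarTower A' A'' E''] [IsScalarTower A A' E'']
    [IsScalarTower A A'' E''] [LieRingModule (A'' ⊗[k] g) E''] {f' : E' →ₗ[A'] E''}
    (hf : IsPullback k g A' f) (hf' : IsPullback k g A'' f') :
    IsPullback k g A'' ((f'.restrictScalars A).comp f) where
  isBaseChange := hf.isBaseChange.comp hf'.isBaseChange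
  map_lie x e := by simp [hf.map_lie, hf'.map_lie]

/-- The image of `Fil_i` lies in `Fil_i` of the pullback. -/
theorem IsFlag.map_mem_fil {n : ℕ} (h : IsFlag k g n A E) (hf : IsPullback k g A' f) (i : ℕ)
    {e : E} (he : e ∈ fil k g A E i) : f e ∈ fil k g A' E' i := by
  have : f e ∈ (fil k g A' E' i : Submodule A' E') := by
    rw [h.fil_pullback A' E' f hf i]
    exact Submodule.subset_span ⟨e, he, rfl⟩
  exact this

/-- The map induced by `f` on `Fil_i`. -/
def filMap {n : ℕ} (h : IsFlag k g n A E) (hf : IsPullback k g A' f) (i : ℕ) :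
    fil k g A E i →ₗ[A] fil k g A' E' i where
  toFun e := ⟨f e, h.map_mem_fil k g hf i e.2⟩
  map_add' x y := by ext; simp
  map_smul' a x := by ext; simp

/-- The map induced by `f` on `E / Fil_i`. -/
def quotMap {n : ℕ} (h : IsFlag k g n A E) (hf : IsPullback k g A' f) (i : ℕ) :
    (E ⧸ fil k g A E i) →ₗ[A] (E' ⧸ fil k g A' E' i) :=
  Submodule.liftQ (fil k g A E i : Submodule A E)
    (((fil k g A' E' i : Submodule A' E').mkQ.restrictScalars A).comp f) (by
      intro e he
      simp only [LinearMap.mem_ker, LinearMap.comp_apply, LinearMap.restrictScalars_apply]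
      exact (Submodule.Quotient.mk_eq_zero _).2 (h.map_mem_fil k g hf i he))

/-- `Fil_i` is a direct summand of `E`. -/
theorem IsFlag.exists_retraction {n : ℕ} (h : IsFlag k g n A E) (i : ℕ) :
    ∃ ρ : E →ₗ[A] fil k g A E i, ∀ e : fil k g A E i, ρ e = e := by
  have := h.projective_quotient i
  obtain ⟨s, hs⟩ := Module.projective_lifting_property
    (fil k g A E i : Submodule A E).mkQ LinearMap.id (Submodule.mkQ_surjective _)
  have hs' (e : E) : e - s ((fil k g A E i : Submodule A E).mkQ e) ∈ fil k g A E i := by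
    have : (fil k g A E i : Submodule A E).mkQ
        (e - s ((fil k g A E i : Submodule A E).mkQ e)) = 0 := by
      rw [map_sub, sub_eq_zero]
      exact (LinearMap.congr_fun hs _).symm
    exact (Submodule.Quotient.mk_eq_zero _).1 this
  refine ⟨LinearMap.codRestrict (fil k g A E i : Submodule A E)
    (LinearMap.id - s.comp (fil k g A E i : Submodule A E).mkQ) hs', fun e => ?_⟩
  apply Subtype.ext
  have : (fil k g A E i : Submodule A E).mkQ (e : E) = 0 :=
    (Submodule.Quotient.mk_eq_zero _).2 e.2
  change (e : E) - s ((fil k g A E i : Submodule A E).mkQ (e : E)) = e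
  rw [this]; simp

theorem IsFlag.finite_fil {n : ℕ} (h : IsFlag k g n A E) (i : ℕ) :
    Module.Finite A (fil k g A E i) := by
  obtain ⟨ρ, hρ⟩ := h.exists_retraction k g i
  have := h.finite
  exact Module.Finite.of_surjective ρ fun e => ⟨e, hρ e⟩

theorem IsFlag.projective_fil {n : ℕ} (h : IsFlag k g n A E) (i : ℕ) :
    Module.Projective A (fil k g A E i) := by
  obtain ⟨ρ, hρ⟩ := h.exists_retraction k g i
  have := h.projective
  exact Module.Projective.of_split (fil k g A E i : Submodule A E).subtype ρ
    (LinearMap.ext fun e => hρ e)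

instance (i : ℕ) : IsScalarTower A A' (E' ⧸ fil k g A' E' i) :=
  inferInstanceAs (IsScalarTower A A' (E' ⧸ (fil k g A' E' i : Submodule A' E')))

theorem filMap_isPullback {n : ℕ} (h : IsFlag k g n A E) (hf : IsPullback k g A' f) (i : ℕ) :
    IsPullback k g A' (filMap k g h hf i) where
  isBaseChange := by
    obtain ⟨ρ, hρ⟩ := h.exists_retraction k g i
    apply IsBaseChange.of_lift_unique
    intro Q _ _ _ _ q
    refine ⟨(hf.isBaseChange.lift (q.comp ρ)).comp (fil k g A' E' i : Submodule A' E').subtype,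
      ?_, ?_⟩
    · ext e
      change hf.isBaseChange.lift (q.comp ρ) (f e) = q e
      rw [IsBaseChange.lift_eq]
      simp [hρ]
    · intro q' hq'
      have key : ∀ (y : E') (hy : y ∈ Submodule.span A' (f '' (fil k g A E i : Set E)))
          (hy' : y ∈ fil k g A' E' i), q' ⟨y, hy'⟩ = hf.isBaseChange.lift (q.comp ρ) y := by
        intro y hy
        induction hy using Submodule.span_induction with
        | mem y hy =>
          obtain ⟨e, he, rfl⟩ := hy
          intro hy'
          rw [IsBaseChange.lift_eq]
          have := LinearMap.congr_fun hq' ⟨e, he⟩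
          exact this.trans (congrArg q (hρ ⟨e, he⟩).symm)
        | zero => intro hy'; rw [map_zero]; exact map_zero q'
        | add a b ha hb iha ihb =>
          intro hy'
          have ha' : a ∈ fil k g A' E' i := by
            rw [← h.fil_pullback A' E' f hf i] at ha; exact ha
          have hb' : b ∈ fil k g A' E' i := by
            rw [← h.fil_pullback A' E' f hf i] at hb; exact hb
          rw [map_add, ← iha ha', ← ihb hb', ← map_add]; rfl
        | smul c a ha iha =>
          intro hy'
          have ha' : a ∈ fil k g A' E' i := by
            rw [← h.fil_pullback A' E' f hf i] at ha; exact ha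
          rw [map_smul, ← iha ha', ← map_smul]; rfl
      ext ⟨y, hy⟩
      refine key y ?_ hy
      rw [← h.fil_pullback A' E' f hf i]; exact hy
  map_lie x e := Subtype.ext (hf.map_lie x e)

/-- Formation of quotients commutes with base change. -/
theorem isBaseChange_quotient {A A' E E' : Type u} [CommRing A] [CommRing A'] [Algebra A A']
    [AddCommGroup E] [Module A E] [AddCommGroup E'] [Module A E'] [Module A' E']
    [IsScalarTower A A' E'] {f : E →ₗ[A] E'} (hf : IsBaseChange A' f)
    (N : Submodule A E) (N' : Submodule A' E') (hN : N' = Submodule.span A' (f '' (N : Set E)))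
    (q : (E ⧸ N) →ₗ[A] (E' ⧸ N')) (hq : ∀ e, q (N.mkQ e) = N'.mkQ (f e)) :
    IsBaseChange A' q := by
  refine IsBaseChange.of_lift_unique.{u,u,u} q fun Q _ _ _ _ p => ?_
  let _ : AddCommGroup Q := Module.addCommMonoidToAddCommGroup A'
  have hle : N' ≤ LinearMap.ker (hf.lift (p.comp N.mkQ)) := by
    rw [hN, Submodule.span_le]
    rintro _ ⟨e, he, rfl⟩
    have : N.mkQ e = 0 := (Submodule.Quotient.mk_eq_zero _).2 he
    rw [SetLike.mem_coe, LinearMap.mem_ker, IsBaseChange.lift_eq, LinearMap.comp_apply, this,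
      map_zero]
  have h1 (y : E') : Submodule.liftQ N' _ hle (N'.mkQ y) = hf.lift (p.comp N.mkQ) y := rfl
  refine ⟨Submodule.liftQ N' _ hle, ?_, ?_⟩
  · refine LinearMap.ext fun e => ?_
    obtain ⟨e, rfl⟩ := N.mkQ_surjective e
    rw [LinearMap.comp_apply, LinearMap.restrictScalars_apply, hq, h1, IsBaseChange.lift_eq]
    rfl
  · intro q' hq'
    have h2 : q'.comp N'.mkQ = hf.lift (p.comp N.mkQ) := by
      refine hf.algHom_ext _ _ fun e => ?_
      have := LinearMap.congr_fun hq' (N.mkQ e)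
      rw [LinearMap.comp_apply, LinearMap.restrictScalars_apply, hq] at this
      rw [IsBaseChange.lift_eq]
      exact this
    refine LinearMap.ext fun y => ?_
    obtain ⟨y, rfl⟩ := N'.mkQ_surjective y
    exact LinearMap.congr_fun h2 y

theorem quotMap_isPullback {n : ℕ} (h : IsFlag k g n A E) (hf : IsPullback k g A' f) (i : ℕ) :
    IsPullback k g A' (quotMap k g h hf i) where
  isBaseChange :=
    isBaseChange_quotient hf.isBaseChange (fil k g A E i : Submodule A E)
      (fil k g A' E' i : Submodule A' E') (h.fil_pullback A' E' f hf i) (quotMap k g h hf i)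
      fun _ => rfl
  map_lie x e := by
    obtain ⟨e, rfl⟩ := Submodule.mkQ_surjective (fil k g A E i : Submodule A E) e
    exact congrArg (fil k g A' E' i : Submodule A' E').mkQ (hf.map_lie x e)

theorem IsFlag.pullback {n : ℕ} (h : IsFlag k g n A E) (hf : IsPullback k g A' f) :
    IsFlag k g n A' E' where
  finite := by
    have := h.finite
    exact Module.Finite.equiv hf.isBaseChange.equiv
  projective := by
    have := h.projective
    exact Module.Projective.of_equiv hf.isBaseChange.equiv
  rank p := by
    have := h.finite
    have := h.projective
    rw [Module.rankAtStalk_isBaseChange hf.isBaseChange, h.rank]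
  finite_quotient i := by
    have := h.finite_quotient i
    exact Module.Finite.equiv (quotMap_isPullback k g h hf i).isBaseChange.equiv
  projective_quotient i := by
    have := h.projective_quotient i
    exact Module.Projective.of_equiv (quotMap_isPullback k g h hf i).isBaseChange.equiv
  rank_fil i hi p := by
    have := h.finite_fil k g i
    have := h.projective_fil k g i
    rw [Module.rankAtStalk_isBaseChange (filMap_isPullback k g h hf i).isBaseChange,
      h.rank_fil i hi]
  fil_pullback A'' _ _ _ _ E'' _ _ _ _ _ _ f' hf' i := by
    let : Algebra A A'' := ((algebraMap A' A'').comp (algebraMap A A')).toAlgebra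
    have : IsScalarTower A A' A'' := IsScalarTower.of_algebraMap_eq fun _ => rfl
    have : IsScalarTower k A A'' := IsScalarTower.of_algebraMap_eq fun x => by
      rw [IsScalarTower.algebraMap_apply k A' A'', IsScalarTower.algebraMap_apply k A A']; rfl
    let : Module A E'' := Module.compHom E'' (algebraMap A A'')
    have : IsScalarTower A A'' E'' := ⟨fun a b c => by
      rw [Algebra.smul_def, mul_smul]; rfl⟩
    have : IsScalarTower A A' E'' := ⟨fun a b c => by
      rw [Algebra.smul_def, mul_smul, ← IsScalarTower.algebraMap_smul A'' (algebraMap A A' a)]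
      rfl⟩
    have h1 := h.fil_pullback A'' E'' _ (hf.trans k g hf') i
    have h2 := h.fil_pullback A' E' f hf i
    rw [h1]
    apply le_antisymm
    · apply Submodule.span_mono
      rintro _ ⟨e, he, rfl⟩
      exact ⟨f e, h.map_mem_fil k g hf i he, rfl⟩
    · rw [Submodule.span_le]
      rintro _ ⟨y, hy, rfl⟩
      have hy' : y ∈ Submodule.span A' (f '' (fil k g A E i : Set E)) := by rw [← h2]; exact hy
      clear hy
      induction hy' using Submodule.span_induction with
      | mem y hy =>
        obtain ⟨e, he, rfl⟩ := hy
        exact Submodule.subset_span ⟨e, he, rfl⟩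
      | zero => rw [map_zero]; exact Submodule.zero_mem _
      | add a b _ _ iha ihb => rw [map_add]; exact Submodule.add_mem _ iha ihb
      | smul c a _ iha =>
        rw [map_smul, ← IsScalarTower.algebraMap_smul A'' c]
        exact Submodule.smul_mem _ _ iha

/-- For an `A'`-algebra `B`, the comparison `E'_B ≃ E_B`. -/
def cmp (hf : IsPullback k g A' f) (B : Type u) [CommRing B] [Algebra A' B] [Algebra A B]
    [IsScalarTower A A' B] : (B ⊗[A'] E') ≃ₗ[B] (B ⊗[A] E) :=
  (TensorProduct.AlgebraTensorModule.congr (LinearEquiv.refl B B)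
    hf.isBaseChange.equiv.symm) ≪≫ₗ TensorProduct.AlgebraTensorModule.cancelBaseChange A A' B B E

theorem cmp_tmul (hf : IsPullback k g A' f) (B : Type u) [CommRing B] [Algebra A' B] [Algebra A B]
    [IsScalarTower A A' B] (b : B) (e : E) : cmp k g hf B (b ⊗ₜ f e) = b ⊗ₜ e := by
  simp [cmp, IsBaseChange.equiv_symm_apply]

theorem cmp_symm_tmul (hf : IsPullback k g A' f) (B : Type u) [CommRing B] [Algebra A' B]
    [Algebra A B] [IsScalarTower A A' B] (b : B) (e : E) :
    (cmp k g hf B).symm (b ⊗ₜ e) = b ⊗ₜ f e := by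
  rw [LinearEquiv.symm_apply_eq, cmp_tmul]

theorem cmp_symm_toEnd (hf : IsPullback k g A' f) (B : Type u) [CommRing B] [Algebra A' B]
    [Algebra A B] [IsScalarTower A A' B] (x : g) (z : B ⊗[A] E) :
    (cmp k g hf B).symm ((LieModule.toEnd A (A ⊗[k] g) E (1 ⊗ₜ[k] x)).baseChange B z) =
      (LieModule.toEnd A' (A' ⊗[k] g) E' (1 ⊗ₜ[k] x)).baseChange B ((cmp k g hf B).symm z) := by
  induction z with
  | zero => simp
  | add a b ha hb => simp only [map_add, ha, hb]
  | tmul b e => simp [cmp_symm_tmul, hf.map_lie]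

theorem cmp_toEnd (hf : IsPullback k g A' f) (B : Type u) [CommRing B] [Algebra A' B]
    [Algebra A B] [IsScalarTower A A' B] (x : g) (z : B ⊗[A'] E') :
    cmp k g hf B ((LieModule.toEnd A' (A' ⊗[k] g) E' (1 ⊗ₜ[k] x)).baseChange B z) =
      (LieModule.toEnd A (A ⊗[k] g) E (1 ⊗ₜ[k] x)).baseChange B (cmp k g hf B z) := by
  rw [← LinearEquiv.eq_symm_apply, cmp_symm_toEnd, LinearEquiv.symm_apply_apply]

theorem cmp_rTensor (hf : IsPullback k g A' f) {B C : Type u} [CommRing B] [Algebra A' B]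
    [Algebra A B] [IsScalarTower A A' B] [CommRing C] [Algebra A' C] [Algebra A C]
    [IsScalarTower A A' C] (h : B →ₐ[A'] C) (z : B ⊗[A'] E') :
    cmp k g hf C (h.toLinearMap.rTensor E' z) =
      (h.restrictScalars A).toLinearMap.rTensor E (cmp k g hf B z) := by
  obtain ⟨z, rfl⟩ := (cmp k g hf B).symm.surjective z
  rw [LinearEquiv.apply_symm_apply]
  induction z with
  | zero => simp
  | add a b ha hb => simp only [map_add, ha, hb]
  | tmul b e => simp [cmp_symm_tmul, cmp_tmul]

theorem isRepAut_conj (hf : IsPullback k g A' f) {B : Type u} [CommRing B] [Algebra A' B]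
    [Algebra A B] [IsScalarTower A A' B] {φ : (B ⊗[A] E) ≃ₗ[B] (B ⊗[A] E)}
    (hφ : IsRepAut k g φ) :
    IsRepAut k g ((cmp k g hf B ≪≫ₗ φ) ≪≫ₗ (cmp k g hf B).symm) := by
  intro x z
  simp only [LinearEquiv.trans_apply]
  rw [cmp_toEnd, hφ, cmp_symm_toEnd]

theorem isRepAut_conj' (hf : IsPullback k g A' f) {B : Type u} [CommRing B] [Algebra A' B]
    [Algebra A B] [IsScalarTower A A' B] {φ : (B ⊗[A'] E') ≃ₗ[B] (B ⊗[A'] E')}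
    (hφ : IsRepAut k g φ) :
    IsRepAut k g (((cmp k g hf B).symm ≪≫ₗ φ) ≪≫ₗ cmp k g hf B) := by
  intro x z
  simp only [LinearEquiv.trans_apply]
  rw [cmp_symm_toEnd, hφ, cmp_toEnd]

theorem RepresentsAut.pullback (hf : IsPullback k g A' f) {R : Type u} [CommRing R] [Algebra A R]
    (h : RepresentsAut k g A E R) : RepresentsAut k g A' E' (A' ⊗[A] R) := by
  obtain ⟨w, hw, hu⟩ := h
  let ι : R →ₐ[A] A' ⊗[A] R := Algebra.TensorProduct.includeRight
  -- the base change of `w` to `R' = A' ⊗ R`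
  let _ : Algebra R (A' ⊗[A] R) := ι.toRingHom.toAlgebra
  have : IsScalarTower A R (A' ⊗[A] R) := IsScalarTower.of_algebraMap_eq fun x =>
    (ι.commutes x).symm
  let c := TensorProduct.AlgebraTensorModule.cancelBaseChange A R (A' ⊗[A] R) (A' ⊗[A] R) E
  let w' : ((A' ⊗[A] R) ⊗[A] E) ≃ₗ[A' ⊗[A] R] ((A' ⊗[A] R) ⊗[A] E) :=
    (c.symm ≪≫ₗ TensorProduct.AlgebraTensorModule.congr (LinearEquiv.refl _ _) w) ≪≫ₗ c
  have hc (z : R ⊗[A] E) (b : A' ⊗[A] R) :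
      c (b ⊗ₜ z) = b • ι.toLinearMap.rTensor E z := by
    induction z with
    | zero => simp
    | add a b ha hb => simp only [TensorProduct.tmul_add, map_add, ha, hb, smul_add]
    | tmul r e =>
      simp only [c, TensorProduct.AlgebraTensorModule.cancelBaseChange_tmul,
        LinearMap.rTensor_tmul, TensorProduct.smul_tmul', AlgHom.toLinearMap_apply]
      rw [Algebra.smul_def, mul_comm]
      rfl
  have hw'e (e : E) : w' (1 ⊗ₜ e) = ι.toLinearMap.rTensor E (w (1 ⊗ₜ e)) := by
    have : c.symm (1 ⊗ₜ e) = 1 ⊗ₜ (1 ⊗ₜ e) := by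
      rw [LinearEquiv.symm_apply_eq, hc]; simp
    simp only [w', LinearEquiv.trans_apply, this,
      TensorProduct.AlgebraTensorModule.congr_tmul, LinearEquiv.refl_apply, hc, one_smul]
  have hcom {B C : Type u} [CommRing B] [Algebra A B] [CommRing C] [Algebra A C] (h : B →ₐ[A] C)
      (x : g) (z : B ⊗[A] E) :
      h.toLinearMap.rTensor E ((LieModule.toEnd A (A ⊗[k] g) E (1 ⊗ₜ[k] x)).baseChange B z) =
      (LieModule.toEnd A (A ⊗[k] g) E (1 ⊗ₜ[k] x)).baseChange C (h.toLinearMap.rTensor E z) := by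
    induction z with
    | zero => simp
    | add a b ha hb => simp only [map_add, ha, hb]
    | tmul b e => simp
  have hw' : IsRepAut k g w' := by
    intro x z
    induction z with
    | zero => simp
    | add a b ha hb => simp only [map_add, ha, hb]
    | tmul b e =>
      have hb (e : E) : b ⊗ₜ[A] e = b • ((1 : A' ⊗[A] R) ⊗ₜ[A] e) := by
        rw [TensorProduct.smul_tmul', smul_eq_mul, mul_one]
      rw [LinearMap.baseChange_tmul, hb, hb, map_smul, map_smul, map_smul, hw'e, hw'e, ← hcom]
      have := hw x (1 ⊗ₜ e)
      rw [LinearMap.baseChange_tmul] at this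
      rw [this]
  refine ⟨_, isRepAut_conj k g hf hw', ?_⟩
  intro B _ _ φ hφ
  let _ : Algebra A B := ((algebraMap A' B).comp (algebraMap A A')).toAlgebra
  have : IsScalarTower A A' B := IsScalarTower.of_algebraMap_eq fun _ => rfl
  obtain ⟨h, hh, hh'⟩ := hu B _ (isRepAut_conj' k g hf hφ)
  -- the universal property only needs to be tested on vectors of `E`
  have key (h₁ : A' ⊗[A] R →ₐ[A'] B) :
      (∀ e' : E', φ (1 ⊗ₜ e') = h₁.toLinearMap.rTensor E'
        (((cmp k g hf (A' ⊗[A] R) ≪≫ₗ w') ≪≫ₗ (cmp k g hf (A' ⊗[A] R)).symm) (1 ⊗ₜ e'))) ↔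
      ∀ e : E, (((cmp k g hf B).symm ≪≫ₗ φ) ≪≫ₗ cmp k g hf B) (1 ⊗ₜ e) =
        ((h₁.restrictScalars A).comp ι).toLinearMap.rTensor E (w (1 ⊗ₜ e)) := by
    have aux (e : E) : (((cmp k g hf B).symm ≪≫ₗ φ) ≪≫ₗ cmp k g hf B) (1 ⊗ₜ e) =
        ((h₁.restrictScalars A).comp ι).toLinearMap.rTensor E (w (1 ⊗ₜ e)) ↔
        φ (1 ⊗ₜ f e) = h₁.toLinearMap.rTensor E'
        (((cmp k g hf (A' ⊗[A] R) ≪≫ₗ w') ≪≫ₗ (cmp k g hf (A' ⊗[A] R)).symm) (1 ⊗ₜ f e)) := by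
      rw [← (cmp k g hf B).injective.eq_iff (b := h₁.toLinearMap.rTensor E' _), cmp_rTensor]
      simp only [LinearEquiv.trans_apply, LinearEquiv.apply_symm_apply, cmp_symm_tmul, cmp_tmul,
        hw'e]
      rw [AlgHom.comp_toLinearMap, LinearMap.rTensor_comp_apply]
    constructor
    · intro H e
      exact (aux e).2 (H (f e))
    · intro H e'
      induction e' using hf.isBaseChange.inductionOn with
      | zero => simp
      | tmul e => exact (aux e).1 (H e)
      | smul a e' ih =>
        simp only [TensorProduct.tmul_smul]
        have h2 (z : B ⊗[A'] E') : φ (a • z) = a • φ z := by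
          rw [← IsScalarTower.algebraMap_smul B a, map_smul, IsScalarTower.algebraMap_smul]
        have h3 (Z : ((A' ⊗[A] R) ⊗[A'] E') ≃ₗ[A' ⊗[A] R] ((A' ⊗[A] R) ⊗[A'] E'))
            (z : (A' ⊗[A] R) ⊗[A'] E') : Z (a • z) = a • Z z := by
          rw [← IsScalarTower.algebraMap_smul (A' ⊗[A] R) a, map_smul,
            IsScalarTower.algebraMap_smul]
        rw [h2, h3, map_smul, ih]
      | add a b ha hb => simp only [TensorProduct.tmul_add, map_add, ha, hb]
  refine ⟨Algebra.TensorProduct.lift (Algebra.ofId A' B) h (fun _ _ => Commute.all _ _), ?_, ?_⟩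
  · refine (key _).2 ?_
    intro e
    rw [hh e]
    congr 3
    ext r
    simp [ι]
  · intro h₁ H
    have := hh' _ ((key h₁).1 H)
    ext r
    · simp [← this, ι]

theorem AutIsFlat.pullback (hf : IsPullback k g A' f) (h : AutIsFlat k g A E) :
    AutIsFlat k g A' E' := by
  obtain ⟨R, _, _, hR, _⟩ := h
  exact ⟨A' ⊗[A] R, inferInstance, inferInstance, hR.pullback k g hf, inferInstance⟩

end Stability

/-- Nondegenerate nilpotent representations are stable under pullback. -/
theorem IsNondegenerate.pullback (k : Type u) [Field k] (g : Type u) [LieRing g] [LieAlgebra k g]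
    (n : ℕ) {A A' : Type u} [CommRing A] [Algebra k A] [CommRing A'] [Algebra k A']
    [Algebra A A'] [IsScalarTower k A A']
    {E E' : Type u} [AddCommGroup E] [Module A E] [LieRingModule (A ⊗[k] g) E]
    [LieModule A (A ⊗[k] g) E] [AddCommGroup E'] [Module A E'] [Module A' E']
    [IsScalarTower A A' E'] [LieRingModule (A' ⊗[k] g) E'] [LieModule A' (A' ⊗[k] g) E']
    {f : E →ₗ[A] E'} (hf : IsPullback k g A' f) (h : IsNondegenerate k g n A E) :
    IsNondegenerate k g n A' E' := by
  induction n generalizing E E' with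
  | zero => exact IsFlag.pullback k g h hf
  | succ n ih =>
    obtain ⟨h1, h2, h3, h4, h5⟩ := h
    refine ⟨h1.pullback k g hf, ih (filMap_isPullback k g h1 hf n) h2,
      ih (quotMap_isPullback k g h1 hf 1) h3, ?_, h5.pullback k g hf⟩
    intro K _ _ _ _ E'' _ _ _ _ _ _ f' hf'
    let _ : Algebra A K := ((algebraMap A' K).comp (algebraMap A A')).toAlgebra
    have : IsScalarTower A A' K := IsScalarTower.of_algebraMap_eq fun _ => rfl
    have : IsScalarTower k A K := IsScalarTower.of_algebraMap_eq fun x => by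
      rw [IsScalarTower.algebraMap_apply k A' K, IsScalarTower.algebraMap_apply k A A']; rfl
    let _ : Module A E'' := Module.compHom E'' (algebraMap A K)
    have : IsScalarTower A K E'' := ⟨fun a b c => by
      rw [Algebra.smul_def, mul_smul]; rfl⟩
    have : IsScalarTower A A' E'' := ⟨fun a b c => by
      rw [Algebra.smul_def, mul_smul, ← IsScalarTower.algebraMap_smul K (algebraMap A A' a)]
      rfl⟩
    exact h4 K E'' _ (hf.trans k g hf')

section Moduli

variable (k : Type u) [Field k] (g : Type u) [LieRing g] [LieAlgebra k g]

/-- Representations of `g_A = A ⊗ g` on `A`-modules. -/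
structure Rep (A : Type u) [CommRing A] [Algebra k A] where
  carrier : Type u
  [addCommGroup : AddCommGroup carrier]
  [module : Module A carrier]
  [lieRingModule : LieRingModule (A ⊗[k] g) carrier]
  [lieModule : LieModule A (A ⊗[k] g) carrier]

attribute [instance] Rep.addCommGroup Rep.module Rep.lieRingModule Rep.lieModule

/-- The action of `g_B` on `B ⊗ E` extending that of `g`. -/
def pullbackAction (A : Type u) [CommRing A] [Algebra k A] (B : Type u) [CommRing B] [Algebra k B]
    [Algebra A B] [IsScalarTower k A B] (E : Type u) [AddCommGroup E] [Module A E]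
    [LieRingModule (A ⊗[k] g) E] [LieModule A (A ⊗[k] g) E] :
    (B ⊗[k] g) →ₗ[B] Module.End B (B ⊗[A] E) :=
  LinearMap.liftBaseChange B
    ({ toFun := fun x => (LieModule.toEnd A (A ⊗[k] g) E (1 ⊗ₜ[k] x)).baseChange B
       map_add' := fun x y => by
        rw [TensorProduct.tmul_add, map_add, LinearMap.baseChange_add]
       map_smul' := fun c x => by
        have : (1 : A) ⊗ₜ[k] (c • x) = algebraMap k A c • ((1 : A) ⊗ₜ[k] x) := by
          rw [TensorProduct.tmul_smul, algebraMap_smul]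
        rw [this, map_smul, LinearMap.baseChange_smul, algebraMap_smul]
        rfl } : g →ₗ[k] Module.End B (B ⊗[A] E))

theorem pullbackAction_tmul (A : Type u) [CommRing A] [Algebra k A] (B : Type u) [CommRing B]
    [Algebra k B] [Algebra A B] [IsScalarTower k A B] (E : Type u) [AddCommGroup E] [Module A E]
    [LieRingModule (A ⊗[k] g) E] [LieModule A (A ⊗[k] g) E] (b c : B) (x : g) (e : E) :
    pullbackAction k g A B E (b ⊗ₜ x) (c ⊗ₜ e) = (b * c) ⊗ₜ ⁅(1 : A) ⊗ₜ[k] x, e⁆ := by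
  simp [pullbackAction, TensorProduct.smul_tmul']

/-- The representation of `g_B` on `B ⊗ E`. -/
@[reducible] def pullbackLieRingModule (A : Type u) [CommRing A] [Algebra k A] (B : Type u) [CommRing B]
    [Algebra k B] [Algebra A B] [IsScalarTower k A B] (E : Type u) [AddCommGroup E] [Module A E]
    [LieRingModule (A ⊗[k] g) E] [LieModule A (A ⊗[k] g) E] :
    LieRingModule (B ⊗[k] g) (B ⊗[A] E) where
  bracket y z := pullbackAction k g A B E y z
  add_lie y y' z := by rw [map_add]; rfl
  lie_add y z z' := map_add _ _ _
  leibniz_lie x y z := by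
    induction x with
    | zero => simp
    | add a b ha hb =>
      simp only [map_add, add_lie, LinearMap.add_apply] at ha hb ⊢
      rw [ha, hb]; abel
    | tmul b x =>
      induction y with
      | zero => simp
      | add a b ha hb =>
        simp only [map_add, lie_add, LinearMap.add_apply] at ha hb ⊢
        rw [ha, hb]; abel
      | tmul c y =>
        induction z with
        | zero => simp
        | add a b ha hb =>
          simp only [map_add] at ha hb ⊢
          rw [ha, hb]; abel
        | tmul d e =>
          have : (1 : A) ⊗ₜ[k] ⁅x, y⁆ = ⁅(1 : A) ⊗ₜ[k] x, (1 : A) ⊗ₜ[k] y⁆ := by simp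
          rw [LieAlgebra.ExtendScalars.bracket_tmul]
          simp only [pullbackAction_tmul, this, lie_lie, TensorProduct.tmul_sub]
          rw [mul_assoc, mul_left_comm c b d, sub_add_cancel]

theorem pullbackLieModule (A : Type u) [CommRing A] [Algebra k A] (B : Type u) [CommRing B]
    [Algebra k B] [Algebra A B] [IsScalarTower k A B] (E : Type u) [AddCommGroup E] [Module A E]
    [LieRingModule (A ⊗[k] g) E] [LieModule A (A ⊗[k] g) E] :
    @LieModule B (B ⊗[k] g) (B ⊗[A] E) _ _ _ _ _ (pullbackLieRingModule k g A B E) :=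
  let _ := pullbackLieRingModule k g A B E
  { smul_lie := fun b y z => by
      change pullbackAction k g A B E (b • y) z = b • pullbackAction k g A B E y z
      rw [map_smul]; rfl
    lie_smul := fun b y z => map_smul (pullbackAction k g A B E y) b z }

variable {k g}

/-- The pullback of a representation along `Spec B → Spec A`. -/
def Rep.pullback {A : Type u} [CommRing A] [Algebra k A] (M : Rep k g A) (B : Type u) [CommRing B]
    [Algebra k B] [Algebra A B] [IsScalarTower k A B] : Rep k g B :=
  letI := pullbackLieRingModule k g A B M.carrier
  letI := pullbackLieModule k g A B M.carrier
  { carrier := B ⊗[A] M.carrier }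

instance {A : Type u} [CommRing A] [Algebra k A] (M : Rep k g A) (B : Type u) [CommRing B]
    [Algebra k B] [Algebra A B] [IsScalarTower k A B] : Module A (M.pullback B).carrier :=
  inferInstanceAs (Module A (B ⊗[A] M.carrier))

instance {A : Type u} [CommRing A] [Algebra k A] (M : Rep k g A) (B : Type u) [CommRing B]
    [Algebra k B] [Algebra A B] [IsScalarTower k A B] :
    IsScalarTower A B (M.pullback B).carrier :=
  inferInstanceAs (IsScalarTower A B (B ⊗[A] M.carrier))

/-- The canonical map `E → B ⊗ E`. -/
def Rep.toPullback {A : Type u} [CommRing A] [Algebra k A] (M : Rep k g A) (B : Type u)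
    [CommRing B] [Algebra k B] [Algebra A B] [IsScalarTower k A B] :
    M.carrier →ₗ[A] (M.pullback B).carrier :=
  TensorProduct.mk A B M.carrier 1

theorem Rep.toPullback_isPullback {A : Type u} [CommRing A] [Algebra k A] (M : Rep k g A)
    (B : Type u) [CommRing B] [Algebra k B] [Algebra A B] [IsScalarTower k A B] :
    IsPullback k g B (M.toPullback B) where
  isBaseChange := TensorProduct.isBaseChange A M.carrier B
  map_lie x e := by
    refine Eq.trans ?_ (pullbackAction_tmul k g A B M.carrier 1 1 x e).symm
    rw [mul_one]; rfl

/-- Isomorphism of representations. -/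
def Rep.Iso {A : Type u} [CommRing A] [Algebra k A] (M N : Rep k g A) : Prop :=
  Nonempty (M.carrier ≃ₗ⁅A, A ⊗[k] g⁆ N.carrier)

/-- Two pullbacks of isomorphic representations are isomorphic. -/
theorem IsPullback.iso {A B : Type u} [CommRing A] [Algebra k A] [CommRing B] [Algebra k B]
    [Algebra A B] {M M' : Rep k g A} {N N' : Rep k g B} [Module A N.carrier]
    [IsScalarTower A B N.carrier] [Module A N'.carrier] [IsScalarTower A B N'.carrier]
    {f : M.carrier →ₗ[A] N.carrier} (hf : IsPullback k g B f)
    {f' : M'.carrier →ₗ[A] N'.carrier} (hf' : IsPullback k g B f') (h : M.Iso M') :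
    N.Iso N' := by
  obtain ⟨φ⟩ := h
  let e : N.carrier ≃ₗ[B] N'.carrier :=
    hf.isBaseChange.equiv.symm ≪≫ₗ TensorProduct.AlgebraTensorModule.congr (LinearEquiv.refl B B)
      φ.toLinearEquiv ≪≫ₗ hf'.isBaseChange.equiv
  have he (m : M.carrier) : e (f m) = f' (φ m) := by
    simp [e, IsBaseChange.equiv_symm_apply, IsBaseChange.equiv_tmul]
  refine ⟨{ e with map_lie' := ?_ }⟩
  intro y z
  change e ⁅y, z⁆ = ⁅y, e z⁆
  induction y with
  | zero => simp
  | add a b ha hb => simp only [add_lie, map_add, ha, hb]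
  | tmul b x =>
    have hb : b ⊗ₜ[k] x = b • ((1 : B) ⊗ₜ[k] x) := by
      rw [TensorProduct.smul_tmul', smul_eq_mul, mul_one]
    rw [hb, smul_lie, smul_lie, map_smul]
    congr 1
    induction z using hf.isBaseChange.inductionOn with
    | zero => simp
    | tmul m => rw [← hf.map_lie, he, he, ← hf'.map_lie]; exact congrArg f' (φ.toLieModuleHom.map_lie _ _)
    | smul s m ih => rw [lie_smul, map_smul, map_smul, lie_smul, ih]
    | add a b ha hb => simp only [lie_add, map_add, ha, hb]

/-- A pullback along the identity is isomorphic to the representation itself. -/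
theorem Rep.iso_of_isPullback_id {A : Type u} [CommRing A] [Algebra k A] {M N : Rep k g A}
    {i : Algebra A A} (hi : @algebraMap A A _ _ i = RingHom.id A) {m : Module A N.carrier}
    {t : @IsScalarTower A A N.carrier i.toSMul N.module.toSMul m.toSMul}
    {f : @LinearMap A A _ _ (RingHom.id A) M.carrier N.carrier _ _ _ m}
    (hf : @IsPullback k _ g _ _ A A _ _ _ _ i M.carrier N.carrier _ _ _ _ m N.module t _ f) :
    N.Iso M := by
  obtain rfl : i = Algebra.id A := Algebra.algebra_ext _ _ fun r => RingHom.congr_fun hi r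
  have : IsScalarTower A A M.carrier := inferInstance
  have h : IsPullback k g A (LinearMap.id : M.carrier →ₗ[A] M.carrier) :=
    ⟨IsBaseChange.ofEquiv (LinearEquiv.refl A M.carrier), fun _ _ => rfl⟩
  exact @IsPullback.iso k _ g _ _ A A _ _ _ _ (Algebra.id A) M M N M m t M.module this f hf _ h
    ⟨LieModuleEquiv.refl⟩

variable (k g)

/-- Nondegenerate nilpotent representations of rank `n` over `Spec A`: the objects over `Spec A`
of the fibered category `𝓜_n^nd(g)`. -/
def NdRep (n : ℕ) (A : Type u) [CommRing A] [Algebra k A] : Type (u + 1) :=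
  {M : Rep k g A // IsNondegenerate k g n A M.carrier}

instance ndSetoid (n : ℕ) (A : Type u) [CommRing A] [Algebra k A] : Setoid (NdRep k g n A) where
  r M N := M.1.Iso N.1
  iseqv :=
    { refl := fun _ => ⟨LieModuleEquiv.refl⟩
      symm := fun ⟨φ⟩ => ⟨φ.symm⟩
      trans := fun ⟨φ⟩ ⟨ψ⟩ => ⟨φ.trans ψ⟩ }

variable {k g}

/-- Pullback of nondegenerate nilpotent representations. -/
def NdRep.pullback {n : ℕ} {A B : Type u} [CommRing A] [Algebra k A] [CommRing B] [Algebra k B]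
    (φ : A →ₐ[k] B) (M : NdRep k g n A) : NdRep k g n B :=
  letI := φ.toRingHom.toAlgebra
  haveI : IsScalarTower k A B := IsScalarTower.of_algebraMap_eq fun x => (φ.commutes x).symm
  ⟨M.1.pullback B, IsNondegenerate.pullback k g n (M.1.toPullback_isPullback B) M.2⟩

variable (k g)

/-- `A ↦ π₀ (𝓜_n^nd(g) (Spec A))`: the functor of isomorphism classes of nondegenerate nilpotent
representations of rank `n`. -/
def pi0 (n : ℕ) : CommAlgCat.{u} k ⥤ Type (u + 1) where
  obj A := Quotient (ndSetoid k g n A)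
  map {A B} φ := ↾(Quotient.map (NdRep.pullback φ.hom) (by
    intro M N h
    let _ := φ.hom.toRingHom.toAlgebra
    have : IsScalarTower k A B := IsScalarTower.of_algebraMap_eq fun x => (φ.hom.commutes x).symm
    exact IsPullback.iso (N := M.1.pullback B) (N' := N.1.pullback B)
      (M.1.toPullback_isPullback B) (N.1.toPullback_isPullback B) h))
  map_id A := by
    ext x
    obtain ⟨M, rfl⟩ := Quotient.exists_rep x
    apply Quotient.sound
    let inst : Algebra A A := (AlgHom.id k A).toRingHom.toAlgebra
    exact Rep.iso_of_isPullback_id (N := (NdRep.pullback (AlgHom.id k A) M).1) (i := inst) rfl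
      (@Rep.toPullback_isPullback k _ g _ _ A _ _ M.1 A _ _ inst
        (IsScalarTower.of_algebraMap_eq fun x => rfl))
  map_comp {A B C} φ ψ := by
    ext x
    obtain ⟨M, rfl⟩ := Quotient.exists_rep x
    apply Quotient.sound
    let _ := φ.hom.toRingHom.toAlgebra
    let _ := ψ.hom.toRingHom.toAlgebra
    let _ := (ψ.hom.comp φ.hom).toRingHom.toAlgebra
    have : IsScalarTower k A B := IsScalarTower.of_algebraMap_eq fun x => (φ.hom.commutes x).symm
    have : IsScalarTower k B C := IsScalarTower.of_algebraMap_eq fun x => (ψ.hom.commutes x).symm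
    have : IsScalarTower k A C := IsScalarTower.of_algebraMap_eq fun x =>
      ((ψ.hom.comp φ.hom).commutes x).symm
    have : IsScalarTower A B C := IsScalarTower.of_algebraMap_eq fun x => rfl
    let N := M.1.pullback B
    let _ : Module A (N.pullback C).carrier := Module.compHom _ (algebraMap A C)
    have : IsScalarTower A C (N.pullback C).carrier := ⟨fun a b c => by
      rw [Algebra.smul_def, mul_smul]; rfl⟩
    have : IsScalarTower A B (N.pullback C).carrier := ⟨fun a b c => by
      rw [Algebra.smul_def, mul_smul, ← IsScalarTower.algebraMap_smul C (algebraMap A B a)]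
      rfl⟩
    exact IsPullback.iso (N := M.1.pullback C) (N' := N.pullback C) (M.1.toPullback_isPullback C)
      ((M.1.toPullback_isPullback B).trans k g (N.toPullback_isPullback C)) ⟨LieModuleEquiv.refl⟩

end Moduli

section Site

variable (k : Type u) [Field k]

/-- The functor `A ↦ Spec A` from affine `k`-schemes, i.e. the opposite of the category of
commutative `k`-algebras, to schemes. -/
def affineToScheme : (CommAlgCat.{u} k)ᵒᵖ ⥤ Scheme.{u} :=
  (forget₂ (CommAlgCat.{u} k) CommRingCat.{u}).op ⋙ Scheme.Spec

/-- The fppf topology on affine `k`-schemes: the coverings are generated by the jointly surjective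
families of flat morphisms locally of finite presentation. -/
def fppf : GrothendieckTopology (CommAlgCat.{u} k)ᵒᵖ :=
  (Scheme.fppfPrecoverage.{u}.comap (affineToScheme k)).toGrothendieck

variable (g : Type u) [LieRing g] [LieAlgebra k g]

/-- The presheaf on affine `k`-schemes of isomorphism classes of nondegenerate nilpotent
representations of rank `n`. -/
def pi0Presheaf (n : ℕ) : (CommAlgCat.{u} k)ᵒᵖᵒᵖ ⥤ Type (u + 1) :=
  unopUnop (CommAlgCat.{u} k) ⋙ pi0 k g n

/-- The moduli space `M_n^nd(g)`: the fppf sheaf associated to the presheaf of isomorphism classes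
of `n`-dimensional nondegenerate nilpotent representations. -/
def moduliSpace (n : ℕ) : Sheaf (fppf k) (Type (u + 1)) :=
  (presheafToSheaf (fppf k) (Type (u + 1))).obj (pi0Presheaf k g n)

/-- The class in the moduli space of a nondegenerate nilpotent representation over `Spec A`. -/
def moduliSpace.mk (n : ℕ) (A : CommAlgCat.{u} k) (M : NdRep k g n A) :
    (moduliSpace k g n).obj.obj (op (op A)) :=
  (toSheafify (fppf k) (pi0Presheaf k g n)).app (op (op A)) (Quotient.mk (ndSetoid k g n A) M)

end Site

section SymmetricAlgebra

open scoped DirectSum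

variable (k : Type u) [Field k] (V : Type u) [AddCommGroup V] [Module k V]

/-- The homogeneous piece `Symⁱ V` of the symmetric algebra. -/
abbrev symPow (i : ℕ) : Submodule k (SymmetricAlgebra k V) :=
  LinearMap.range (SymmetricAlgebra.ι k V) ^ i

instance symPow.gradedMonoid : SetLike.GradedMonoid (symPow k V) :=
  Submodule.nat_power_gradedMonoid (LinearMap.range (SymmetricAlgebra.ι k V))

/-- The inclusion of `V` in degree one. -/
def symPow.ι : V →ₗ[k] ⨁ i : ℕ, symPow k V i :=
  DirectSum.lof k ℕ (fun i => symPow k V i) 1 ∘ₗ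
    (SymmetricAlgebra.ι k V).codRestrict _ fun m => by
      simpa only [symPow, pow_one] using LinearMap.mem_range_self _ m

theorem symPow.ι_apply (m : V) :
    symPow.ι k V m = DirectSum.of (fun i : ℕ => symPow k V i) 1
      ⟨SymmetricAlgebra.ι k V m, by
        simpa only [symPow, pow_one] using LinearMap.mem_range_self _ m⟩ :=
  rfl

/-- The decomposition of the symmetric algebra. -/
def symPow.lift : SymmetricAlgebra k V →ₐ[k] ⨁ i : ℕ, symPow k V i :=
  SymmetricAlgebra.lift (symPow.ι k V)

theorem symPow.lift_eq (i : ℕ) (x : symPow k V i) :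
    symPow.lift k V x = DirectSum.of (fun i => symPow k V i) i x := by
  obtain ⟨x, hx⟩ := x
  dsimp only
  induction hx using Submodule.pow_induction_on_left' with
  | algebraMap => simp_rw [AlgHom.commutes, DirectSum.algebraMap_apply]; rfl
  | add _ _ _ _ _ ihx ihy => simp_rw [map_add, ihx, ihy, ← map_add]; rfl
  | mem_mul _ hm _ _ _ ih =>
      obtain ⟨_, rfl⟩ := hm
      simp_rw [map_mul, ih, symPow.lift, SymmetricAlgebra.lift_ι_apply, symPow.ι_apply k V,
        DirectSum.of_mul_of]
      exact DirectSum.of_eq_of_gradedMonoid_eq (Sigma.subtype_ext (add_comm _ _) rfl)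

instance symPow.gradedAlgebra : GradedAlgebra (symPow k V) :=
  GradedAlgebra.ofAlgHom _ (symPow.lift k V)
    (by
      refine SymmetricAlgebra.algHom_ext (LinearMap.ext fun m => ?_)
      change DirectSum.coeAlgHom (symPow k V) (symPow.lift k V (SymmetricAlgebra.ι k V m)) =
        SymmetricAlgebra.ι k V m
      rw [symPow.lift, SymmetricAlgebra.lift_ι_apply, symPow.ι_apply k V,
        DirectSum.coeAlgHom_of])
    (symPow.lift_eq k V)

/-- The projective space `ℙ V = Proj (Sym V)`, -/
abbrev projSpace : Scheme.{u} := Proj (symPow k V)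

/-- with its structure morphism to `Spec k`. -/
def projSpace.toSpec : projSpace k V ⟶ Spec (.of k) :=
  Proj.toSpecZero (symPow k V) ≫ Spec.map (CommRingCat.ofHom (algebraMap k (symPow k V 0)))

/-- The structure morphism of `Spec A` for a `k`-algebra `A`. -/
abbrev structureMap (A : Type u) [CommRing A] [Algebra k A] : Spec (.of A) ⟶ Spec (.of k) :=
  Spec.map (CommRingCat.ofHom (algebraMap k A))

/-- The functor of points of `ℙ V` on affine `k`-schemes: `A ↦ ℙ V (Spec A)`, the set of morphisms
`Spec A → ℙ V` over `Spec k`. -/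
def projSpace.points : (CommAlgCat.{u} k)ᵒᵖᵒᵖ ⥤ Type (u + 1) :=
  unopUnop (CommAlgCat.{u} k) ⋙
    { obj A := ULift.{u + 1} {p : Spec (.of A) ⟶ projSpace k V //
        p ≫ projSpace.toSpec k V = structureMap k A}
      map {A B} φ := ↾fun p => ⟨Spec.map (CommRingCat.ofHom φ.hom.toRingHom) ≫ p.down.1, by
        rw [Category.assoc, p.down.2, ← Spec.map_comp, ← CommRingCat.ofHom_comp]
        congr 2
        exact φ.hom.comp_algebraMap⟩
      map_id A := by
        ext p
        change Spec.map (𝟙 _) ≫ _ = _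
        rw [Spec.map_id, Category.id_comp]
        rfl
      map_comp {A B C} φ ψ := by
        ext p
        change Spec.map (CommRingCat.ofHom φ.hom.toRingHom ≫ CommRingCat.ofHom ψ.hom.toRingHom) ≫ _ =
          Spec.map _ ≫ Spec.map _ ≫ _
        rw [Spec.map_comp, Category.assoc] }

variable {k V}

/-- The homomorphism `Sym V → A → Γ(Spec A)` induced by a linear map `V → A`. -/
def symToΓ {A : Type u} [CommRing A] [Algebra k A] (l : V →ₗ[k] A) :
    SymmetricAlgebra k V →+* Γ(Spec (.of A), ⊤) :=
  (Scheme.ΓSpecIso (.of A)).inv.hom.comp (SymmetricAlgebra.lift l).toRingHom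

theorem map_irrelevant_symToΓ {A : Type u} [CommRing A] [Algebra k A] (l : V →ₗ[k] A)
    (hl : Ideal.span (Set.range l) = ⊤) :
    (HomogeneousIdeal.irrelevant (symPow k V)).toIdeal.map (symToΓ l) = ⊤ := by
  have h : (HomogeneousIdeal.irrelevant (symPow k V)).toIdeal.map
      (SymmetricAlgebra.lift l).toRingHom = ⊤ := by
    rw [eq_top_iff, ← hl, Ideal.span_le]
    rintro _ ⟨v, rfl⟩
    have : (SymmetricAlgebra.lift l).toRingHom (SymmetricAlgebra.ι k V v) = l v :=
      SymmetricAlgebra.lift_ι_apply l v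
    rw [← this]
    refine Ideal.mem_map_of_mem _ (HomogeneousIdeal.mem_irrelevant_of_mem _ one_pos ?_)
    rw [symPow, pow_one]
    exact LinearMap.mem_range_self _ v
  rw [symToΓ, ← Ideal.map_map, h, Ideal.map_top]

theorem fromOfGlobalSections_symToΓ {A : Type u} [CommRing A] [Algebra k A] (l : V →ₗ[k] A)
    (hl : Ideal.span (Set.range l) = ⊤) :
    Proj.fromOfGlobalSections (symPow k V) (symToΓ l) (map_irrelevant_symToΓ l hl) ≫
      projSpace.toSpec k V = structureMap k A := by
  rw [projSpace.toSpec, ← Category.assoc, Proj.fromOfGlobalSections_toSpecZero, Category.assoc,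
    structureMap, ← Spec.map_comp, ← CommRingCat.ofHom_comp]
  have : ((symToΓ l).comp (algebraMap (symPow k V 0) (SymmetricAlgebra k V))).comp
      (algebraMap k (symPow k V 0)) =
      (Scheme.ΓSpecIso (.of A)).inv.hom.comp (algebraMap k A) := by
    ext c
    exact congrArg (Scheme.ΓSpecIso (.of A)).inv.hom ((SymmetricAlgebra.lift l).commutes c)
  rw [this, CommRingCat.ofHom_comp, Spec.map_comp]
  simp

/-- The point `[l]` of `ℙ V` over `Spec A` given by a linear map `l : V → A` whose values generate
the unit ideal, i.e. by the invertible quotient `A ⊗ V → A` of `V`. -/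
def projSpace.point (A : CommAlgCat.{u} k) (l : V →ₗ[k] A) (hl : Ideal.span (Set.range l) = ⊤) :
    (projSpace.points k V).obj (op (op A)) :=
  ⟨Proj.fromOfGlobalSections (symPow k V) (symToΓ l) (map_irrelevant_symToΓ l hl),
    fromOfGlobalSections_symToΓ l hl⟩

end SymmetricAlgebra

/-- The abelianization `g / [g, g]`. -/
abbrev ab (k : Type u) [Field k] (g : Type u) [LieRing g] [LieAlgebra k g] : Type u :=
  g ⧸ LieAlgebra.derivedSeries k g 1

end NilpotentModuli
end

/-! In rank two the nondegeneracy conditions beyond being a flag hold automatically, once the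
representation is in standard form. Choose a generator `e₀` of `Fil₁` and a lift `e₁` of a generator
of `E / Fil₁`. Then `g` kills `e₀` and sends `e₁` to `l(x) e₀`. The functional `l` factors through
the abelianization because a commutator kills `e₁`, and its values generate the unit ideal because
at a closed point where they all vanish `Fil₁` would jump to rank two
(`IsStandard.span_range_eq_top`).

Conversely let `l` be unimodular. Then `x` acts as `l(x) N` with `N : e₁ ↦ e₀`, and automorphisms
are exactly the elements `t + s N` with `t` invertible. So the automorphism scheme is `𝔾ₘ × 𝔾ₐ`,
with ring `A[T;T⁻¹][X]` (`IsStandard.representsAut`). It is flat over `A`, and over every field it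
has dimension two, so minimality excludes nothing. Hence standard representations with `l`
unimodular are nondegenerate (`IsStandard.isNondegenerate`). Every nondegenerate representation of
rank two becomes standard locally on the base (`IsNondegenerate.exists_isStandard`), and two
standard ones are isomorphic exactly when their functionals differ by a unit.

Let `U` be the presheaf of unimodular functionals modulo units. It maps to isomorphism classes of
representations (`unimodularToPi0`) and to the points of projective space (`unimodularToPoints`).
Both maps are locally injective and locally surjective. For projective space this is seen in the
charts `v ≠ 0`, where the point `[l]` has coordinates `w / v ↦ l(w) / l(v)`. The points of
projective space already form an fppf sheaf, since representable functors do. So the moduli space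
and projective space are both sheafifications of `U`, which gives an isomorphism compatible with the
maps from `U`. The condition on classes of standard representations is precisely this compatibility
(`compatible_iff`), hence uniqueness. -/

noncomputable section

namespace NilpotentModuli

/-! ### Fppf sheaves on affine schemes over `k` -/

section Site

open Limits

variable (k : Type u) [Field k]

/-- `CommAlgCat k` is the category of rings under `k`, and forgetting the structure map preserves
pushouts. Dually, `affineToScheme` preserves fibre products, which is what its continuity needs. -/
instance : PreservesColimitsOfShape WalkingSpan (forget₂ (CommAlgCat.{u} k) CommRingCat.{u}) :=
  let e : (commAlgCatEquivUnder (CommRingCat.of k)).functor ⋙ Under.forget (CommRingCat.of k) ≅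
      forget₂ (CommAlgCat.{u} k) CommRingCat.{u} :=
    NatIso.ofComponents (fun A => Iso.refl (CommRingCat.of A)) fun _ => rfl
  preservesColimitsOfShape_of_natIso e

instance : PreservesLimitsOfShape WalkingCospan (forget₂ (CommAlgCat.{u} k) CommRingCat.{u}).op :=
  have : PreservesColimitsOfShape WalkingCospanᵒᵖ
      (forget₂ (CommAlgCat.{u} k) CommRingCat.{u}) :=
    preservesColimitsOfShape_of_equiv walkingCospanOpEquiv.symm _
  preservesLimitsOfShape_op _ _

instance : PreservesLimitsOfShape WalkingCospan (affineToScheme.{u} k) :=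
  inferInstanceAs (PreservesLimitsOfShape WalkingCospan (_ ⋙ Scheme.Spec))

instance affineToScheme_isContinuous :
    Functor.IsContinuous (affineToScheme.{u} k) (fppf k) Scheme.fppfTopology.{u} :=
  Functor.isContinuous_toGrothendieck_of_pullbacksPreservedBy _ _ _ le_rfl

/-- The fppf topology on schemes is subcanonical, and restriction along a continuous functor
preserves sheaves. -/
theorem isSheaf_affineToScheme_yoneda (Y : Scheme.{u}) :
    Presieve.IsSheaf (fppf k) ((affineToScheme.{u} k).op ⋙ yoneda.obj Y) := by
  have h : Presheaf.IsSheaf Scheme.fppfTopology.{u} (yoneda.obj Y) := by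
    rw [isSheaf_iff_isSheaf_of_type]
    exact GrothendieckTopology.Subcanonical.isSheaf_of_isRepresentable _
  rw [← isSheaf_iff_isSheaf_of_type]
  exact Functor.op_comp_isSheaf (affineToScheme k) (fppf k) Scheme.fppfTopology ⟨_, h⟩

/-- Matching families glue as morphisms to the scheme `ℙ V`. The glued morphism lies over `Spec k`
because that equality of morphisms to `Spec k` can be tested on the cover. -/
theorem projSpace.isSheaf_points (V : Type u) [AddCommGroup V] [Module k V] :
    Presheaf.IsSheaf (fppf k) (projSpace.points k V) := by
  rw [isSheaf_iff_isSheaf_of_type]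
  intro X S hS x hx
  have hP := isSheaf_affineToScheme_yoneda k (projSpace k V) S hS
  have hk := (isSheaf_affineToScheme_yoneda k (Spec (.of k)) S hS).isSeparatedFor
  obtain ⟨t, ht, htu⟩ := hP (fun Y f hf => (x f hf).down.1) (fun Y₁ Y₂ Z g₁ g₂ f₁ f₂ h₁ h₂ e =>
    congrArg (fun z => z.down.1) (hx g₁ g₂ h₁ h₂ e))
  have ht' : t ≫ projSpace.toSpec k V = structureMap k X.unop := by
    refine hk.ext fun Y f hf => ?_
    let a : Spec (.of Y.unop) ⟶ Spec (.of X.unop) :=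
      Spec.map (CommRingCat.ofHom f.unop.hom.toRingHom)
    let p : Spec (.of X.unop) ⟶ projSpace k V := t
    have h1 : a ≫ p = (x f hf).down.1 := ht f hf
    have h2 : a ≫ structureMap k X.unop = structureMap k Y.unop := by
      rw [structureMap, structureMap, ← Spec.map_comp, ← CommRingCat.ofHom_comp]
      congr 2
      exact f.unop.hom.comp_algebraMap
    have h3 : a ≫ p ≫ projSpace.toSpec k V = a ≫ structureMap k X.unop := by
      rw [← Category.assoc, h1, (x f hf).down.2, h2]
    exact h3
  refine ⟨⟨t, ht'⟩, fun Y f hf => ?_, fun s hs => ?_⟩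
  · exact ULift.ext _ _ (Subtype.ext (ht f hf))
  · refine ULift.ext _ _ (Subtype.ext (htu _ fun Y f hf => ?_))
    exact congrArg (fun z => z.down.1) (hs f hf)

/-- A sieve is an fppf covering as soon as it contains basic opens around all points. -/
theorem fppf_mem_of_basicOpen (A : CommAlgCat.{u} k) (S : Sieve (op A))
    (h : ∀ p : PrimeSpectrum A, ∃ f : A, f ∉ p.asIdeal ∧
      S (Quiver.Hom.op (CommAlgCat.ofHom (Algebra.algHom k A (Localization.Away f))))) :
    S ∈ fppf k (op A) := by
  choose f hf hS using h
  let π (p : PrimeSpectrum A) : op (CommAlgCat.of k (Localization.Away (f p))) ⟶ op A :=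
    Quiver.Hom.op (CommAlgCat.ofHom (Algebra.algHom k A (Localization.Away (f p))))
  refine GrothendieckTopology.superset_covering _ (S := Sieve.generate (Presieve.ofArrows _ π)) ?_
    (Precoverage.generate_mem_toGrothendieck ?_)
  · rw [Sieve.generate_le_iff]
    rintro _ _ ⟨p⟩
    exact hS p
  · rw [Precoverage.mem_comap_iff, Presieve.map_ofArrows]
    refine (Scheme.ofArrows_mem_precoverage_iff _).2 ⟨fun p => ⟨p, ?_⟩, fun p => ?_⟩
    · have h := PrimeSpectrum.localization_away_comap_range (Localization.Away (f p)) (f p)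
      change p ∈ Set.range (PrimeSpectrum.comap (algebraMap A (Localization.Away (f p))))
      rw [h]
      exact hf p
    · have : IsOpenImmersion ((affineToScheme k).map (π p)) :=
        inferInstanceAs (IsOpenImmersion
          (Spec.map (CommRingCat.ofHom (algebraMap A (Localization.Away (f p))))))
      exact ⟨inferInstance, inferInstance⟩

end Site

/-! ### Morphisms to `Proj` that land in a basic open -/

section Proj

open HomogeneousLocalization

variable {σ R : Type u} [CommRing R] [SetLike σ R] [AddSubgroupClass σ R] (𝒜 : ℕ → σ)
  [GradedRing 𝒜]

/-- The homomorphism from the degree zero part of `R_r` induced by one inverting `r`. -/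
def awayLift {B : Type u} [CommRing B] (ψ : R →+* B) (r : R) (hu : IsUnit (ψ r)) :
    Away 𝒜 r →+* B :=
  (IsLocalization.Away.lift (S := Localization.Away r) r hu).comp
    (algebraMap (Away 𝒜 r) (Localization.Away r))

theorem comp_awayLift {B C : Type u} [CommRing B] [CommRing C] (ψ : R →+* B) (r : R)
    (hu : IsUnit (ψ r)) (χ : B →+* C) :
    χ.comp (awayLift 𝒜 ψ r hu) = awayLift 𝒜 (χ.comp ψ) r (hu.map χ) := by
  rw [awayLift, awayLift, ← RingHom.comp_assoc]
  congr 1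
  refine IsLocalization.ringHom_ext (M := .powers r) ?_
  ext x
  simp

/-- Fractions `x / rⁿ` are handled through this denominator-free identity, which determines them by
`away_ext`. -/
theorem algebraMap_away_mk {r : R} {d : ℕ} (hd : r ∈ 𝒜 d) (n : ℕ) (x : R) (hx : x ∈ 𝒜 (n • d)) :
    algebraMap (Away 𝒜 r) (Localization.Away r) (Away.mk 𝒜 hd n x hx) *
      algebraMap R (Localization.Away r) r ^ n = algebraMap R (Localization.Away r) x := by
  rw [HomogeneousLocalization.algebraMap_apply, Away.val_mk, Localization.mk_eq_mk', ← map_pow]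
  exact IsLocalization.mk'_spec (M := .powers r) _ x ⟨r ^ n, n, rfl⟩

theorem awayLift_mk {B : Type u} [CommRing B] (ψ : R →+* B) (r : R) (hu : IsUnit (ψ r)) {d : ℕ}
    (hd : r ∈ 𝒜 d) (n : ℕ) (x : R) (hx : x ∈ 𝒜 (n • d)) :
    awayLift 𝒜 ψ r hu (Away.mk 𝒜 hd n x hx) * ψ r ^ n = ψ x := by
  simpa [awayLift] using congrArg (IsLocalization.Away.lift (S := Localization.Away r) r hu)
    (algebraMap_away_mk 𝒜 hd n x hx)

theorem away_ext {r : R} (n : ℕ) {x y : Away 𝒜 r}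
    (h : algebraMap (Away 𝒜 r) (Localization.Away r) x * algebraMap R (Localization.Away r) r ^ n =
      algebraMap (Away 𝒜 r) (Localization.Away r) y *
        algebraMap R (Localization.Away r) r ^ n) : x = y :=
  HomogeneousLocalization.val_injective _
    (((IsLocalization.Away.algebraMap_isUnit r).pow n).mul_right_cancel h)

/-- Where the pulled-back section `f r` is invertible, the morphism to `Proj` lands in the chart `r
≠ 0`, and the gluing construction identifies it there with the map induced by inverting `r`. -/
theorem comp_fromOfGlobalSections {X Y : Scheme.{u}} (f : R →+* Γ(X, ⊤))
    (hf : (HomogeneousIdeal.irrelevant 𝒜).toIdeal.map f = ⊤) {r : R} {n : ℕ} (hn : 0 < n)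
    (hr : r ∈ 𝒜 n) (h : Y ⟶ X) (hu : IsUnit ((h.appTop.hom.comp f) r)) :
    h ≫ Proj.fromOfGlobalSections 𝒜 f hf =
      Y.toSpecΓ ≫ Spec.map (CommRingCat.ofHom (awayLift 𝒜 (h.appTop.hom.comp f) r hu)) ≫
        Proj.awayι 𝒜 r hr hn := by
  -- The preimage of the basic open of `f r` is the basic open of a unit, hence all of `Y`, so `h`
  -- factors through it.
  have hle : Set.range h ⊆ Set.range (X.basicOpen (f r)).ι := by
    have h1 : h ⁻¹ᵁ X.basicOpen (f r) = ⊤ := by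
      rw [Scheme.preimage_basicOpen]
      exact Scheme.basicOpen_of_isUnit _ hu
    rw [Scheme.Opens.range_ι]
    rintro _ ⟨y, rfl⟩
    have : y ∈ h ⁻¹ᵁ X.basicOpen (f r) := by rw [h1]; trivial
    exact this
  obtain ⟨h', rfl⟩ : ∃ h', h' ≫ (X.basicOpen (f r)).ι = h :=
    ⟨IsOpenImmersion.lift _ h hle, IsOpenImmersion.lift_fac _ _ _⟩
  have h1 : (X.basicOpen (f r)).ι ≫ Proj.fromOfGlobalSections 𝒜 f hf =
      Proj.toBasicOpenOfGlobalSections 𝒜 f rfl hn hr ≫ (Proj.basicOpen 𝒜 r).ι :=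
    (Proj.openCoverOfMapIrrelevantEqTop 𝒜 f hf).ι_glueMorphisms _ _ ⟨n, r, hn, hr⟩
  rw [Category.assoc, h1, Proj.toBasicOpenOfGlobalSections]
  simp only [Category.assoc, Proj.basicOpenIsoSpec_inv_ι]
  have hu' : IsUnit ((h' ≫ (X.basicOpen (f r)).ι).appTop.hom (f r)) := hu
  -- The lift factors through the localization of `Γ(X, ⊤)` at `f r`, the ring used in the
  -- construction of the glued morphism.
  have h2 : awayLift 𝒜 ((h' ≫ (X.basicOpen (f r)).ι).appTop.hom.comp f) r hu =
      (IsLocalization.Away.lift (S := Localization.Away (f r)) (f r) hu').comp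
        ((IsLocalization.map (M := .powers r) (T := .powers (f r)) (Localization.Away (f r)) f
          (by rw [← Submonoid.map_le_iff_le_comap, Submonoid.map_powers])).comp
        (algebraMap (Away 𝒜 r) (Localization.Away r))) := by
    rw [awayLift, ← RingHom.comp_assoc]
    congr 1
    refine IsLocalization.ringHom_ext (M := .powers r) ?_
    ext x
    simp
  have key : h' ≫ (X.isoOfEq (X.toSpecΓ_preimage_basicOpen (f r))).inv ≫ (X.toSpecΓ ∣_ _) ≫
      (basicOpenIsoSpecAway (f r)).hom = Y.toSpecΓ ≫ Spec.map (CommRingCat.ofHom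
        (IsLocalization.Away.lift (S := Localization.Away (f r)) (f r) hu')) := by
    -- The spectrum of a localization is a monomorphism into `Spec Γ(X, ⊤)`, so it is enough to
    -- compare there, where both sides are built from the canonical maps to `Spec Γ`.
    rw [← cancel_mono
      (Spec.map (CommRingCat.ofHom (algebraMap Γ(X, ⊤) (Localization.Away (f r)))))]
    simp only [Category.assoc, basicOpenIsoSpecAway_hom_SpecMap]
    rw [← Spec.map_comp, ← CommRingCat.ofHom_comp, IsLocalization.Away.lift_comp]
    have e := congrArg (fun z => h' ≫ (X.isoOfEq (X.toSpecΓ_preimage_basicOpen (f r))).inv ≫ z)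
      (morphismRestrict_ι X.toSpecΓ (PrimeSpectrum.basicOpen (f r)))
    refine e.trans ?_
    rw [CommRingCat.ofHom_hom, ← Scheme.toSpecΓ_naturality, Category.assoc]
    exact congrArg (h' ≫ ·) (Scheme.homOfLE_ι_assoc X (X.toSpecΓ_preimage_basicOpen (f r)).ge _)
  rw [h2, reassoc_of% key]
  simp only [CommRingCat.ofHom_comp, Spec.map_comp, Category.assoc]

end Proj

/-! ### The charts `v ≠ 0` of projective space -/

section ProjSpace

open HomogeneousLocalization

variable {k : Type u} [Field k] {V : Type u} [AddCommGroup V] [Module k V]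

variable (k) in
theorem symPow.ι_mem (v : V) : SymmetricAlgebra.ι k V v ∈ symPow k V 1 := by
  rw [symPow, pow_one]
  exact LinearMap.mem_range_self _ v

variable (k) in
/-- The open immersion of the affine chart `v ≠ 0` into `ℙ V`. -/
abbrev projSpace.chart (v : V) :
    Spec (.of (Away (symPow k V) (SymmetricAlgebra.ι k V v))) ⟶ projSpace k V :=
  Proj.awayι (symPow k V) _ (symPow.ι_mem k v) one_pos

variable (k) in
/-- The coordinate `w / v` on the affine chart `v ≠ 0`. -/
def projSpace.coord (v w : V) : Away (symPow k V) (SymmetricAlgebra.ι k V v) :=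
  Away.mk (symPow k V) (symPow.ι_mem k v) 1 (SymmetricAlgebra.ι k V w) (symPow.ι_mem k w)

theorem projSpace.algebraMap_coord (v w : V) :
    algebraMap _ (Localization.Away (SymmetricAlgebra.ι k V v)) (projSpace.coord k v w) *
      algebraMap _ (Localization.Away (SymmetricAlgebra.ι k V v)) (SymmetricAlgebra.ι k V v) =
      algebraMap _ _ (SymmetricAlgebra.ι k V w) := by
  have := algebraMap_away_mk (symPow k V) (symPow.ι_mem k v) 1 (SymmetricAlgebra.ι k V w)
    (symPow.ι_mem k w)
  rwa [pow_one] at this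

theorem projSpace.awayLift_coord {B : Type u} [CommRing B] (ψ : SymmetricAlgebra k V →+* B) (v w : V)
    (hu : IsUnit (ψ (SymmetricAlgebra.ι k V v))) :
    awayLift (symPow k V) ψ _ hu (projSpace.coord k v w) * ψ (SymmetricAlgebra.ι k V v) =
      ψ (SymmetricAlgebra.ι k V w) := by
  have := awayLift_mk (symPow k V) ψ _ hu (symPow.ι_mem k v) 1 (SymmetricAlgebra.ι k V w)
    (symPow.ι_mem k w)
  rwa [pow_one] at this

/-- The chart ring is generated by the constants and the coordinates `w / v`, since the symmetric
algebra is generated in degree one. -/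
theorem projSpace.awayHom_ext {B : Type u} [CommRing B] {v : V}
    {θ θ' : Away (symPow k V) (SymmetricAlgebra.ι k V v) →+* B}
    (h0 : ∀ c : k, θ (fromZeroRingHom (symPow k V) _ (algebraMap k (symPow k V 0) c)) =
      θ' (fromZeroRingHom (symPow k V) _ (algebraMap k (symPow k V 0) c)))
    (h1 : ∀ w : V, θ (projSpace.coord k v w) = θ' (projSpace.coord k v w)) : θ = θ' := by
  -- Describing the fraction `a / vⁿ` by the equation `x vⁿ = a` allows induction on `a`. The
  -- multiplicative step is `(w a) / vⁿ⁺¹ = (w / v) (a / vⁿ)`.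
  have key (n : ℕ) (a : SymmetricAlgebra k V) (ha : a ∈ symPow k V n)
      (x : Away (symPow k V) (SymmetricAlgebra.ι k V v))
      (hx : algebraMap _ (Localization.Away (SymmetricAlgebra.ι k V v)) x *
        algebraMap _ (Localization.Away (SymmetricAlgebra.ι k V v)) (SymmetricAlgebra.ι k V v) ^ n =
        algebraMap _ _ a) : θ x = θ' x := by
    have hsurj (n : ℕ) (a : SymmetricAlgebra k V) (ha : a ∈ symPow k V n) :
        ∃ x : Away (symPow k V) (SymmetricAlgebra.ι k V v),
        algebraMap _ (Localization.Away (SymmetricAlgebra.ι k V v)) x *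
        algebraMap _ (Localization.Away (SymmetricAlgebra.ι k V v)) (SymmetricAlgebra.ι k V v) ^ n =
        algebraMap _ _ a :=
      ⟨_, algebraMap_away_mk (symPow k V) (symPow.ι_mem k v) n a (by simpa using ha)⟩
    induction ha using Submodule.pow_induction_on_left' generalizing x with
    | algebraMap c =>
      have : x = fromZeroRingHom (symPow k V) _ (algebraMap k (symPow k V 0) c) :=
        away_ext _ 0 (by
          rw [hx, pow_zero, mul_one, HomogeneousLocalization.algebraMap_apply]
          exact (Localization.mk_one_eq_algebraMap _).symm)
      rw [this, h0]
    | add a b n ha hb iha ihb =>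
      obtain ⟨y, hy⟩ := hsurj n a ha
      obtain ⟨z, hz⟩ := hsurj n b hb
      have : x = y + z := away_ext _ n (by rw [hx, map_add, map_add, add_mul, hy, hz])
      rw [this, map_add, map_add, iha y hy, ihb z hz]
    | mem_mul m hm n a ha ih =>
      obtain ⟨w, rfl⟩ := hm
      obtain ⟨y, hy⟩ := hsurj n a ha
      have : x = projSpace.coord k v w * y := away_ext _ (n + 1) (by
        rw [hx, map_mul, map_mul, ← hy, ← projSpace.algebraMap_coord v w]; ring)
      rw [this, map_mul, map_mul, h1, ih y hy]
  ext x
  obtain ⟨n, a, ha, rfl⟩ := Away.mk_surjective (symPow k V) (symPow.ι_mem k v) x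
  exact key n a (by simpa using ha) _ (algebraMap_away_mk (symPow k V) (symPow.ι_mem k v) n a ha)

variable {A : Type u} [CommRing A] [Algebra k A]

/-- Over a base where `l v` is invertible the point `[l]` lies in the chart `v ≠ 0` and is given by
`w / v ↦ l w / l v`. All later comparisons of points reduce to this formula. -/
theorem projSpace.comp_point (l : V →ₗ[k] A) (hl : Ideal.span (Set.range l) = ⊤) {B : Type u}
    [CommRing B] (φ : A →+* B) (v : V)
    (hu : IsUnit (φ.comp (SymmetricAlgebra.lift l).toRingHom (SymmetricAlgebra.ι k V v))) :
    Spec.map (CommRingCat.ofHom φ) ≫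
        Proj.fromOfGlobalSections (symPow k V) (symToΓ l) (map_irrelevant_symToΓ l hl) =
      Spec.map (CommRingCat.ofHom (awayLift (symPow k V)
        (φ.comp (SymmetricAlgebra.lift l).toRingHom) _ hu)) ≫ projSpace.chart k v := by
  have h1 : (Spec.map (CommRingCat.ofHom φ)).appTop.hom.comp (symToΓ l) =
      (Scheme.ΓSpecIso (.of B)).inv.hom.comp (φ.comp (SymmetricAlgebra.lift l).toRingHom) := by
    rw [symToΓ, ← RingHom.comp_assoc, ← RingHom.comp_assoc]
    congr 1
    exact congrArg CommRingCat.Hom.hom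
      (Scheme.ΓSpecIso_inv_naturality (CommRingCat.ofHom φ)).symm
  have hu' : IsUnit ((Spec.map (CommRingCat.ofHom φ)).appTop.hom.comp (symToΓ l)
      (SymmetricAlgebra.ι k V v)) := by
    rw [h1]
    exact hu.map (Scheme.ΓSpecIso (.of B)).inv.hom
  rw [comp_fromOfGlobalSections (symPow k V) (symToΓ l) (map_irrelevant_symToΓ l hl) one_pos
    (symPow.ι_mem k v) _ hu', ← Category.assoc]
  congr 1
  simp only [h1]
  rw [← comp_awayLift (symPow k V) _ _ hu, CommRingCat.ofHom_comp, Spec.map_comp,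
    CommRingCat.ofHom_hom, ← SpecMap_ΓSpecIso_hom, ← Spec.map_comp_assoc, Iso.inv_hom_id,
    Spec.map_id, Category.id_comp]

end ProjSpace

/-! ### Unimodular functionals modulo units and points of projective space -/

section Unimodular

open HomogeneousLocalization

theorem awayLift_fromZeroRingHom {σ R : Type u} [CommRing R] [SetLike σ R] [AddSubgroupClass σ R]
    (𝒜 : ℕ → σ) [GradedRing 𝒜] {B : Type u} [CommRing B] (ψ : R →+* B) (r : R)
    (hu : IsUnit (ψ r)) (a : 𝒜 0) : awayLift 𝒜 ψ r hu (fromZeroRingHom 𝒜 _ a) = ψ a := by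
  have h : algebraMap (Away 𝒜 r) (Localization.Away r) (fromZeroRingHom 𝒜 _ a) =
      algebraMap R (Localization.Away r) a := by
    rw [HomogeneousLocalization.algebraMap_apply]
    exact Localization.mk_one_eq_algebraMap _
  rw [awayLift, RingHom.comp_apply, h, IsLocalization.Away.lift_eq]

variable (k : Type u) [Field k] (V : Type u) [AddCommGroup V] [Module k V]

/-- Unimodular linear maps `V → A`, up to units of `A`. -/
instance unimodularSetoid (A : Type u) [CommRing A] [Algebra k A] :
    Setoid {l : V →ₗ[k] A // Ideal.span (Set.range l) = ⊤} where
  r l l' := ∃ u : Aˣ, ∀ v, l'.1 v = u * l.1 v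
  iseqv :=
    { refl := fun _ => ⟨1, fun _ => by simp⟩
      symm := fun ⟨u, hu⟩ => ⟨u⁻¹, fun v => by rw [hu, Units.inv_mul_cancel_left]⟩
      trans := fun ⟨u, hu⟩ ⟨u', hu'⟩ => ⟨u' * u, fun v => by
        rw [hu', hu, Units.val_mul, mul_assoc]⟩ }

variable {k V}

theorem span_range_comp {A B : Type u} [CommRing A] [Algebra k A] [CommRing B] [Algebra k B]
    (φ : A →ₐ[k] B) {l : V →ₗ[k] A} (hl : Ideal.span (Set.range l) = ⊤) :
    Ideal.span (Set.range (φ.toLinearMap ∘ₗ l)) = ⊤ := by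
  have := Ideal.map_span φ.toRingHom (Set.range l)
  rw [hl, Ideal.map_top, ← Set.range_comp] at this
  exact this.symm

variable (k V)

/-- The presheaf of unimodular linear maps up to units. -/
def unimodular : (CommAlgCat.{u} k)ᵒᵖᵒᵖ ⥤ Type (u + 1) :=
  unopUnop (CommAlgCat.{u} k) ⋙
    { obj A := ULift.{u + 1} (Quotient (unimodularSetoid k V A))
      map {A B} φ := ↾fun p => ⟨Quotient.map
        (fun l => ⟨φ.hom.toLinearMap ∘ₗ l.1, span_range_comp φ.hom l.2⟩)
        (by
          rintro l l' ⟨u, hu⟩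
          refine ⟨Units.map φ.hom.toRingHom.toMonoidHom u, fun v => ?_⟩
          change φ.hom (l'.1 v) = φ.hom u * φ.hom (l.1 v)
          rw [hu, map_mul]) p.down⟩
      map_id A := by
        ext ⟨p⟩
        obtain ⟨l, rfl⟩ := Quotient.exists_rep p
        rfl
      map_comp {A B C} φ ψ := by
        ext ⟨p⟩
        obtain ⟨l, rfl⟩ := Quotient.exists_rep p
        rfl }

variable {k V}

/-- The class of a unimodular linear map. -/
def unimodular.mk (A : CommAlgCat.{u} k) (l : V →ₗ[k] A) (hl : Ideal.span (Set.range l) = ⊤) :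
    (unimodular k V).obj (op (op A)) :=
  ⟨Quotient.mk (unimodularSetoid k V A) ⟨l, hl⟩⟩

/-- Basic opens around all points form an fppf covering, and the points of `ℙ V` are separated for
it. -/
theorem projSpace.points_ext (A : CommAlgCat.{u} k) (p q : (projSpace.points k V).obj (op (op A)))
    (h : ∀ P : PrimeSpectrum A, ∃ f : A, f ∉ P.asIdeal ∧
      Spec.map (CommRingCat.ofHom (algebraMap A (Localization.Away f))) ≫ p.down.1 =
      Spec.map (CommRingCat.ofHom (algebraMap A (Localization.Away f))) ≫ q.down.1) : p = q := by
  have hs := (isSheaf_iff_isSheaf_of_type _ _).1 (projSpace.isSheaf_points k V)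
  let S := Presheaf.equalizerSieve (F := projSpace.points k V) (X := op (op A)) p q
  refine (hs S (fppf_mem_of_basicOpen k A S fun P => ?_)).isSeparatedFor.ext fun Y f hf => hf
  obtain ⟨f, hf, h⟩ := h P
  exact ⟨f, hf, ULift.ext _ _ (Subtype.ext h)⟩

theorem exists_notMem_of_span_range {A : Type u} [CommRing A] [Algebra k A] {l : V →ₗ[k] A}
    (hl : Ideal.span (Set.range l) = ⊤) (P : PrimeSpectrum A) : ∃ v, l v ∉ P.asIdeal := by
  by_contra! h
  refine P.2.ne_top (top_le_iff.1 (hl ▸ Ideal.span_le.2 ?_))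
  rintro _ ⟨v, rfl⟩
  exact h v

theorem comp_lift_ι {A : Type u} [CommRing A] [Algebra k A] (l : V →ₗ[k] A) {B : Type u}
    [CommRing B] (φ : A →+* B) (v : V) :
    φ.comp (SymmetricAlgebra.lift l).toRingHom (SymmetricAlgebra.ι k V v) = φ (l v) :=
  congrArg φ (SymmetricAlgebra.lift_ι_apply l v)

/-- The unit cancels in the chart coordinates: `(u l w) / (u l v) = l w / l v`. -/
theorem awayLift_eq_of_smul {A : Type u} [CommRing A] [Algebra k A] {l l' : V →ₗ[k] A} {u : Aˣ}
    (h : ∀ v, l' v = u * l v) {B : Type u} [CommRing B] (φ : A →+* B) (v : V)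
    (hu : IsUnit (φ.comp (SymmetricAlgebra.lift l).toRingHom (SymmetricAlgebra.ι k V v)))
    (hu' : IsUnit (φ.comp (SymmetricAlgebra.lift l').toRingHom (SymmetricAlgebra.ι k V v))) :
    awayLift (symPow k V) _ _ hu = awayLift (symPow k V) _ _ hu' := by
  refine projSpace.awayHom_ext (fun c => ?_) (fun w => ?_)
  · rw [awayLift_fromZeroRingHom, awayLift_fromZeroRingHom]
    exact congrArg φ (((SymmetricAlgebra.lift l).commutes c).trans
      ((SymmetricAlgebra.lift l').commutes c).symm)
  · refine hu'.mul_right_cancel ?_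
    have h1 := projSpace.awayLift_coord _ v w hu
    have h2 := projSpace.awayLift_coord _ v w hu'
    simp only [comp_lift_ι, h, map_mul] at h1 h2 ⊢
    rw [h2, mul_left_comm, h1]

theorem projSpace.point_eq_of_smul {A : CommAlgCat.{u} k} {l l' : V →ₗ[k] A}
    (hl : Ideal.span (Set.range l) = ⊤) (hl' : Ideal.span (Set.range l') = ⊤) {u : Aˣ}
    (h : ∀ v, l' v = u * l v) : projSpace.point A l hl = projSpace.point A l' hl' := by
  refine projSpace.points_ext A _ _ fun P => ?_
  obtain ⟨v, hv⟩ := exists_notMem_of_span_range hl P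
  refine ⟨l v, hv, ?_⟩
  have h0 : IsUnit (algebraMap A (Localization.Away (l v)) (l v)) :=
    IsLocalization.Away.algebraMap_isUnit _
  have hu : IsUnit ((algebraMap A (Localization.Away (l v))).comp
      (SymmetricAlgebra.lift l).toRingHom (SymmetricAlgebra.ι k V v)) := by
    rw [comp_lift_ι]
    exact h0
  have hu' : IsUnit ((algebraMap A (Localization.Away (l v))).comp
      (SymmetricAlgebra.lift l').toRingHom (SymmetricAlgebra.ι k V v)) := by
    rw [comp_lift_ι, h, map_mul]
    exact (u.isUnit.map _).mul h0
  refine (projSpace.comp_point l hl _ v hu).trans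
    (Eq.trans ?_ (projSpace.comp_point l' hl' _ v hu').symm)
  rw [awayLift_eq_of_smul h]

theorem projSpace.map_point {A B : CommAlgCat.{u} k} (φ : A ⟶ B) {l : V →ₗ[k] A}
    (hl : Ideal.span (Set.range l) = ⊤) :
    (projSpace.points k V).map φ.op.op (projSpace.point A l hl) =
      projSpace.point B (φ.hom.toLinearMap ∘ₗ l) (span_range_comp φ.hom hl) := by
  refine projSpace.points_ext B _ _ fun P => ?_
  obtain ⟨v, hv⟩ := exists_notMem_of_span_range (span_range_comp φ.hom hl) P
  refine ⟨_, hv, ?_⟩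
  set f := (φ.hom.toLinearMap ∘ₗ l) v
  have h0 : IsUnit (algebraMap B (Localization.Away f) f) :=
    IsLocalization.Away.algebraMap_isUnit _
  have hψ : (algebraMap B (Localization.Away f)).comp
      (SymmetricAlgebra.lift (φ.hom.toLinearMap ∘ₗ l)).toRingHom =
      ((algebraMap B (Localization.Away f)).comp φ.hom.toRingHom).comp
        (SymmetricAlgebra.lift l).toRingHom := by
    rw [RingHom.comp_assoc]
    congr 1
    have : SymmetricAlgebra.lift (φ.hom.toLinearMap ∘ₗ l) =
        φ.hom.comp (SymmetricAlgebra.lift l) :=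
      SymmetricAlgebra.algHom_ext (LinearMap.ext fun m => by simp)
    rw [this]
    rfl
  have hu' : IsUnit ((algebraMap B (Localization.Away f)).comp
      (SymmetricAlgebra.lift (φ.hom.toLinearMap ∘ₗ l)).toRingHom (SymmetricAlgebra.ι k V v)) := by
    rw [comp_lift_ι]
    exact h0
  have hu := hu'
  rw [hψ] at hu
  have h1 := projSpace.comp_point l hl _ v hu
  have h2 := projSpace.comp_point _ (span_range_comp φ.hom hl) _ v hu'
  refine Eq.trans ?_ (h1.trans (Eq.trans ?_ h2.symm))
  · rw [CommRingCat.ofHom_comp (CommAlgCat.Hom.hom φ).toRingHom, Spec.map_comp, Category.assoc]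
    rfl
  · simp only [hψ]

/-- A unimodular linear map defines a point of projective space. -/
def unimodularToPoints : unimodular k V ⟶ projSpace.points k V where
  app X := ↾fun p => Quotient.lift (fun l => projSpace.point X.unop.unop l.1 l.2)
    (by
      rintro l l' ⟨_, hu⟩
      exact projSpace.point_eq_of_smul l.2 l'.2 hu) p.down
  naturality X Y φ := by
    ext ⟨p⟩
    obtain ⟨l, rfl⟩ := Quotient.exists_rep p
    exact (projSpace.map_point φ.unop.unop l.2).symm

/-- The locus where `l v` is invertible is the preimage of the basic open of `v` under `[l]`, so it
depends only on the point. -/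
theorem isUnit_of_point_eq {A : CommAlgCat.{u} k} {l l' : V →ₗ[k] A}
    (hl : Ideal.span (Set.range l) = ⊤) (hl' : Ideal.span (Set.range l') = ⊤)
    (h : projSpace.point A l hl = projSpace.point A l' hl') {v : V} (hv : IsUnit (l v)) :
    IsUnit (l' v) := by
  have h1 := Proj.fromOfGlobalSections_preimage_basicOpen (symPow k V) (symToΓ l)
    (map_irrelevant_symToΓ l hl) one_pos (symPow.ι_mem k v)
  have h2 := Proj.fromOfGlobalSections_preimage_basicOpen (symPow k V) (symToΓ l')
    (map_irrelevant_symToΓ l' hl') one_pos (symPow.ι_mem k v)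
  have h3 : Proj.fromOfGlobalSections (symPow k V) (symToΓ l) (map_irrelevant_symToΓ l hl) =
      Proj.fromOfGlobalSections (symPow k V) (symToΓ l') (map_irrelevant_symToΓ l' hl') :=
    congrArg (fun z => z.down.1) h
  have h4 (m : V →ₗ[k] A) : symToΓ m (SymmetricAlgebra.ι k V v) =
      (Scheme.ΓSpecIso (.of A)).inv.hom (m v) :=
    congrArg (Scheme.ΓSpecIso (.of A)).inv.hom (SymmetricAlgebra.lift_ι_apply m v)
  rw [h3, h2, h4, h4, Scheme.basicOpen_of_isUnit _ (hv.map _)] at h1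
  have h5 := basicOpen_eq_of_affine (R := .of A) (l' v)
  rw [h1] at h5
  by_contra hn
  obtain ⟨m, hm, hmem⟩ := exists_max_ideal_of_mem_nonunits hn
  have h6 : (⟨m, hm.isPrime⟩ : PrimeSpectrum A) ∈ PrimeSpectrum.basicOpen (l' v) := h5.le trivial
  exact h6 hmem

/-- Both points factor through the chart `v ≠ 0`, which is a monomorphism, so their coordinates
agree: `l w / l v = l' w / l' v` for every `w`. -/
theorem smul_of_point_eq {A : CommAlgCat.{u} k} {l l' : V →ₗ[k] A}
    (hl : Ideal.span (Set.range l) = ⊤) (hl' : Ideal.span (Set.range l') = ⊤)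
    (h : projSpace.point A l hl = projSpace.point A l' hl') {v : V} (hv : IsUnit (l v)) :
    ∃ u : Aˣ, ∀ w, l' w = u * l w := by
  have hv' := isUnit_of_point_eq hl hl' h hv
  have hu : IsUnit ((RingHom.id A).comp (SymmetricAlgebra.lift l).toRingHom
      (SymmetricAlgebra.ι k V v)) := by rwa [comp_lift_ι]
  have hu' : IsUnit ((RingHom.id A).comp (SymmetricAlgebra.lift l').toRingHom
      (SymmetricAlgebra.ι k V v)) := by rwa [comp_lift_ι]
  have h1 := projSpace.comp_point l hl _ v hu
  have h2 := projSpace.comp_point l' hl' _ v hu'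
  have h3 : Proj.fromOfGlobalSections (symPow k V) (symToΓ l) (map_irrelevant_symToΓ l hl) =
      Proj.fromOfGlobalSections (symPow k V) (symToΓ l') (map_irrelevant_symToΓ l' hl') :=
    congrArg (fun z => z.down.1) h
  rw [h3, h2, cancel_mono] at h1
  have h4 := congrArg CommRingCat.Hom.hom (Spec.map_injective h1)
  obtain ⟨u, hu0⟩ := hv
  obtain ⟨u', hu0'⟩ := hv'
  -- The proportionality factor is `l' v / l v`.
  refine ⟨u' * u⁻¹, fun w => ?_⟩
  have h5 := projSpace.awayLift_coord _ v w hu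
  have h6 := projSpace.awayLift_coord _ v w hu'
  rw [CommRingCat.hom_ofHom, CommRingCat.hom_ofHom] at h4
  rw [h4] at h6
  simp only [comp_lift_ι, RingHom.id_apply] at h5 h6
  rw [← h5, ← h6, ← hu0, ← hu0', Units.val_mul]
  linear_combination
    (-(awayLift (symPow k V) _ _ hu (projSpace.coord k v w) * u')) * u.inv_mul

/-- Around every point some `l v` becomes invertible after localizing at it, and there equality of
points gives proportionality of functionals. -/
theorem unimodular.equalizerSieve_mem {A : CommAlgCat.{u} k} {l l' : V →ₗ[k] A}
    (hl : Ideal.span (Set.range l) = ⊤) (hl' : Ideal.span (Set.range l') = ⊤)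
    (h : projSpace.point A l hl = projSpace.point A l' hl') :
    Presheaf.equalizerSieve (F := unimodular k V) (X := op (op A)) (unimodular.mk A l hl)
      (unimodular.mk A l' hl') ∈ fppf k (op A) := by
  refine fppf_mem_of_basicOpen k A _ fun P => ?_
  obtain ⟨v, hv⟩ := exists_notMem_of_span_range hl P
  let φ : A ⟶ CommAlgCat.of k (Localization.Away (l v)) :=
    CommAlgCat.ofHom (Algebra.algHom k A (Localization.Away (l v)))
  have h' := congrArg ((projSpace.points k V).map φ.op.op) h
  rw [projSpace.map_point, projSpace.map_point] at h'
  exact ⟨l v, hv, ULift.ext _ _ (Quotient.sound (smul_of_point_eq _ _ h' (v := v)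
    (IsLocalization.Away.algebraMap_isUnit (S := Localization.Away (l v)) (l v))))⟩

instance unimodularToPoints_isLocallyInjective :
    Presheaf.IsLocallyInjective (fppf k) (unimodularToPoints (k := k) (V := V)) where
  equalizerSieve_mem {X} p q h := by
    obtain ⟨p⟩ := p
    obtain ⟨q⟩ := q
    obtain ⟨⟨l, hl⟩, rfl⟩ := Quotient.exists_rep p
    obtain ⟨⟨l', hl'⟩, rfl⟩ := Quotient.exists_rep q
    exact unimodular.equalizerSieve_mem (A := X.unop.unop) hl hl' h

/-- A point in the affine chart `v ≠ 0` comes from a unimodular linear map. -/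
theorem exists_point_eq {A : CommAlgCat.{u} k} (p : (projSpace.points k V).obj (op (op A))) {v : V}
    (q : Spec (.of A) ⟶ Spec (.of (Away (symPow k V) (SymmetricAlgebra.ι k V v))))
    (hq : q ≫ projSpace.chart k v = p.down.1) :
    ∃ (l : V →ₗ[k] A) (hl : Ideal.span (Set.range l) = ⊤), projSpace.point A l hl = p := by
  obtain ⟨θ, rfl⟩ := Spec.map_surjective q
  obtain ⟨θ, rfl⟩ : ∃ θ', θ = CommRingCat.ofHom θ' := ⟨θ.hom, rfl⟩
  -- That the point lies over `Spec k` says that `θ` is compatible with the constants.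
  have hθ (c : k) : θ (fromZeroRingHom (symPow k V) _ (algebraMap k (symPow k V 0) c)) =
      algebraMap k A c := by
    have h1 := p.down.2
    rw [← hq, Category.assoc, projSpace.toSpec, Proj.awayι_toSpecZero_assoc, ← Spec.map_comp,
      ← Spec.map_comp] at h1
    exact congrArg (fun z => z.hom c) (Spec.map_injective h1)
  -- The functional is normalized by `l v = 1`: its value at `w` is the coordinate `w / v` of the
  -- point.
  let l : V →ₗ[k] A :=
    { toFun := fun w => θ (projSpace.coord k v w)
      map_add' := fun w w' => by
        rw [← map_add]
        congr 1
        refine away_ext _ 1 ?_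
        simp only [pow_one, map_add, add_mul, projSpace.algebraMap_coord]
      map_smul' := fun c w => by
        rw [Algebra.smul_def, RingHom.id_apply, ← hθ, ← map_mul]
        congr 1
        refine away_ext _ 1 ?_
        have : algebraMap _ (Localization.Away (SymmetricAlgebra.ι k V v))
            (fromZeroRingHom (symPow k V) (.powers (SymmetricAlgebra.ι k V v))
              (algebraMap k (symPow k V 0) c)) =
            algebraMap _ _ (algebraMap k (SymmetricAlgebra k V) c) := by
          rw [HomogeneousLocalization.algebraMap_apply]
          exact Localization.mk_one_eq_algebraMap _
        rw [pow_one, projSpace.algebraMap_coord, map_mul, mul_assoc, projSpace.algebraMap_coord,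
          map_smul, Algebra.smul_def, map_mul, this] }
  have hlv : l v = 1 := by
    have : projSpace.coord k v v = 1 := away_ext _ 1 (by
      rw [pow_one, projSpace.algebraMap_coord, map_one, one_mul])
    change θ _ = 1
    rw [this, map_one]
  have hl : Ideal.span (Set.range l) = ⊤ :=
    Ideal.eq_top_of_isUnit_mem _ (Ideal.subset_span ⟨v, hlv⟩) isUnit_one
  refine ⟨l, hl, ULift.ext _ _ (Subtype.ext ?_)⟩
  have hu : IsUnit ((RingHom.id A).comp (SymmetricAlgebra.lift l).toRingHom
      (SymmetricAlgebra.ι k V v)) := by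
    rw [comp_lift_ι, RingHom.id_apply, hlv]
    exact isUnit_one
  have h1 := projSpace.comp_point l hl _ v hu
  have h2 : awayLift (symPow k V) _ _ hu = θ := by
    refine projSpace.awayHom_ext (fun c => ?_) fun w => ?_
    · rw [awayLift_fromZeroRingHom, hθ]
      exact (SymmetricAlgebra.lift l).commutes c
    · have := projSpace.awayLift_coord _ v w hu
      rw [comp_lift_ι, comp_lift_ι, RingHom.id_apply, RingHom.id_apply, hlv, mul_one] at this
      rw [this]
      rfl
  rw [h2, hq] at h1
  refine Eq.trans ?_ h1
  change Proj.fromOfGlobalSections (symPow k V) (symToΓ l) (map_irrelevant_symToΓ l hl) =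
    Spec.map (𝟙 _) ≫ _
  rw [Spec.map_id, Category.id_comp]

/-- The degree-one elements `v` generate the symmetric algebra over its degree-zero part, so their
basic opens cover `Proj`. -/
theorem projSpace.exists_mem_basicOpen (x : projSpace k V) :
    ∃ v : V, x ∈ Proj.basicOpen (symPow k V) (SymmetricAlgebra.ι k V v) := by
  have h : Algebra.adjoin (symPow k V 0) (Set.range (SymmetricAlgebra.ι k V)) = ⊤ := by
    refine top_le_iff.1 fun a _ => ?_
    induction a using SymmetricAlgebra.induction with
    | algebraMap c =>
      exact Subalgebra.algebraMap_mem (Algebra.adjoin (symPow k V 0) _) (algebraMap k _ c)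
    | ι v => exact Algebra.subset_adjoin ⟨v, rfl⟩
    | mul a b ha hb => exact mul_mem (ha trivial) (hb trivial)
    | add a b ha hb => exact add_mem (ha trivial) (hb trivial)
  have := (Proj.iSup_basicOpen_eq_top' (symPow k V) (SymmetricAlgebra.ι k V)
    (fun v => ⟨1, symPow.ι_mem k v⟩) h).ge (Set.mem_univ x)
  exact TopologicalSpace.Opens.mem_iSup.1 this

/-- The preimage of a chart is open in `Spec A`, so it contains a basic open around the given point.
Over that basic open the morphism factors through the chart and comes from a functional. -/
theorem unimodularToPoints_imageSieve_mem (A : CommAlgCat.{u} k)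
    (p : (projSpace.points k V).obj (op (op A))) :
    Presheaf.imageSieve (unimodularToPoints (k := k) (V := V)) p ∈ fppf k (op A) := by
  refine fppf_mem_of_basicOpen k A _ fun P => ?_
  obtain ⟨v, hv⟩ := projSpace.exists_mem_basicOpen (p.down.1 P)
  obtain ⟨f, hf, hfv⟩ : ∃ f : A, f ∉ P.asIdeal ∧ ∀ Q : PrimeSpectrum A, f ∉ Q.asIdeal →
      p.down.1 Q ∈ Proj.basicOpen (symPow k V) (SymmetricAlgebra.ι k V v) := by
    obtain ⟨_, ⟨_, ⟨f, rfl⟩, rfl⟩, hf, hfv⟩ :=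
      PrimeSpectrum.isBasis_basic_opens.exists_subset_of_mem_open
        (show P ∈ (p.down.1 ⁻¹ᵁ Proj.basicOpen (symPow k V) (SymmetricAlgebra.ι k V v)) from hv)
        (p.down.1 ⁻¹ᵁ Proj.basicOpen (symPow k V) (SymmetricAlgebra.ι k V v)).2
    exact ⟨f, hf, fun Q hQ => hfv hQ⟩
  refine ⟨f, hf, ?_⟩
  let φ : A ⟶ CommAlgCat.of k (Localization.Away f) :=
    CommAlgCat.ofHom (Algebra.algHom k A (Localization.Away f))
  let p' := (projSpace.points k V).map φ.op.op p
  have hr : Set.range p'.down.1 ⊆ Set.range (projSpace.chart k v) := by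
    have h1 := Proj.opensRange_awayι (symPow k V) _ (symPow.ι_mem k v) one_pos
    have h2 : Set.range (projSpace.chart k v) =
        Proj.basicOpen (symPow k V) (SymmetricAlgebra.ι k V v) := by rw [← h1]; rfl
    rw [h2]
    rintro _ ⟨y, rfl⟩
    refine hfv (PrimeSpectrum.comap (algebraMap A (Localization.Away f)) y) ?_
    have := (PrimeSpectrum.localization_away_comap_range (Localization.Away f) f).le ⟨y, rfl⟩
    exact this
  obtain ⟨l, hl, hp⟩ := exists_point_eq p' (IsOpenImmersion.lift (projSpace.chart k v) _ hr)
    (IsOpenImmersion.lift_fac _ _ _)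
  exact ⟨unimodular.mk _ l hl, hp⟩

instance unimodularToPoints_isLocallySurjective :
    Presheaf.IsLocallySurjective (fppf k) (unimodularToPoints (k := k) (V := V)) where
  imageSieve_mem {U} p := unimodularToPoints_imageSieve_mem U.unop p

end Unimodular

/-! ### Coordinate rings of `𝔾ₘ` and `𝔾ₘ × 𝔾ₐ` -/

section CoordinateRings

open LaurentPolynomial

/-- The homomorphism from Laurent polynomials sending `T` to a given unit. -/
def laurentLift {A B : Type u} [CommRing A] [CommRing B] [Algebra A B] (t : Bˣ) :
    A[T;T⁻¹] →ₐ[A] B :=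
  { LaurentPolynomial.eval₂ (algebraMap A B) t with
    commutes' := fun r => LaurentPolynomial.eval₂_C _ t r }

theorem laurentLift_T {A B : Type u} [CommRing A] [CommRing B] [Algebra A B] (t : Bˣ) :
    laurentLift (A := A) t (T 1) = t :=
  (LaurentPolynomial.eval₂_T _ t 1).trans (by rw [zpow_one])

theorem laurentAlgHom_ext {A B : Type u} [CommRing A] [CommRing B] [Algebra A B]
    {h h' : A[T;T⁻¹] →ₐ[A] B} (H : h (T 1) = h' (T 1)) : h = h' := by
  have : h.toRingHom = h'.toRingHom := by
    refine IsLocalization.ringHom_ext (M := .powers (Polynomial.X : Polynomial A)) ?_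
    refine Polynomial.ringHom_ext (fun a => ?_) ?_
    · rw [RingHom.comp_apply, RingHom.comp_apply, algebraMap_eq_toLaurent, Polynomial.toLaurent_C]
      exact (h.commutes a).trans (h'.commutes a).symm
    · rw [RingHom.comp_apply, RingHom.comp_apply, algebraMap_eq_toLaurent, Polynomial.toLaurent_X]
      exact H
  exact AlgHom.ext fun x => RingHom.congr_fun this x

/-- The unit `T` of the ring of Laurent polynomials. -/
def laurentUnit (A : Type u) [CommRing A] : A[T;T⁻¹]ˣ where
  val := T 1
  inv := T (-1)
  val_inv := by rw [← T_add]; simp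
  inv_val := by rw [← T_add]; simp

/-- As a localization of `K[X]` at nonzerodivisors, the ring is a principal ideal domain, so it has
dimension one unless it is a field. -/
theorem ringKrullDim_laurentPolynomial (K : Type u) [Field K] : ringKrullDim K[T;T⁻¹] = 1 := by
  have hX : Submonoid.powers (Polynomial.X : Polynomial K) ≤ nonZeroDivisors (Polynomial K) :=
    powers_le_nonZeroDivisors_of_noZeroDivisors Polynomial.X_ne_zero
  have : IsPrincipalIdealRing K[T;T⁻¹] := ⟨fun I => by
    rw [← IsLocalization.map_under (.powers (Polynomial.X : Polynomial K)) K[T;T⁻¹] I]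
    obtain ⟨a, ha⟩ := IsPrincipalIdealRing.principal
      (I.under (Polynomial K))
    rw [ha, Ideal.submodule_span_eq, Ideal.map_span, Set.image_singleton]
    exact ⟨_, rfl⟩⟩
  have : IsDomain K[T;T⁻¹] := IsLocalization.isDomain_of_le_nonZeroDivisors _ hX
  -- In a field the evaluation `T ↦ 1` would be injective, forcing `T = 1`, which comparison of
  -- degrees excludes.
  refine IsPrincipalIdealRing.ringKrullDim_eq_one _ fun hf => ?_
  let _ := hf.toField
  have h : laurentLift (A := K) (1 : Kˣ) (T 1) = laurentLift (A := K) (1 : Kˣ) 1 := by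
    rw [laurentLift_T, map_one, Units.val_one]
  have h' := (laurentLift (A := K) (1 : Kˣ)).toRingHom.injective h
  rw [← Polynomial.toLaurent_X, ← Polynomial.toLaurent_one] at h'
  have := congrArg Polynomial.natDegree (Polynomial.toLaurent_injective h')
  simp at this

theorem ringKrullDim_polynomial_laurentPolynomial (K : Type u) [Field K] :
    ringKrullDim (Polynomial K[T;T⁻¹]) = 2 := by
  have : IsNoetherianRing K[T;T⁻¹] :=
    IsLocalization.isNoetherianRing (.powers (Polynomial.X : Polynomial K)) _ inferInstance
  rw [Polynomial.ringKrullDim_of_isNoetherianRing, ringKrullDim_laurentPolynomial]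
  norm_num

instance laurentPolynomial_free (A : Type u) [CommRing A] : Module.Free A A[T;T⁻¹] :=
  inferInstanceAs (Module.Free A (AddMonoidAlgebra A ℤ))

end CoordinateRings

/-! ### Automorphism schemes: uniqueness and the trivial case -/

section Automorphisms

variable {k : Type u} [Field k] {g : Type u} [LieRing g] [LieAlgebra k g]
  {A : Type u} [CommRing A] [Algebra k A] {E : Type u} [AddCommGroup E] [Module A E]
  [LieRingModule (A ⊗[k] g) E] [LieModule A (A ⊗[k] g) E]

/-- Yoneda: the universal automorphisms induce mutually inverse homomorphisms. The dimension of an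
arbitrary representing ring can thus be computed on an explicit model. -/
theorem RepresentsAut.algEquiv {R R' : Type u} [CommRing R] [Algebra A R] [CommRing R']
    [Algebra A R'] (h : RepresentsAut k g A E R) (h' : RepresentsAut k g A E R') :
    Nonempty (R ≃ₐ[A] R') := by
  obtain ⟨w, hw, hu⟩ := h
  obtain ⟨w', hw', hu'⟩ := h'
  obtain ⟨a, ha, -⟩ := hu R' w' hw'
  obtain ⟨b, hb, -⟩ := hu' R w hw
  have h1 : b.comp a = AlgHom.id A R := by
    refine (hu R w hw).unique (fun e => ?_) fun e => ?_
    · rw [AlgHom.comp_toLinearMap, LinearMap.rTensor_comp_apply, ← ha, ← hb]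
    · simp
  have h2 : a.comp b = AlgHom.id A R' := by
    refine (hu' R' w' hw').unique (fun e => ?_) fun e => ?_
    · rw [AlgHom.comp_toLinearMap, LinearMap.rTensor_comp_apply, ← hb, ← ha]
    · simp
  exact ⟨AlgEquiv.ofAlgHom a b h2 h1⟩

theorem isRepAut_of_isTrivial [LieModule.IsTrivial (A ⊗[k] g) E] {B : Type u} [CommRing B]
    [Algebra A B] (φ : (B ⊗[A] E) ≃ₗ[B] (B ⊗[A] E)) : IsRepAut k g φ := by
  have h (x : g) : LieModule.toEnd A (A ⊗[k] g) E (1 ⊗ₜ[k] x) = 0 := by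
    ext e
    exact LieModule.IsTrivial.trivial _ _
  intro x z
  simp [h]

open LaurentPolynomial in
/-- The automorphism group of a trivial representation of rank one is `𝔾ₘ`. -/
theorem representsAut_of_isTrivial [LieModule.IsTrivial (A ⊗[k] g) E] (e : A ≃ₗ[A] E) :
    RepresentsAut k g A E A[T;T⁻¹] := by
  refine ⟨LinearEquiv.smulOfUnit (laurentUnit A), isRepAut_of_isTrivial _, fun B _ _ φ _ => ?_⟩
  let c : (B ⊗[A] E) ≃ₗ[B] B :=
    TensorProduct.AlgebraTensorModule.congr (LinearEquiv.refl B B) e.symm ≪≫ₗ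
      TensorProduct.AlgebraTensorModule.rid A B B
  have hc (b : B) : c (b ⊗ₜ e 1) = b := by simp [c]
  -- Transported to the free module `B`, the automorphism is multiplication by the unit `ψ 1`, which
  -- is the image of `T` to be prescribed.
  let ψ : B ≃ₗ[B] B := c.symm ≪≫ₗ φ ≪≫ₗ c
  have hψ : IsUnit (ψ 1) := by
    refine isUnit_iff_exists_inv'.2 ⟨ψ.symm 1, ?_⟩
    rw [← smul_eq_mul, ← map_smul, smul_eq_mul, mul_one, LinearEquiv.apply_symm_apply]
  obtain ⟨t, ht⟩ := hψ
  have hφ : φ (1 ⊗ₜ e 1) = (t : B) ⊗ₜ e 1 := by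
    refine c.injective ?_
    have : c.symm 1 = 1 ⊗ₜ e 1 := by rw [LinearEquiv.symm_apply_eq, hc]
    rw [hc, ht, ← this]
    rfl
  have key (h : A[T;T⁻¹] →ₐ[A] B) :
      (∀ x : E, φ (1 ⊗ₜ x) = h.toLinearMap.rTensor E
        (LinearEquiv.smulOfUnit (laurentUnit A) ((1 : A[T;T⁻¹]) ⊗ₜ[A] x))) ↔ h (T 1) = t := by
    have h1 (x : E) : h.toLinearMap.rTensor E
        (LinearEquiv.smulOfUnit (laurentUnit A) ((1 : A[T;T⁻¹]) ⊗ₜ[A] x)) = h (T 1) ⊗ₜ[A] x := by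
      change h.toLinearMap.rTensor E ((T 1 : A[T;T⁻¹]) • ((1 : A[T;T⁻¹]) ⊗ₜ[A] x)) = _
      rw [TensorProduct.smul_tmul', smul_eq_mul, mul_one]
      rfl
    simp only [h1]
    refine ⟨fun H => ?_, fun H x => ?_⟩
    · rw [← hc (h (T 1)), ← H, hφ, hc]
    · obtain ⟨a, rfl⟩ := e.surjective x
      have : e a = a • e 1 := by rw [← map_smul, smul_eq_mul, mul_one]
      rw [H, this, TensorProduct.tmul_smul, TensorProduct.tmul_smul, ← hφ,
        ← IsScalarTower.algebraMap_smul B a, map_smul, IsScalarTower.algebraMap_smul]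
  refine ⟨laurentLift t, (key _).2 (laurentLift_T t), fun h' H => laurentAlgHom_ext ?_⟩
  rw [(key h').1 H, laurentLift_T]

end Automorphisms

/-! ### Representations in standard form and their filtration -/

section Standard

set_option linter.unusedSectionVars false

variable {k : Type u} [Field k] {g : Type u} [LieRing g] [LieAlgebra k g]
  {A : Type u} [CommRing A] [Algebra k A] {E : Type u} [AddCommGroup E] [Module A E]
  [LieRingModule (A ⊗[k] g) E] [LieModule A (A ⊗[k] g) E]

/-- The action of `g` in the basis `e` is given by `x e₀ = 0`, `x e₁ = l(x) e₀`. -/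
structure IsStandard (e : Module.Basis (Fin 2) A E) (l : ab k g →ₗ[k] A) : Prop where
  lie_zero (x : g) : ⁅(1 : A) ⊗ₜ[k] x, e 0⁆ = 0
  lie_one (x : g) : ⁅(1 : A) ⊗ₜ[k] x, e 1⁆ = l (LieSubmodule.Quotient.mk x) • e 0

/-- The elements `1 ⊗ x` span `A ⊗ g` over `A`, so conditions on the action need only be tested on
`g`. -/
theorem lie_mem_of_forall_tmul {N : Submodule A E} {v : E}
    (h : ∀ x : g, ⁅(1 : A) ⊗ₜ[k] x, v⁆ ∈ N) (y : A ⊗[k] g) : ⁅y, v⁆ ∈ N := by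
  induction y with
  | zero => rw [zero_lie]; exact N.zero_mem
  | add a b ha hb => rw [add_lie]; exact N.add_mem ha hb
  | tmul a x =>
    have : a ⊗ₜ[k] x = a • ((1 : A) ⊗ₜ[k] x) := by
      rw [TensorProduct.smul_tmul', smul_eq_mul, mul_one]
    rw [this, smul_lie]
    exact N.smul_mem _ (h x)

theorem mem_fil_succ (i : ℕ) (v : E) :
    v ∈ fil k g A E (i + 1) ↔ ∀ x : g, ⁅(1 : A) ⊗ₜ[k] x, v⁆ ∈ fil k g A E i := by
  rw [fil, LieSubmodule.ucs_succ, LieSubmodule.mem_normalizer]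
  exact ⟨fun h x => h _, fun h y => lie_mem_of_forall_tmul (N := (fil k g A E i).toSubmodule) h y⟩

theorem mem_fil_one (v : E) : v ∈ fil k g A E 1 ↔ ∀ x : g, ⁅(1 : A) ⊗ₜ[k] x, v⁆ = 0 :=
  mem_fil_succ 0 v

theorem Basis.eq_add (e : Module.Basis (Fin 2) A E) (v : E) :
    v = e.repr v 0 • e 0 + e.repr v 1 • e 1 := by
  conv_lhs => rw [← e.sum_repr v]
  rw [Fin.sum_univ_two]

theorem Basis.smul_zero_inj (e : Module.Basis (Fin 2) A E) {a b : A} (h : a • e 0 = b • e 0) :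
    a = b := by
  simpa using congrArg (fun v => e.repr v 0) h

variable {e : Module.Basis (Fin 2) A E} {l : ab k g →ₗ[k] A}

theorem IsStandard.lie_eq (h : IsStandard e l) (x : g) (v : E) :
    ⁅(1 : A) ⊗ₜ[k] x, v⁆ = (l (LieSubmodule.Quotient.mk x) * e.repr v 1) • e 0 := by
  conv_lhs => rw [Basis.eq_add e v]
  rw [lie_add, lie_smul, lie_smul, h.lie_zero, h.lie_one, smul_zero, zero_add, smul_smul, mul_comm]

/-- The annihilator of `c` is an ideal containing all values of `l`. This replaces division by a
value of `l`, since no single value need be invertible. -/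
theorem eq_zero_of_forall_smul {l : ab k g →ₗ[k] A} (hl : Ideal.span (Set.range l) = ⊤) {M : Type u}
    [AddCommGroup M] [Module A M] {c : M}
    (h : ∀ x : g, l (LieSubmodule.Quotient.mk x) • c = 0) : c = 0 := by
  have h2 : Ideal.span (Set.range l) ≤ Module.annihilator A (Submodule.span A {c}) := by
    rw [Ideal.span_le]
    rintro _ ⟨y, rfl⟩
    obtain ⟨x, rfl⟩ := LieSubmodule.Quotient.surjective_mk' _ y
    rw [SetLike.mem_coe, Submodule.mem_annihilator_span_singleton]
    exact h x
  rw [hl] at h2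
  have := (Submodule.mem_annihilator_span_singleton c (1 : A)).1 (h2 trivial)
  rwa [one_smul] at this

/-- A vector is killed by `g` when every `l(x)` kills its `e₁`-coordinate, and unimodularity then
makes that coordinate vanish. -/
theorem IsStandard.mem_fil_one_iff (h : IsStandard e l) (hl : Ideal.span (Set.range l) = ⊤) (v : E) :
    v ∈ fil k g A E 1 ↔ e.repr v 1 = 0 := by
  simp only [mem_fil_one, h.lie_eq]
  refine ⟨fun H => eq_zero_of_forall_smul hl fun x => Basis.smul_zero_inj e ?_, fun H x => ?_⟩
  · rw [zero_smul]
    exact H x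
  · rw [H, mul_zero, zero_smul]

/-- Every `x` maps `E` into the line of `e₀`, which is killed by `g`. So the filtration is
everything from step two on. -/
theorem IsStandard.fil_add_two (h : IsStandard e l) (i : ℕ) : fil k g A E (i + 2) = ⊤ := by
  have h2 : fil k g A E 2 = ⊤ := by
    refine top_le_iff.1 fun v _ => (mem_fil_succ 1 v).2 fun x => (mem_fil_one _).2 fun y => ?_
    rw [h.lie_eq x, lie_smul, h.lie_zero, smul_zero]
  induction i with
  | zero => exact h2
  | succ i ih =>
    refine top_le_iff.1 fun v _ => (mem_fil_succ (i + 2) v).2 fun x => ?_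
    rw [ih]
    trivial

/-- The line `Fil₁` of a standard representation. -/
def IsStandard.filEquiv (h : IsStandard e l) (hl : Ideal.span (Set.range l) = ⊤) :
    A ≃ₗ[A] fil k g A E 1 :=
  LinearEquiv.ofBijective
    ((LinearMap.toSpanSingleton A E (e 0)).codRestrict (fil k g A E 1).toSubmodule fun a => by
      change a • e 0 ∈ fil k g A E 1
      rw [h.mem_fil_one_iff hl]
      simp)
    ⟨fun a b hab => Basis.smul_zero_inj e (congrArg Subtype.val hab), fun ⟨v, hv⟩ =>
      ⟨e.repr v 0, Subtype.ext (by
        have hv' := (h.mem_fil_one_iff hl v).1 hv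
        change e.repr v 0 • e 0 = v
        conv_rhs => rw [Basis.eq_add e v, hv', zero_smul, add_zero])⟩⟩

/-- The quotient by `Fil₁` of a standard representation. -/
def IsStandard.quotEquiv (h : IsStandard e l) (hl : Ideal.span (Set.range l) = ⊤) :
    (E ⧸ fil k g A E 1) ≃ₗ[A] A :=
  (Submodule.quotEquivOfEq (fil k g A E 1).toSubmodule (LinearMap.ker (e.coord 1)) (by
    ext v
    exact h.mem_fil_one_iff hl v)) ≪≫ₗ
  (e.coord 1).quotKerEquivOfSurjective fun a => ⟨a • e 1, by simp⟩

instance isTrivial_fil_one : LieModule.IsTrivial (A ⊗[k] g) (fil k g A E 1) :=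
  ⟨fun y v => Subtype.ext (lie_mem_of_forall_tmul (N := ⊥) ((mem_fil_one _).1 v.2) y)⟩

/-- By the definition of the filtration, `g` carries `Fil₂` into `Fil₁`. -/
theorem isTrivial_quotient (h : fil k g A E 2 = ⊤) :
    LieModule.IsTrivial (A ⊗[k] g) (E ⧸ fil k g A E 1) :=
  ⟨fun y v => by
    obtain ⟨v, rfl⟩ := LieSubmodule.Quotient.surjective_mk' _ v
    have hv : v ∈ fil k g A E 2 := h ▸ LieSubmodule.mem_top v
    exact (LieSubmodule.Quotient.mk_eq_zero (N := fil k g A E 1)).2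
      (lie_mem_of_forall_tmul (N := (fil k g A E 1).toSubmodule) ((mem_fil_succ 1 v).1 hv) y)⟩

theorem fil_succ_of_isTrivial [LieModule.IsTrivial (A ⊗[k] g) E] (i : ℕ) :
    fil k g A E (i + 1) = ⊤ := by
  refine top_le_iff.1 fun v _ => (mem_fil_succ i v).2 fun x => ?_
  rw [LieModule.IsTrivial.trivial]
  exact Submodule.zero_mem _

section Pullback

variable {A' : Type u} [CommRing A'] [Algebra k A'] [Algebra A A'] {E' : Type u} [AddCommGroup E']
  [Module A E'] [Module A' E'] [IsScalarTower A A' E'] [LieRingModule (A' ⊗[k] g) E']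
  [LieModule A' (A' ⊗[k] g) E'] {f : E →ₗ[A] E'}

theorem IsPullback.isTrivial (hf : IsPullback k g A' f) [LieModule.IsTrivial (A ⊗[k] g) E] :
    LieModule.IsTrivial (A' ⊗[k] g) E' := by
  refine ⟨fun y v => lie_mem_of_forall_tmul (N := ⊥) (fun x => ?_) y⟩
  change _ = _
  induction v using hf.isBaseChange.inductionOn with
  | zero => rw [lie_zero]
  | tmul e => rw [← hf.map_lie, LieModule.IsTrivial.trivial, map_zero]
  | smul a v ih => rw [lie_smul, ih, smul_zero]
  | add v w hv hw => rw [lie_add, hv, hw, add_zero]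

theorem IsStandard.pullback [IsScalarTower k A A'] (h : IsStandard e l) (hf : IsPullback k g A' f) :
    IsStandard (hf.isBaseChange.basis e)
      ((IsScalarTower.toAlgHom k A A').toLinearMap ∘ₗ l) where
  lie_zero x := by
    rw [IsBaseChange.basis_apply, ← hf.map_lie, h.lie_zero, map_zero]
  lie_one x := by
    rw [IsBaseChange.basis_apply, IsBaseChange.basis_apply, ← hf.map_lie, h.lie_one, map_smul,
      ← IsScalarTower.algebraMap_smul A']
    rfl

end Pullback

end Standard

/-! ### Automorphisms of standard representations -/

section StandardAutomorphisms

set_option linter.unusedSectionVars false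

variable {k : Type u} [Field k] {g : Type u} [LieRing g] [LieAlgebra k g]
  {A : Type u} [CommRing A] [Algebra k A] {E : Type u} [AddCommGroup E] [Module A E]

/-- The nilpotent endomorphism `e₀ ↦ 0`, `e₁ ↦ e₀`. -/
def shift (e : Module.Basis (Fin 2) A E) : E →ₗ[A] E :=
  (LinearMap.toSpanSingleton A E (e 0)).comp (e.coord 1)

theorem shift_apply (e : Module.Basis (Fin 2) A E) (v : E) : shift e v = e.repr v 1 • e 0 := rfl

theorem shift_shift (e : Module.Basis (Fin 2) A E) (v : E) : shift e (shift e v) = 0 := by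
  simp [shift_apply]

theorem shift_one (e : Module.Basis (Fin 2) A E) : shift e (e 1) = e 0 := by
  simp [shift_apply]

theorem baseChange_shift_shift (e : Module.Basis (Fin 2) A E) (B : Type u) [CommRing B]
    [Algebra A B] (z : B ⊗[A] E) :
    (shift e).baseChange B ((shift e).baseChange B z) = 0 := by
  induction z with
  | zero => simp
  | add a b ha hb => rw [map_add, map_add, ha, hb, add_zero]
  | tmul b v => simp [shift_shift]

/-- The automorphism `t + s N`, for `N` of square zero. -/
def unitAddSMul {B Z : Type u} [CommRing B] [AddCommGroup Z] [Module B Z] (N : Z →ₗ[B] Z)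
    (hN : ∀ z, N (N z) = 0) (t : Bˣ) (s : B) : Z ≃ₗ[B] Z :=
  { (t : B) • LinearMap.id + s • N with
    -- Since `N² = 0`, the inverse of `t + s N` is `t⁻¹ - t⁻² s N`.
    invFun := fun z => ((t⁻¹ : Bˣ) : B) • z - (((t⁻¹ : Bˣ) : B) * ((t⁻¹ : Bˣ) : B) * s) • N z
    left_inv := fun z => by
      change ((t⁻¹ : Bˣ) : B) • ((t : B) • z + s • N z) -
        (((t⁻¹ : Bˣ) : B) * ((t⁻¹ : Bˣ) : B) * s) • N ((t : B) • z + s • N z) = z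
      have h1 : ((t⁻¹ : Bˣ) : B) * ((t⁻¹ : Bˣ) : B) * s * (t : B) = ((t⁻¹ : Bˣ) : B) * s := by
        rw [mul_right_comm, mul_assoc ((t⁻¹ : Bˣ) : B), Units.inv_mul, mul_one]
      rw [map_add, map_smul, map_smul, hN, smul_zero, add_zero, smul_add, smul_smul, smul_smul,
        smul_smul, h1, Units.inv_mul, one_smul, add_sub_cancel_right]
    right_inv := fun z => by
      change (t : B) • (((t⁻¹ : Bˣ) : B) • z -
        (((t⁻¹ : Bˣ) : B) * ((t⁻¹ : Bˣ) : B) * s) • N z) + s • N (((t⁻¹ : Bˣ) : B) • z -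
        (((t⁻¹ : Bˣ) : B) * ((t⁻¹ : Bˣ) : B) * s) • N z) = z
      have h1 : (t : B) * (((t⁻¹ : Bˣ) : B) * ((t⁻¹ : Bˣ) : B) * s) = s * ((t⁻¹ : Bˣ) : B) := by
        rw [← mul_assoc, ← mul_assoc, Units.mul_inv, one_mul, mul_comm]
      rw [map_sub, map_smul, map_smul, hN, smul_zero, sub_zero, smul_sub, smul_smul, smul_smul,
        smul_smul, h1, Units.mul_inv, one_smul, sub_add_cancel] }

/-- The automorphism `t + s N`, where `N` is the nilpotent endomorphism `e₀ ↦ 0`, `e₁ ↦ e₀`. -/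
def shear (e : Module.Basis (Fin 2) A E) {B : Type u} [CommRing B] [Algebra A B] (t : Bˣ) (s : B) :
    (B ⊗[A] E) ≃ₗ[B] (B ⊗[A] E) :=
  unitAddSMul ((shift e).baseChange B) (baseChange_shift_shift e B) t s

theorem shear_apply (e : Module.Basis (Fin 2) A E) {B : Type u} [CommRing B] [Algebra A B] (t : Bˣ)
    (s : B) (z : B ⊗[A] E) : shear e t s z = (t : B) • z + s • (shift e).baseChange B z := rfl

theorem shear_one_tmul (e : Module.Basis (Fin 2) A E) {B : Type u} [CommRing B] [Algebra A B]
    (t : Bˣ) (s : B) (v : E) : shear e t s (1 ⊗ₜ v) = (t : B) ⊗ₜ v + s ⊗ₜ shift e v := by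
  simp [shear_apply, TensorProduct.smul_tmul']

variable [LieRingModule (A ⊗[k] g) E] [LieModule A (A ⊗[k] g) E]
  {e : Module.Basis (Fin 2) A E} {l : ab k g →ₗ[k] A}

theorem IsStandard.toEnd_eq (h : IsStandard e l) (x : g) :
    LieModule.toEnd A (A ⊗[k] g) E (1 ⊗ₜ[k] x) = l (LieSubmodule.Quotient.mk x) • shift e := by
  refine LinearMap.ext fun v => ?_
  rw [LieModule.toEnd_apply_apply, h.lie_eq, LinearMap.smul_apply, shift_apply, smul_smul]

/-- Each `x` acts as `l(x) N`, and unimodularity permits cancelling the factors `l(x)` jointly from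
the commutation relations. -/
theorem IsStandard.isRepAut_iff (h : IsStandard e l) (hl : Ideal.span (Set.range l) = ⊤)
    {B : Type u} [CommRing B] [Algebra A B] (φ : (B ⊗[A] E) ≃ₗ[B] (B ⊗[A] E)) :
    IsRepAut k g φ ↔
      ∀ z, φ ((shift e).baseChange B z) = (shift e).baseChange B (φ z) := by
  have hφ (a : A) (z : B ⊗[A] E) : φ (a • z) = a • φ z := by
    rw [← IsScalarTower.algebraMap_smul B a, map_smul, IsScalarTower.algebraMap_smul]
  simp only [IsRepAut, h.toEnd_eq, LinearMap.baseChange_smul, LinearMap.smul_apply, hφ]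
  refine ⟨fun H z => ?_, fun H x z => by rw [H]⟩
  rw [← sub_eq_zero]
  refine eq_zero_of_forall_smul hl fun x => ?_
  rw [smul_sub, H, sub_self]

/-- As `e₁` generates the module under `N`, a map commuting with `N` is determined by `φ(e₁) = s e₀
+ t e₁`. Applying `N` gives `φ(e₀) = t e₀`, and invertibility of `φ` makes `t` a unit. -/
theorem IsStandard.exists_eq_shear (h : IsStandard e l) (hl : Ideal.span (Set.range l) = ⊤)
    {B : Type u} [CommRing B] [Algebra A B] {φ : (B ⊗[A] E) ≃ₗ[B] (B ⊗[A] E)}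
    (hφ : IsRepAut k g φ) : ∃ (t : Bˣ) (s : B), φ = shear e t s := by
  rw [h.isRepAut_iff hl] at hφ
  let b := Algebra.TensorProduct.basis B e
  have hb (i : Fin 2) : b i = 1 ⊗ₜ e i := Algebra.TensorProduct.basis_apply e i
  have hN0 : (shift e).baseChange B (b 0) = 0 := by simp [hb, shift_apply]
  have hN1 : (shift e).baseChange B (b 1) = b 0 := by simp [hb, shift_one]
  let t := b.repr (φ (b 1)) 1
  let s := b.repr (φ (b 1)) 0
  have h1 : φ (b 1) = s • b 0 + t • b 1 := Basis.eq_add b _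
  have h0 : φ (b 0) = t • b 0 := by
    rw [← hN1, hφ, h1, map_add, map_smul, map_smul, hN0, hN1, smul_zero, zero_add]
  have ht : IsUnit t := by
    refine isUnit_iff_exists_inv.2 ⟨b.repr (φ.symm (b 0)) 0, ?_⟩
    have : t • φ.symm (b 0) = b 0 := by
      rw [← map_smul, ← h0, LinearEquiv.symm_apply_apply]
    simpa using congrArg (fun v => b.repr v 0) this
  obtain ⟨u, hu⟩ := ht
  refine ⟨u, s, ?_⟩
  refine LinearEquiv.toLinearMap_injective (b.ext fun i => ?_)
  rw [LinearEquiv.coe_coe, LinearEquiv.coe_coe, shear_apply, hu]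
  fin_cases i
  · change φ (b 0) = t • b 0 + s • (shift e).baseChange B (b 0)
    rw [h0, hN0, smul_zero, add_zero]
  · change φ (b 1) = t • b 1 + s • (shift e).baseChange B (b 1)
    rw [h1, hN1, add_comm]

open LaurentPolynomial in
/-- The automorphism group of a standard representation is `𝔾ₘ × 𝔾ₐ`. -/
theorem IsStandard.representsAut (h : IsStandard e l) (hl : Ideal.span (Set.range l) = ⊤) :
    RepresentsAut k g A E (Polynomial A[T;T⁻¹]) := by
  -- The universal automorphism is `T + X N`.
  let τ : (Polynomial A[T;T⁻¹])ˣ := Units.map Polynomial.C.toMonoidHom (laurentUnit A)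
  refine ⟨shear e τ Polynomial.X, (h.isRepAut_iff hl _).2 fun z => ?_, fun B _ _ φ hφ => ?_⟩
  · rw [shear_apply, shear_apply, map_add, map_smul, map_smul]
  obtain ⟨t, s, rfl⟩ := h.exists_eq_shear hl hφ
  -- The coordinates of the image of `e₁` recover `t` and `s`. Existence and uniqueness of the
  -- classifying map therefore reduce to the universal property of `A[T;T⁻¹][X]`.
  have key (f : Polynomial A[T;T⁻¹] →ₐ[A] B) :
      (∀ v : E, shear e t s (1 ⊗ₜ v) = f.toLinearMap.rTensor E (shear e τ Polynomial.X (1 ⊗ₜ v))) ↔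
        f (Polynomial.C (T 1)) = t ∧ f Polynomial.X = s := by
    simp only [shear_one_tmul, map_add, LinearMap.rTensor_tmul]
    refine ⟨fun H => ?_, fun ⟨H, H'⟩ v => ?_⟩
    · have H1 := H (e 1)
      rw [shift_one] at H1
      constructor
      · have := congrArg (fun v => (Algebra.TensorProduct.basis B e).repr v 1) H1
        exact (by simpa [Algebra.TensorProduct.basis_repr_tmul] using this.symm : f τ = t)
      · have := congrArg (fun v => (Algebra.TensorProduct.basis B e).repr v 0) H1
        simpa [Algebra.TensorProduct.basis_repr_tmul] using this.symm
    · rw [← H, ← H']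
      rfl
  let F : Polynomial A[T;T⁻¹] →ₐ[A] B :=
    { Polynomial.eval₂RingHom (laurentLift (A := A) t).toRingHom s with
      commutes' := fun a => by
        change Polynomial.eval₂ (laurentLift (A := A) t).toRingHom s
          (Polynomial.C (algebraMap A A[T;T⁻¹] a)) = _
        rw [Polynomial.eval₂_C]
        exact (laurentLift (A := A) t).commutes a }
  have hF (p) : F p = Polynomial.eval₂ (laurentLift (A := A) t).toRingHom s p := rfl
  refine ⟨F, (key F).2 ⟨?_, ?_⟩, fun f Hf => ?_⟩
  · rw [hF, Polynomial.eval₂_C]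
    exact laurentLift_T t
  · rw [hF, Polynomial.eval₂_X]
  · obtain ⟨h1, h2⟩ := (key f).1 Hf
    have h3 : f.comp (IsScalarTower.toAlgHom A A[T;T⁻¹] (Polynomial A[T;T⁻¹])) =
        laurentLift t := laurentAlgHom_ext (by rw [laurentLift_T]; exact h1)
    have : f.toRingHom = F.toRingHom := Polynomial.ringHom_ext
      (fun a => by
        change f (Polynomial.C a) = F (Polynomial.C a)
        rw [hF, Polynomial.eval₂_C]
        exact AlgHom.congr_fun h3 a)
      (by
        change f Polynomial.X = F Polynomial.X
        rw [h2, hF, Polynomial.eval₂_X])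
    exact AlgHom.ext fun x => RingHom.congr_fun this x

theorem IsStandard.autIsFlat (h : IsStandard e l) (hl : Ideal.span (Set.range l) = ⊤) :
    AutIsFlat k g A E :=
  ⟨_, _, _, h.representsAut hl, Module.Flat.trans A (LaurentPolynomial A) _⟩

theorem autIsFlat_of_isTrivial [LieModule.IsTrivial (A ⊗[k] g) E] (e : A ≃ₗ[A] E) :
    AutIsFlat k g A E :=
  ⟨_, _, _, representsAut_of_isTrivial e, inferInstance⟩

end StandardAutomorphisms

/-! ### Flag conditions in ranks zero, one and two -/

section Flags

set_option linter.unusedSectionVars false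

variable {k : Type u} [Field k] {g : Type u} [LieRing g] [LieAlgebra k g]
  {A : Type u} [CommRing A] [Algebra k A] {E : Type u} [AddCommGroup E] [Module A E]

theorem rankAtStalk_of_equiv (e : A ≃ₗ[A] E) (p : PrimeSpectrum A) :
    Module.rankAtStalk E p = 1 := by
  have := p.nontrivial
  rw [← Module.rankAtStalk_eq_of_equiv e, Module.rankAtStalk_self]
  rfl

theorem span_range_of_isBaseChange {A' : Type u} [CommRing A'] [Algebra A A'] {E' : Type u}
    [AddCommGroup E'] [Module A E'] [Module A' E'] [IsScalarTower A A' E'] {f : E →ₗ[A] E'}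
    (hf : IsBaseChange A' f) : Submodule.span A' (Set.range f) = ⊤ := by
  refine top_le_iff.1 fun v _ => ?_
  induction v using hf.inductionOn with
  | zero => exact Submodule.zero_mem _
  | tmul e => exact Submodule.subset_span ⟨e, rfl⟩
  | smul a v ih => exact Submodule.smul_mem _ a (ih trivial)
  | add v w hv hw => exact Submodule.add_mem _ (hv trivial) (hw trivial)

variable [LieRingModule (A ⊗[k] g) E] [LieModule A (A ⊗[k] g) E]
  {e : Module.Basis (Fin 2) A E} {l : ab k g →ₗ[k] A}

instance subsingleton_fil_zero : Subsingleton (fil k g A E 0) :=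
  inferInstanceAs (Subsingleton (⊥ : Submodule A E))

theorem subsingleton_quotient {i : ℕ} (h : fil k g A E i = ⊤) :
    Subsingleton (E ⧸ fil k g A E i) :=
  Submodule.Quotient.subsingleton_iff.2 (by rw [h]; rfl)

/-- The quotient by `Fil₀ = 0`. -/
def quotFilZeroEquiv : (E ⧸ fil k g A E 0) ≃ₗ[A] E :=
  Submodule.quotEquivOfEqBot _ rfl

/-- The submodule `Fil_i` when it is everything. -/
def filEquivOfEqTop {i : ℕ} (h : fil k g A E i = ⊤) : fil k g A E i ≃ₗ[A] E :=
  LinearEquiv.ofTop (fil k g A E i).toSubmodule (by rw [h]; rfl)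

section Pullback

variable {A' : Type u} [CommRing A'] [Algebra k A'] [Algebra A A'] {E' : Type u} [AddCommGroup E']
  [Module A E'] [Module A' E'] [IsScalarTower A A' E'] [LieRingModule (A' ⊗[k] g) E']
  [LieModule A' (A' ⊗[k] g) E'] {f : E →ₗ[A] E'}

theorem fil_zero_pullback :
    (fil k g A' E' 0 : Submodule A' E') = Submodule.span A' (f '' (fil k g A E 0 : Set E)) := by
  have : (fil k g A E 0 : Set E) = {0} := rfl
  rw [this, Set.image_singleton, map_zero, Submodule.span_zero_singleton]
  rfl

theorem fil_pullback_of_eq_top (hf : IsPullback k g A' f) {i : ℕ} (h : fil k g A E i = ⊤)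
    (h' : fil k g A' E' i = ⊤) :
    (fil k g A' E' i : Submodule A' E') = Submodule.span A' (f '' (fil k g A E i : Set E)) := by
  have : (fil k g A E i : Set E) = Set.univ := by rw [h]; rfl
  rw [this, Set.image_univ, span_range_of_isBaseChange hf.isBaseChange, h']
  rfl

end Pullback

theorem isFlag_zero [Subsingleton E] : IsFlag k g 0 A E where
  finite := inferInstance
  projective := inferInstance
  rank p := by rw [Module.rankAtStalk_eq_zero_of_subsingleton]; rfl
  finite_quotient i := inferInstance
  projective_quotient i := by
    have : Subsingleton (E ⧸ fil k g A E i) :=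
      inferInstanceAs (Subsingleton (E ⧸ (fil k g A E i).toSubmodule))
    infer_instance
  rank_fil i hi p := by
    have : Subsingleton (fil k g A E i) := inferInstance
    obtain rfl : i = 0 := Nat.le_zero.1 hi
    rw [Module.rankAtStalk_eq_zero_of_subsingleton]
    rfl
  fil_pullback A' _ _ _ _ E' _ _ _ _ _ _ f hf i := by
    have : Subsingleton E' := by
      refine ⟨fun v w => ?_⟩
      have h : Submodule.span A' (Set.range f) = ⊥ := by
        rw [Submodule.span_eq_bot]
        rintro _ ⟨v, rfl⟩
        rw [Subsingleton.elim v 0, map_zero]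
      rw [span_range_of_isBaseChange hf.isBaseChange] at h
      have h' (v : E') : v = 0 := (Submodule.mem_bot A').1 (h ▸ Submodule.mem_top)
      rw [h' v, h' w]
    exact Subsingleton.elim _ _

theorem isFlag_one [LieModule.IsTrivial (A ⊗[k] g) E] (e : A ≃ₗ[A] E) : IsFlag k g 1 A E where
  finite := Module.Finite.equiv e
  projective := Module.Projective.of_equiv e
  rank p := rankAtStalk_of_equiv e p
  finite_quotient i := by
    have := Module.Finite.equiv e
    exact Module.Finite.quotient A (fil k g A E i).toSubmodule
  projective_quotient i := by
    cases i with
    | zero => exact Module.Projective.of_equiv (e ≪≫ₗ quotFilZeroEquiv.symm)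
    | succ i =>
      have := subsingleton_quotient (fil_succ_of_isTrivial (k := k) (g := g) (A := A) (E := E) i)
      infer_instance
  rank_fil i hi p := by
    obtain rfl | rfl : i = 0 ∨ i = 1 := by omega
    · rw [Module.rankAtStalk_eq_zero_of_subsingleton]
      rfl
    · exact rankAtStalk_of_equiv (e ≪≫ₗ (filEquivOfEqTop (fil_succ_of_isTrivial 0)).symm) p
  fil_pullback A' _ _ _ _ E' _ _ _ _ _ _ f hf i := by
    cases i with
    | zero => exact fil_zero_pullback
    | succ i =>
      have := hf.isTrivial
      exact fil_pullback_of_eq_top hf (fil_succ_of_isTrivial i) (fil_succ_of_isTrivial i)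

theorem isNondegenerateOverField_one {K : Type u} [Field K] [Algebra k K] {E : Type u}
    [AddCommGroup E] [Module K E] [LieRingModule (K ⊗[k] g) E] [LieModule K (K ⊗[k] g) E]
    [LieModule.IsTrivial (K ⊗[k] g) E] (e : K ≃ₗ[K] E) : IsNondegenerateOverField k g 1 K E := by
  refine ⟨⟨Module.Finite.equiv e, ?_, ?_, fun i hi => ?_⟩, inferInstance⟩
  · rw [← e.finrank_eq, Module.finrank_self]
  · exact LieModule.trivialIsNilpotent (K ⊗[k] g) E
  · obtain rfl | rfl : i = 0 ∨ i = 1 := by omega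
    · exact Module.finrank_zero_of_subsingleton
    · exact (e ≪≫ₗ (filEquivOfEqTop (fil_succ_of_isTrivial 0)).symm).finrank_eq.symm.trans
        (Module.finrank_self K)

/-- The two representations of rank zero, on `Fil₀` and `E / Fil₁`, vanish, triviality passes to
field-valued points, and the automorphism group `𝔾ₘ` is flat. -/
theorem isNondegenerate_one [LieModule.IsTrivial (A ⊗[k] g) E] (e : A ≃ₗ[A] E) :
    IsNondegenerate k g 1 A E := by
  have := subsingleton_quotient (fil_succ_of_isTrivial (k := k) (g := g) (A := A) (E := E) 0)
  refine ⟨isFlag_one e, isFlag_zero, isFlag_zero, ?_, autIsFlat_of_isTrivial e⟩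
  intro K _ _ _ _ E' _ _ _ _ _ _ f hf
  have := hf.isTrivial
  exact isNondegenerateOverField_one ((TensorProduct.AlgebraTensorModule.rid A K K).symm ≪≫ₗ
    TensorProduct.AlgebraTensorModule.congr (LinearEquiv.refl K K) e ≪≫ₗ hf.isBaseChange.equiv)

/-- The filtration is `0 ⊂ A e₀ ⊂ E`, with free quotients. A pullback is again standard with
unimodular functional, so its filtration has the same description. -/
theorem IsStandard.isFlag (h : IsStandard e l) (hl : Ideal.span (Set.range l) = ⊤) :
    IsFlag k g 2 A E where
  finite := Module.Finite.of_basis e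
  projective := Module.Projective.of_basis e
  rank p := by
    have := p.nontrivial
    have := Module.Free.of_basis e
    rw [Module.rankAtStalk_eq_finrank_of_free, Module.finrank_eq_card_basis e]
    rfl
  finite_quotient i := by
    have := Module.Finite.of_basis e
    exact Module.Finite.quotient A (fil k g A E i).toSubmodule
  projective_quotient i := by
    match i with
    | 0 =>
      have := Module.Projective.of_basis e
      exact Module.Projective.of_equiv (quotFilZeroEquiv (k := k) (g := g) (A := A) (E := E)).symm
    | 1 => exact Module.Projective.of_equiv (h.quotEquiv hl).symm
    | i + 2 =>
      have := subsingleton_quotient (h.fil_add_two i)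
      infer_instance
  rank_fil i hi p := by
    obtain rfl | rfl | rfl : i = 0 ∨ i = 1 ∨ i = 2 := by omega
    · rw [Module.rankAtStalk_eq_zero_of_subsingleton]
      rfl
    · exact rankAtStalk_of_equiv (h.filEquiv hl) p
    · have := p.nontrivial
      have := Module.Free.of_basis e
      rw [Module.rankAtStalk_eq_of_equiv (filEquivOfEqTop (h.fil_add_two 0)),
        Module.rankAtStalk_eq_finrank_of_free, Module.finrank_eq_card_basis e]
      rfl
  fil_pullback A' _ _ _ _ E' _ _ _ _ _ _ f hf i := by
    have h' := h.pullback hf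
    have hl' := span_range_comp (IsScalarTower.toAlgHom k A A') hl
    match i with
    | 0 => exact fil_zero_pullback
    | 1 =>
      -- After base change `Fil₁` is the line of the image of `e₀`, and `e₀` itself lies in the
      -- original `Fil₁`.
      refine le_antisymm (fun v hv => ?_) (Submodule.span_le.2 ?_)
      · have hv' := (h'.mem_fil_one_iff hl' v).1 hv
        rw [Basis.eq_add (hf.isBaseChange.basis e) v, hv', zero_smul, add_zero,
          IsBaseChange.basis_apply]
        refine Submodule.smul_mem _ _ (Submodule.subset_span ⟨e 0, ?_, rfl⟩)
        exact (mem_fil_one _).2 h.lie_zero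
      · rintro _ ⟨v, hv, rfl⟩
        have hv' := (mem_fil_one v).1 hv
        refine (mem_fil_one _).2 fun x => ?_
        rw [← hf.map_lie, hv', map_zero]
    | i + 2 => exact fil_pullback_of_eq_top hf (h.fil_add_two i) (h'.fil_add_two i)

end Flags

/-! ### Bringing a representation into standard form -/

section ExistsStandard

variable {k : Type u} [Field k] {g : Type u} [LieRing g] [LieAlgebra k g]
  {A : Type u} [CommRing A] [Algebra k A] {E : Type u} [AddCommGroup E] [Module A E]
  [LieRingModule (A ⊗[k] g) E] [LieModule A (A ⊗[k] g) E]

/-- The coefficient of `v₀` is unique because `v₀` has zero annihilator, which makes it linear in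
`x`. It vanishes on brackets since `x (y v₁)` and `y (x v₁)` are both zero, `y v₁` and `x v₁` being
multiples of the killed vector `v₀`. -/
theorem exists_linearMap_lie {v₀ v₁ : E} (h₀ : ∀ x : g, ⁅(1 : A) ⊗ₜ[k] x, v₀⁆ = 0)
    (hinj : ∀ a : A, a • v₀ = 0 → a = 0) (h₁ : ∀ x : g, ∃ a : A, ⁅(1 : A) ⊗ₜ[k] x, v₁⁆ = a • v₀) :
    ∃ l : ab k g →ₗ[k] A, ∀ x : g, ⁅(1 : A) ⊗ₜ[k] x, v₁⁆ = l (LieSubmodule.Quotient.mk x) • v₀ := by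
  choose c hc using h₁
  have hinj' {a b : A} (h : a • v₀ = b • v₀) : a = b := by
    rw [← sub_eq_zero]
    refine hinj _ ?_
    rw [sub_smul, h, sub_self]
  let l : g →ₗ[k] A :=
    { toFun := c
      map_add' := fun x y => hinj' (by
        rw [← hc, TensorProduct.tmul_add, add_lie, add_smul, hc, hc])
      map_smul' := fun r x => hinj' (by
        have : (1 : A) ⊗ₜ[k] (r • x) = algebraMap k A r • ((1 : A) ⊗ₜ[k] x) := by
          rw [TensorProduct.tmul_smul, algebraMap_smul]
        rw [← hc, this, smul_lie, hc, RingHom.id_apply, Algebra.smul_def, mul_smul]) }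
  have hl : (LieAlgebra.derivedSeries k g 1).toSubmodule ≤ LinearMap.ker l := by
    refine (LieAlgebra.coe_derivedSeries_one_eq k g).trans_le (Submodule.span_le.2 ?_)
    rintro _ ⟨x, y, rfl⟩
    refine hinj' ?_
    have : (1 : A) ⊗ₜ[k] ⁅x, y⁆ = ⁅(1 : A) ⊗ₜ[k] x, (1 : A) ⊗ₜ[k] y⁆ := by simp
    change c ⁅x, y⁆ • v₀ = (0 : A) • v₀
    rw [← hc, this, lie_lie, hc, hc, lie_smul, lie_smul, h₀, h₀, smul_zero, smul_zero, sub_zero,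
      zero_smul]
  exact ⟨Submodule.liftQ _ l hl, fun x => hc x⟩

/-- A generator `v₀` of `Fil₁` and a lift `v₁` of a generator of the quotient form a basis of the
extension `E`. As `v₁` lies in `Fil₂`, the action sends it to multiples of `v₀`. -/
theorem exists_isStandard (e₁ : A ≃ₗ[A] fil k g A E 1) (e₂ : A ≃ₗ[A] (E ⧸ fil k g A E 1))
    (h : fil k g A E 2 = ⊤) :
    ∃ (e : Module.Basis (Fin 2) A E) (l : ab k g →ₗ[k] A), IsStandard e l := by
  obtain ⟨v₁, hv₁⟩ := Submodule.mkQ_surjective (fil k g A E 1).toSubmodule (e₂ 1)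
  have hmk (a : A) : (fil k g A E 1).toSubmodule.mkQ (a • v₁) = e₂ a := by
    rw [map_smul, hv₁, ← map_smul, smul_eq_mul, mul_one]
  have hmem (a : A) : ((e₁ a : fil k g A E 1) : E) = a • (e₁ 1 : fil k g A E 1) := by
    rw [← LieSubmodule.coe_smul, ← map_smul, smul_eq_mul, mul_one]
  let v₀ : E := (e₁ 1 : fil k g A E 1)
  have hv₀ (a : A) (ha : a • v₀ = 0) : a = 0 := by
    refine e₁.injective ?_
    rw [map_zero]
    exact Subtype.ext ((hmem a).trans ha)
  let F : (Fin 2 → A) →ₗ[A] E :=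
    (LinearMap.toSpanSingleton A E v₀).comp (LinearMap.proj 0) +
      (LinearMap.toSpanSingleton A E v₁).comp (LinearMap.proj 1)
  have hF (c : Fin 2 → A) : F c = c 0 • v₀ + c 1 • v₁ := rfl
  have h0 (a : A) : (fil k g A E 1).toSubmodule.mkQ (a • v₀) = 0 :=
    (Submodule.Quotient.mk_eq_zero _).2 (Submodule.smul_mem _ a (e₁ 1).2)
  have hbij : Function.Bijective F := by
    constructor
    · rw [injective_iff_map_eq_zero]
      intro c hc
      rw [hF] at hc
      have h1 : c 1 = 0 := by
        refine e₂.injective ?_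
        rw [← hmk, map_zero, ← map_zero (fil k g A E 1).toSubmodule.mkQ, ← hc, map_add, h0,
          zero_add]
      rw [h1, zero_smul, add_zero] at hc
      have h0 := hv₀ _ hc
      ext i
      fin_cases i
      · exact h0
      · exact h1
    · intro v
      obtain ⟨a, ha⟩ := e₂.surjective ((fil k g A E 1).toSubmodule.mkQ v)
      have hv : v - a • v₁ ∈ fil k g A E 1 := by
        refine (Submodule.Quotient.mk_eq_zero (fil k g A E 1).toSubmodule).1 ?_
        change (fil k g A E 1).toSubmodule.mkQ (v - a • v₁) = 0
        rw [map_sub, hmk, ha, sub_self]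
      obtain ⟨b, hb⟩ := e₁.surjective ⟨_, hv⟩
      refine ⟨![b, a], ?_⟩
      rw [hF]
      change b • v₀ + a • v₁ = v
      rw [← hmem, hb, sub_add_cancel]
  let e : Module.Basis (Fin 2) A E := Module.Basis.ofEquivFun (LinearEquiv.ofBijective F hbij).symm
  have he (i : Fin 2) : e i = F (Pi.single i 1) := by
    simp [e, Module.Basis.coe_ofEquivFun]
  have he0 : e 0 = v₀ := by rw [he, hF]; simp
  have he1 : e 1 = v₁ := by rw [he, hF]; simp
  have hv₀' : ∀ x : g, ⁅(1 : A) ⊗ₜ[k] x, v₀⁆ = 0 := (mem_fil_one _).1 (e₁ 1).2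
  obtain ⟨l, hl⟩ := exists_linearMap_lie (v₁ := v₁) hv₀' hv₀ fun x => by
    have : v₁ ∈ fil k g A E 2 := h ▸ LieSubmodule.mem_top v₁
    obtain ⟨a, ha⟩ := e₁.surjective ⟨_, (mem_fil_succ 1 v₁).1 this x⟩
    exact ⟨a, by rw [← hmem, ha]⟩
  refine ⟨e, l, fun x => ?_, fun x => ?_⟩
  · rw [he0, hv₀']
  · rw [he0, he1, hl]

theorem IsStandard.fil_one_eq_top {e : Module.Basis (Fin 2) A E} {l : ab k g →ₗ[k] A}
    (h : IsStandard e l) (hl : ∀ y, l y = 0) : fil k g A E 1 = ⊤ :=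
  top_le_iff.1 fun v _ => (mem_fil_one v).2 fun x => by rw [h.lie_eq, hl, zero_mul, zero_smul]

end ExistsStandard

/-! ### Nondegeneracy over fields -/

section OverField

variable {k : Type u} [Field k] {g : Type u} [LieRing g] [LieAlgebra k g]
  {K : Type u} [Field K] [Algebra k K] {E : Type u} [AddCommGroup E] [Module K E]
  [LieRingModule (K ⊗[k] g) E] [LieModule K (K ⊗[k] g) E]

/-- Dimension counts make `Fil₁` and `E / Fil₁` lines and `Fil₂` everything. If all values of the
functional were zero, `Fil₁` would have dimension two. -/
theorem IsFlagOverField.exists_isStandard (h : IsFlagOverField k g 2 K E) :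
    ∃ (e : Module.Basis (Fin 2) K E) (l : ab k g →ₗ[k] K),
      IsStandard e l ∧ Ideal.span (Set.range l) = ⊤ := by
  have := h.finite
  have h1 := h.finrank_fil 1 one_le_two
  have h2 : fil k g K E 2 = ⊤ := by
    rw [← LieSubmodule.toSubmodule_eq_top]
    exact Submodule.eq_top_of_finrank_eq ((h.finrank_fil 2 le_rfl).trans h.finrank_eq.symm)
  have h3 : Module.finrank K (E ⧸ fil k g K E 1) = 1 := by
    have := Submodule.finrank_quotient_add_finrank (fil k g K E 1).toSubmodule
    have h1' : Module.finrank K (fil k g K E 1).toSubmodule = 1 := h1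
    rw [h.finrank_eq, h1'] at this
    exact Nat.succ_injective this
  have : Module.Finite K (E ⧸ fil k g K E 1) :=
    Module.Finite.quotient K (fil k g K E 1).toSubmodule
  have : Module.Finite K (fil k g K E 1) :=
    inferInstanceAs (Module.Finite K (fil k g K E 1).toSubmodule)
  obtain ⟨e, l, hel⟩ := NilpotentModuli.exists_isStandard
    (LinearEquiv.ofFinrankEq K (fil k g K E 1) ((Module.finrank_self K).trans h1.symm))
    (LinearEquiv.ofFinrankEq K (E ⧸ fil k g K E 1) ((Module.finrank_self K).trans h3.symm)) h2
  refine ⟨e, l, hel, (Ideal.eq_bot_or_top _).resolve_left fun hbot => ?_⟩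
  have htop := hel.fil_one_eq_top fun y => (Ideal.span_eq_bot.1 hbot) _ ⟨y, rfl⟩
  have := (filEquivOfEqTop htop).finrank_eq
  rw [h1, h.finrank_eq] at this
  omega

theorem IsStandard.isFlagOverField {e : Module.Basis (Fin 2) K E} {l : ab k g →ₗ[k] K}
    (h : IsStandard e l) (hl : Ideal.span (Set.range l) = ⊤) : IsFlagOverField k g 2 K E where
  finite := Module.Finite.of_basis e
  finrank_eq := by rw [Module.finrank_eq_card_basis e]; rfl
  isNilpotent := (LieModule.isNilpotent_iff_exists_ucs_eq_top K).2 ⟨2, h.fil_add_two 0⟩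
  finrank_fil i hi := by
    obtain rfl | rfl | rfl : i = 0 ∨ i = 1 ∨ i = 2 := by omega
    · exact Module.finrank_zero_of_subsingleton
    · exact (h.filEquiv hl).finrank_eq.symm.trans (Module.finrank_self K)
    · rw [(filEquivOfEqTop (h.fil_add_two 0)).finrank_eq, Module.finrank_eq_card_basis e]
      rfl

theorem ringKrullDim_of_representsAut {e : Module.Basis (Fin 2) K E} {l : ab k g →ₗ[k] K}
    (h : IsStandard e l) (hl : Ideal.span (Set.range l) = ⊤) {R : Type u} [CommRing R]
    [Algebra K R] (hR : RepresentsAut k g K E R) : ringKrullDim R = 2 := by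
  obtain ⟨φ⟩ := hR.algEquiv (h.representsAut hl)
  rw [ringKrullDim_eq_of_ringEquiv φ.toRingEquiv, ringKrullDim_polynomial_laurentPolynomial]

/-- Every competitor in the minimality condition is itself standard, with automorphism group of
dimension two, so the required inequality is an equality. -/
theorem IsStandard.isNondegenerateOverField {e : Module.Basis (Fin 2) K E} {l : ab k g →ₗ[k] K}
    (h : IsStandard e l) (hl : Ideal.span (Set.range l) = ⊤) :
    IsNondegenerateOverField k g 2 K E := by
  have := isTrivial_quotient (h.fil_add_two 0)
  have h1 : IsNondegenerateOverField k g 1 K (fil k g K E 1) :=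
    isNondegenerateOverField_one (h.filEquiv hl)
  refine ⟨h.isFlagOverField hl, h1,
    isNondegenerateOverField_one (h.quotEquiv hl).symm, _, _, _, h.representsAut hl, ?_⟩
  intro K' _ _ E' _ _ _ _ R' _ _ hE' _ _ hR'
  obtain ⟨e', l', h', hl'⟩ := hE'.exists_isStandard
  rw [ringKrullDim_of_representsAut h' hl' hR', ringKrullDim_polynomial_laurentPolynomial]

end OverField

/-! ### Nondegeneracy of standard families -/

section Families

variable {k : Type u} [Field k] {g : Type u} [LieRing g] [LieAlgebra k g]
  {A : Type u} [CommRing A] [Algebra k A] {E : Type u} [AddCommGroup E] [Module A E]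
  [LieRingModule (A ⊗[k] g) E] [LieModule A (A ⊗[k] g) E]

theorem IsStandard.isNondegenerate {e : Module.Basis (Fin 2) A E} {l : ab k g →ₗ[k] A}
    (h : IsStandard e l) (hl : Ideal.span (Set.range l) = ⊤) : IsNondegenerate k g 2 A E := by
  have := isTrivial_quotient (h.fil_add_two 0)
  refine ⟨h.isFlag hl, isNondegenerate_one (h.filEquiv hl),
    isNondegenerate_one (h.quotEquiv hl).symm, ?_, h.autIsFlat hl⟩
  intro K _ _ _ _ E' _ _ _ _ _ _ f hf
  exact (h.pullback hf).isNondegenerateOverField (span_range_comp (IsScalarTower.toAlgHom k A K) hl)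

end Families

/-! ### Local standard form of nondegenerate families -/

section LocalStandardForm

/-- The map `A → A'` factors through the localization at `a`, so `M'` is a base change of the free
module obtained there. -/
theorem free_of_isBaseChange_of_isUnit {A : Type u} [CommRing A] {M : Type u} [AddCommGroup M]
    [Module A M] {a : A} (h : Module.Free (Localization.Away a) (LocalizedModule.Away a M))
    {A' : Type u} [CommRing A'] [Algebra A A'] (ha : IsUnit (algebraMap A A' a)) {M' : Type u}
    [AddCommGroup M'] [Module A M'] [Module A' M'] [IsScalarTower A A' M'] {f : M →ₗ[A] M'}
    (hf : IsBaseChange A' f) : Module.Free A' M' := by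
  let _ : Algebra (Localization.Away a) A' := (IsLocalization.Away.lift a ha).toAlgebra
  have : IsScalarTower A (Localization.Away a) A' :=
    IsScalarTower.of_algebraMap_eq fun x => (IsLocalization.Away.lift_eq a ha x).symm
  have hloc : IsBaseChange (Localization.Away a)
      (LocalizedModule.mkLinearMap (Submonoid.powers a) M) :=
    IsLocalizedModule.isBaseChange (Submonoid.powers a) _ _
  have := Module.Free.of_equiv hloc.equiv.symm
  exact Module.Free.of_equiv
    (TensorProduct.AlgebraTensorModule.cancelBaseChange A (Localization.Away a) A' A' M ≪≫ₗ hf.equiv)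

theorem nonempty_linearEquiv_of_rankAtStalk {A : Type u} [CommRing A] [Nontrivial A] {M : Type u}
    [AddCommGroup M] [Module A M] [Module.Free A M]
    (h : ∀ p : PrimeSpectrum A, Module.rankAtStalk M p = 1) : Nonempty (A ≃ₗ[A] M) := by
  obtain ⟨p⟩ := (inferInstance : Nonempty (PrimeSpectrum A))
  refine Module.nonempty_linearEquiv_of_finrank_eq_one ?_
  rw [← h p, Module.rankAtStalk_eq_finrank_of_free]
  rfl

variable {k : Type u} [Field k] {g : Type u} [LieRing g] [LieAlgebra k g]
  {A : Type u} [CommRing A] [Algebra k A] {E : Type u} [AddCommGroup E] [Module A E]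
  [LieRingModule (A ⊗[k] g) E] [LieModule A (A ⊗[k] g) E]

/-- If the values of `l` lay in a maximal ideal, the reduction modulo it would be a trivial
representation with `Fil₁` of rank two, whereas flags are stable under base change and have `Fil₁`
of rank one. -/
theorem IsStandard.span_range_eq_top {e : Module.Basis (Fin 2) A E} {l : ab k g →ₗ[k] A}
    (h : IsStandard e l) (hE : IsFlag k g 2 A E) : Ideal.span (Set.range l) = ⊤ := by
  by_contra hl
  obtain ⟨m, hm, hlm⟩ := Ideal.exists_le_maximal _ hl
  let M : Rep k g A := ⟨E⟩
  have hf : IsPullback k g (A ⧸ m) (M.toPullback (A ⧸ m)) := M.toPullback_isPullback (A ⧸ m)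
  have h1 := (h.pullback hf).fil_one_eq_top fun y =>
    Ideal.Quotient.eq_zero_iff_mem.2 (hlm (Ideal.subset_span ⟨y, rfl⟩))
  have h2 := hE.pullback k g hf
  obtain ⟨p⟩ := (inferInstance : Nonempty (PrimeSpectrum (A ⧸ m)))
  have h3 := h2.rank_fil 1 one_le_two p
  rw [Module.rankAtStalk_eq_of_equiv (filEquivOfEqTop h1), h2.rank] at h3
  omega

/-- Nondegeneracy of `E / Fil₁` in rank one makes its own quotient by `Fil₁` projective of rank
zero, hence zero. So `g` kills `E / Fil₁`. -/
theorem IsNondegenerate.fil_two_eq_top (h : IsNondegenerate k g 2 A E) : fil k g A E 2 = ⊤ := by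
  have h0 : IsFlag k g 0 A ((E ⧸ fil k g A E 1) ⧸ fil k g A (E ⧸ fil k g A E 1) 1) :=
    h.2.2.1.2.2.1
  have := h0.finite
  have := h0.projective
  have h1 : Subsingleton ((E ⧸ fil k g A E 1) ⧸ fil k g A (E ⧸ fil k g A E 1) 1) :=
    Module.rankAtStalk_eq_zero_iff_subsingleton.1 (funext h0.rank)
  refine top_le_iff.1 fun v _ => (mem_fil_succ 1 v).2 fun x => ?_
  have h2 : LieSubmodule.Quotient.mk' (fil k g A E 1) v ∈ fil k g A (E ⧸ fil k g A E 1) 1 :=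
    (Submodule.Quotient.mk_eq_zero _).1 (h1.elim _ _)
  exact (LieSubmodule.Quotient.mk_eq_zero (N := fil k g A E 1)).1 ((mem_fil_one _).1 h2 x)

/-- Nondegenerate nilpotent representations of rank two are locally of standard form. -/
theorem IsNondegenerate.exists_isStandard (h : IsNondegenerate k g 2 A E) (p : PrimeSpectrum A) :
    ∃ a ∉ p.asIdeal, ∀ (A' : Type u) [CommRing A'] [Nontrivial A'] [Algebra k A'] [Algebra A A']
      [IsScalarTower k A A'] (E' : Type u) [AddCommGroup E'] [Module A E'] [Module A' E']
      [IsScalarTower A A' E'] [LieRingModule (A' ⊗[k] g) E'] [LieModule A' (A' ⊗[k] g) E']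
      (f : E →ₗ[A] E'), IsPullback k g A' f → IsUnit (algebraMap A A' a) →
      ∃ (e : Module.Basis (Fin 2) A' E') (l : ab k g →ₗ[k] A'),
        IsStandard e l ∧ Ideal.span (Set.range l) = ⊤ := by
  have hE : IsFlag k g 2 A E := h.1
  have hQ : IsFlag k g 1 A (E ⧸ fil k g A E 1) := h.2.2.1.1
  have := hE.finite_fil k g 1
  have := hE.projective_fil k g 1
  have := hE.finite_quotient 1
  have := hE.projective_quotient 1
  -- `Fil₁` and `E / Fil₁` are finite projective of constant rank, so each becomes free on a basic
  -- open around `p`; inverting the product of the two elements makes both free.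
  obtain ⟨a, ha, ha'⟩ := Module.Free.away_of_finite_of_flat_of_rankAtStalk_constant
    (fil k g A E 1) p.asIdeal fun m _ => by
      rw [hE.rank_fil 1 one_le_two, hE.rank_fil 1 one_le_two]
  obtain ⟨b, hb, hb'⟩ := Module.Free.away_of_finite_of_flat_of_rankAtStalk_constant
    (E ⧸ fil k g A E 1) p.asIdeal fun m _ => by rw [hQ.rank, hQ.rank]
  refine ⟨a * b, fun hab => (p.2.mem_or_mem hab).elim ha hb, ?_⟩
  intro A' _ _ _ _ _ E' _ _ _ _ _ _ f hf hu
  rw [map_mul] at hu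
  have hE' := hE.pullback k g hf
  have h' := IsNondegenerate.pullback k g 2 hf h
  have hQ' : IsFlag k g 1 A' (E' ⧸ fil k g A' E' 1) := h'.2.2.1.1
  have := free_of_isBaseChange_of_isUnit ha' (isUnit_of_mul_isUnit_left hu)
    (filMap_isPullback k g hE hf 1).isBaseChange
  have := free_of_isBaseChange_of_isUnit hb' (isUnit_of_mul_isUnit_right hu)
    (quotMap_isPullback k g hE hf 1).isBaseChange
  obtain ⟨e₁⟩ := nonempty_linearEquiv_of_rankAtStalk (hE'.rank_fil 1 one_le_two)
  obtain ⟨e₂⟩ := nonempty_linearEquiv_of_rankAtStalk hQ'.rank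
  obtain ⟨e, l, hel⟩ := NilpotentModuli.exists_isStandard e₁ e₂ h'.fil_two_eq_top
  exact ⟨e, l, hel, hel.span_range_eq_top hE'⟩

end LocalStandardForm

/-! ### Isomorphisms between standard representations -/

section Isomorphisms

variable {k : Type u} [Field k] {g : Type u} [LieRing g] [LieAlgebra k g]
  {A : Type u} [CommRing A] [Algebra k A]

theorem map_lie_of_forall_tmul {E F : Type u} [AddCommGroup E] [Module A E]
    [LieRingModule (A ⊗[k] g) E] [LieModule A (A ⊗[k] g) E] [AddCommGroup F] [Module A F]
    [LieRingModule (A ⊗[k] g) F] [LieModule A (A ⊗[k] g) F] (φ : E →ₗ[A] F)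
    (h : ∀ (x : g) (v : E), φ ⁅(1 : A) ⊗ₜ[k] x, v⁆ = ⁅(1 : A) ⊗ₜ[k] x, φ v⁆) (y : A ⊗[k] g)
    (v : E) : φ ⁅y, v⁆ = ⁅y, φ v⁆ := by
  induction y with
  | zero => rw [zero_lie, zero_lie, map_zero]
  | add a b ha hb => rw [add_lie, add_lie, map_add, ha, hb]
  | tmul a x =>
    have : a ⊗ₜ[k] x = a • ((1 : A) ⊗ₜ[k] x) := by
      rw [TensorProduct.smul_tmul', smul_eq_mul, mul_one]
    rw [this, smul_lie, smul_lie, map_smul, h]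

theorem IsStandard.iso {M N : Rep k g A} {e : Module.Basis (Fin 2) A M.carrier}
    {e' : Module.Basis (Fin 2) A N.carrier} {l l' : ab k g →ₗ[k] A} (h : IsStandard e l)
    (h' : IsStandard e' l') (u : Aˣ) (hu : ∀ y, l' y = u * l y) : M.Iso N := by
  -- Scaling only `e₀` by `u` matches the actions: `x e₁ = l(x) e₀` goes to `u l(x) e'₀ = l'(x)
  -- e'₀`.
  let φ : M.carrier ≃ₗ[A] N.carrier := e.equiv (e'.unitsSMul ![u, 1]) (Equiv.refl _)
  have h0 : φ (e 0) = (u : A) • e' 0 := by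
    rw [Module.Basis.equiv_apply, Module.Basis.unitsSMul_apply]
    rfl
  have h1 : φ (e 1) = e' 1 := by
    rw [Module.Basis.equiv_apply, Module.Basis.unitsSMul_apply]
    exact one_smul _ _
  refine ⟨{ φ with map_lie' := fun {y v} => map_lie_of_forall_tmul φ.toLinearMap ?_ y v }⟩
  intro x v
  change φ _ = ⁅_, φ v⁆
  rw [Basis.eq_add e v]
  simp only [lie_add, lie_smul, map_add, map_smul, h0, h1, h.lie_zero, h'.lie_zero, h.lie_one,
    h'.lie_one, smul_zero, zero_add, hu, mul_smul, smul_comm (u : A)]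

/-- An isomorphism preserves `Fil₁`, so `φ(e₀) = a e'₀` and `φ(e₁)` is `c e'₁` modulo `e'₀`, with
`a` and `c` units because `φ` is invertible. Comparing the action on `e₁` gives `l(x) a = l'(x) c`.
-/
theorem IsStandard.exists_units {M N : Rep k g A} {e : Module.Basis (Fin 2) A M.carrier}
    {e' : Module.Basis (Fin 2) A N.carrier} {l l' : ab k g →ₗ[k] A} (h : IsStandard e l)
    (h' : IsStandard e' l') (hl : Ideal.span (Set.range l) = ⊤)
    (hl' : Ideal.span (Set.range l') = ⊤) (hMN : M.Iso N) : ∃ u : Aˣ, ∀ y, l' y = u * l y := by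
  obtain ⟨φ⟩ := hMN
  have key {M N : Rep k g A} {e : Module.Basis (Fin 2) A M.carrier}
      {e' : Module.Basis (Fin 2) A N.carrier} {l l' : ab k g →ₗ[k] A} (h : IsStandard e l)
      (h' : IsStandard e' l') (hl' : Ideal.span (Set.range l') = ⊤)
      (φ : M.carrier ≃ₗ⁅A, A ⊗[k] g⁆ N.carrier) : φ (e 0) = e'.repr (φ (e 0)) 0 • e' 0 := by
    have : e'.repr (φ (e 0)) 1 = 0 := (h'.mem_fil_one_iff hl' _).1 ((mem_fil_one _).2 fun x => by
      have h1 : φ ⁅(1 : A) ⊗ₜ[k] x, e 0⁆ = ⁅(1 : A) ⊗ₜ[k] x, φ (e 0)⁆ :=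
        φ.toLieModuleHom.map_lie _ _
      rw [← h1, h.lie_zero, map_zero])
    conv_lhs => rw [Basis.eq_add e' (φ (e 0)), this, zero_smul, add_zero]
  have k0 := key h h' hl' φ
  have k0' := key h' h hl φ.symm
  set a := e'.repr (φ (e 0)) 0
  set a' := e.repr (φ.symm (e' 0)) 0
  have ha : IsUnit a := by
    refine isUnit_iff_exists_inv'.2 ⟨a', Basis.smul_zero_inj e' ?_⟩
    rw [mul_smul, ← k0, ← map_smul, ← k0', LieModuleEquiv.apply_symm_apply, one_smul]
  have hc : IsUnit (e'.repr (φ (e 1)) 1) := by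
    refine isUnit_iff_exists_inv'.2 ⟨e.repr (φ.symm (e' 1)) 1, ?_⟩
    have := congrArg (fun v => e'.repr (φ v) 1) (Basis.eq_add e (φ.symm (e' 1)))
    simpa [k0] using this.symm
  obtain ⟨a, ha⟩ := ha
  obtain ⟨c, hc⟩ := hc
  refine ⟨c⁻¹ * a, fun y => ?_⟩
  obtain ⟨x, rfl⟩ := LieSubmodule.Quotient.surjective_mk' _ y
  have h1 : φ ⁅(1 : A) ⊗ₜ[k] x, e 1⁆ = ⁅(1 : A) ⊗ₜ[k] x, φ (e 1)⁆ :=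
    φ.toLieModuleHom.map_lie _ _
  rw [h.lie_one, map_smul, k0, h'.lie_eq, smul_smul, ← ha, ← hc] at h1
  have h2 := Basis.smul_zero_inj e' h1
  rw [Units.val_mul, mul_assoc, Units.eq_inv_mul_iff_mul_eq, mul_comm, mul_comm (a : A)]
  exact h2.symm

end Isomorphisms

/-! ### The standard representation of a functional -/

section StandardRepresentation

variable {k : Type u} [Field k] {g : Type u} [LieRing g] [LieAlgebra k g]
  {A : Type u} [CommRing A] [Algebra k A]

/-- The functional on `g_A` induced by a linear map `g / [g, g] → A`. -/
def extendFunctional (l : ab k g →ₗ[k] A) : (A ⊗[k] g) →ₗ[A] A :=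
  LinearMap.liftBaseChange A (l ∘ₗ (LieAlgebra.derivedSeries k g 1).toSubmodule.mkQ)

theorem extendFunctional_tmul (l : ab k g →ₗ[k] A) (a : A) (x : g) :
    extendFunctional l (a ⊗ₜ x) = a * l (LieSubmodule.Quotient.mk x) :=
  LinearMap.liftBaseChange_tmul ..

theorem extendFunctional_lie (l : ab k g →ₗ[k] A) (y z : A ⊗[k] g) :
    extendFunctional l ⁅y, z⁆ = 0 := by
  induction y with
  | zero => rw [zero_lie, map_zero]
  | add a b ha hb => rw [add_lie, map_add, ha, hb, add_zero]
  | tmul a x =>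
    induction z with
    | zero => rw [lie_zero, map_zero]
    | add a b ha hb => rw [lie_add, map_add, ha, hb, add_zero]
    | tmul b y =>
      have hxy : ⁅x, y⁆ ∈ LieAlgebra.derivedSeries k g 1 :=
        LieSubmodule.lie_mem_lie (LieSubmodule.mem_top x) (LieSubmodule.mem_top y)
      have h0 : (LieSubmodule.Quotient.mk ⁅x, y⁆ : ab k g) = 0 :=
        (LieSubmodule.Quotient.mk_eq_zero (N := LieAlgebra.derivedSeries k g 1)).2 hxy
      rw [LieAlgebra.ExtendScalars.bracket_tmul, extendFunctional_tmul, h0, map_zero, mul_zero]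

/-- The underlying module `A²` of the standard representation. -/
def StandardModule (_ : ab k g →ₗ[k] A) : Type u := Fin 2 → A

instance (l : ab k g →ₗ[k] A) : AddCommGroup (StandardModule l) :=
  inferInstanceAs (AddCommGroup (Fin 2 → A))

instance (l : ab k g →ₗ[k] A) : Module A (StandardModule l) :=
  inferInstanceAs (Module A (Fin 2 → A))

/-- The standard basis of `A²`. -/
def StandardModule.basis (l : ab k g →ₗ[k] A) : Module.Basis (Fin 2) A (StandardModule l) :=
  Pi.basisFun A (Fin 2)

/-- All terms of the Leibniz identity vanish: `N² = 0` kills iterated actions, and the extended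
functional kills brackets. -/
instance (l : ab k g →ₗ[k] A) : LieRingModule (A ⊗[k] g) (StandardModule l) where
  bracket y v := extendFunctional l y • shift (StandardModule.basis l) v
  add_lie y z v := by rw [map_add, add_smul]
  lie_add y v w := by rw [map_add, smul_add]
  leibniz_lie y z v := by
    simp only [map_smul, shift_shift, smul_zero, extendFunctional_lie, zero_smul, add_zero]

theorem StandardModule.lie_def (l : ab k g →ₗ[k] A) (y : A ⊗[k] g) (v : StandardModule l) :
    ⁅y, v⁆ = extendFunctional l y • shift (StandardModule.basis l) v := rfl

instance (l : ab k g →ₗ[k] A) : LieModule A (A ⊗[k] g) (StandardModule l) where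
  smul_lie a y v := by
    rw [StandardModule.lie_def, StandardModule.lie_def, map_smul, smul_smul, smul_eq_mul]
  lie_smul a y v := by
    rw [StandardModule.lie_def, StandardModule.lie_def, map_smul, smul_comm]

theorem StandardModule.isStandard (l : ab k g →ₗ[k] A) :
    IsStandard (StandardModule.basis l) l where
  lie_zero x := by
    rw [StandardModule.lie_def, shift_apply]
    simp
  lie_one x := by
    rw [StandardModule.lie_def, shift_one, extendFunctional_tmul, one_mul]

/-- The standard representation attached to a unimodular functional. -/
def standardNdRep (l : ab k g →ₗ[k] A) (hl : Ideal.span (Set.range l) = ⊤) : NdRep k g 2 A :=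
  ⟨⟨StandardModule l⟩, (StandardModule.isStandard l).isNondegenerate hl⟩

end StandardRepresentation

/-! ### From unimodular functionals to isomorphism classes -/

section Comparison

variable (k : Type u) [Field k] (g : Type u) [LieRing g] [LieAlgebra k g]

/-- Pullback replaces the functional `l` by its composite with `A → B`, and the functional
determines a standard representation up to isomorphism. -/
theorem pi0_map_mk {A B : CommAlgCat.{u} k} (φ : A ⟶ B) {M : NdRep k g 2 A} {N : NdRep k g 2 B}
    {e : Module.Basis (Fin 2) A M.1.carrier} {l : ab k g →ₗ[k] A} (h : IsStandard e l)
    {e' : Module.Basis (Fin 2) B N.1.carrier}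
    (h' : IsStandard e' (φ.hom.toLinearMap ∘ₗ l)) :
    (pi0 k g 2).map φ (Quotient.mk (ndSetoid k g 2 A) M) = Quotient.mk (ndSetoid k g 2 B) N := by
  let _ := φ.hom.toRingHom.toAlgebra
  have : IsScalarTower k A B := IsScalarTower.of_algebraMap_eq fun x => (φ.hom.commutes x).symm
  have h1 := h.pullback (M.1.toPullback_isPullback B)
  exact Quotient.sound (IsStandard.iso (M := (M.pullback φ.hom).1) (N := N.1) h1 h' 1 fun y => by
    rw [Units.val_one, one_mul]; rfl)

/-- A unimodular functional defines a standard representation. -/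
def unimodularToPi0 : unimodular k (ab k g) ⟶ pi0Presheaf k g 2 where
  app U := ↾fun p => Quotient.map
    (sa := unimodularSetoid k (ab k g) U.unop.unop) (sb := ndSetoid k g 2 U.unop.unop)
    (fun l => standardNdRep l.1 l.2)
    (fun l l' ⟨u, hu⟩ =>
      IsStandard.iso (StandardModule.isStandard l.1) (StandardModule.isStandard l'.1) u hu) p.down
  naturality U V φ := by
    ext ⟨p⟩
    obtain ⟨⟨l, hl⟩, rfl⟩ := Quotient.exists_rep p
    exact (pi0_map_mk k g φ.unop.unop (M := standardNdRep l hl)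
      (N := standardNdRep (φ.unop.unop.hom.toLinearMap ∘ₗ l) (span_range_comp _ hl))
      (StandardModule.isStandard l)
      (StandardModule.isStandard (φ.unop.unop.hom.toLinearMap ∘ₗ l))).symm

theorem unimodularToPi0_mk {A : CommAlgCat.{u} k} {M : NdRep k g 2 A}
    {e : Module.Basis (Fin 2) A M.1.carrier} {l : ab k g →ₗ[k] A} (h : IsStandard e l)
    (hl : Ideal.span (Set.range l) = ⊤) :
    (unimodularToPi0 k g).app (op (op A)) (unimodular.mk A l hl) =
      Quotient.mk (ndSetoid k g 2 A) M :=
  Quotient.sound (IsStandard.iso (StandardModule.isStandard l) h 1 fun y => by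
    rw [Units.val_one, one_mul])

theorem unimodularToPi0_injective (A : CommAlgCat.{u} k) :
    Function.Injective ((unimodularToPi0 k g).app (op (op A))) := by
  rintro ⟨p⟩ ⟨q⟩ h
  obtain ⟨⟨l, hl⟩, rfl⟩ := Quotient.exists_rep p
  obtain ⟨⟨l', hl'⟩, rfl⟩ := Quotient.exists_rep q
  have h1 : (standardNdRep l hl).1.Iso (standardNdRep l' hl').1 := Quotient.exact h
  obtain ⟨u, hu⟩ := (StandardModule.isStandard l).exists_units (StandardModule.isStandard l') hl hl' h1
  exact congrArg ULift.up (Quotient.sound ⟨u, hu⟩)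

instance unimodularToPi0_isLocallyInjective :
    Presheaf.IsLocallyInjective (fppf k) (unimodularToPi0 k g) :=
  Presheaf.isLocallyInjective_of_injective _ _ fun U => unimodularToPi0_injective k g U.unop.unop

theorem NdRep.exists_isStandard_pullback {A : Type u} [CommRing A] [Algebra k A] (M : NdRep k g 2 A)
    (P : PrimeSpectrum A) : ∃ a ∉ P.asIdeal, ∀ (B : Type u) [CommRing B] [Nontrivial B]
      [Algebra k B] (φ : A →ₐ[k] B), IsUnit (φ a) →
      ∃ (e : Module.Basis (Fin 2) B (M.pullback φ).1.carrier) (l : ab k g →ₗ[k] B),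
        IsStandard e l ∧ Ideal.span (Set.range l) = ⊤ := by
  obtain ⟨a, ha, H⟩ := IsNondegenerate.exists_isStandard M.2 P
  refine ⟨a, ha, fun B _ _ _ φ hu => ?_⟩
  let _ : Algebra A B := φ.toRingHom.toAlgebra
  have : IsScalarTower k A B := IsScalarTower.of_algebraMap_eq fun x => (φ.commutes x).symm
  exact H B (M.1.pullback B).carrier _ (M.1.toPullback_isPullback B) hu

/-- Local surjectivity is the local existence of standard forms. -/
theorem unimodularToPi0_imageSieve_mem (A : CommAlgCat.{u} k) (M : NdRep k g 2 A) :
    Presheaf.imageSieve (unimodularToPi0 k g) (U := op A) (Quotient.mk (ndSetoid k g 2 A) M) ∈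
      fppf k (op A) := by
  refine fppf_mem_of_basicOpen k A _ fun P => ?_
  obtain ⟨a, ha, H⟩ := M.exists_isStandard_pullback k g P
  refine ⟨a, ha, ?_⟩
  -- The prime `P` survives in the localization, since it does not contain `a`.
  have : Nontrivial (Localization.Away a) := by
    obtain ⟨Q, -⟩ := (PrimeSpectrum.localization_away_comap_range (Localization.Away a) a).ge ha
    exact Q.nontrivial
  obtain ⟨e, l, h, hl⟩ := H (Localization.Away a) (Algebra.algHom k A (Localization.Away a))
    (IsLocalization.Away.algebraMap_isUnit a)
  exact ⟨unimodular.mk (CommAlgCat.of k (Localization.Away a)) l hl,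
    unimodularToPi0_mk k g (M := M.pullback _) h hl⟩

instance unimodularToPi0_isLocallySurjective :
    Presheaf.IsLocallySurjective (fppf k) (unimodularToPi0 k g) where
  imageSieve_mem {U} p := by
    obtain ⟨M, rfl⟩ := Quotient.exists_rep p
    exact unimodularToPi0_imageSieve_mem k g U.unop M

end Comparison

/-! ### Comparison of the two sheafifications -/

section Comparison

variable (k : Type u) [Field k] (g : Type u) [LieRing g] [LieAlgebra k g]

/-- The map from unimodular functionals to the moduli space. -/
def unimodularToModuli : unimodular k (ab k g) ⟶ (moduliSpace k g 2).obj :=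
  unimodularToPi0 k g ≫ toSheafify (fppf k) (pi0Presheaf k g 2)

/-- Locally bijective maps and the unit of sheafification both become isomorphisms after
sheafification, hence so does their composite. -/
theorem W_unimodularToModuli : (fppf k).W (unimodularToModuli k g) :=
  MorphismProperty.comp_mem _ _ _
    (GrothendieckTopology.W_of_isLocallyBijective (J := fppf k) (unimodularToPi0 k g))
    (GrothendieckTopology.W_toSheafify _ _)

theorem W_unimodularToPoints (V : Type u) [AddCommGroup V] [Module k V] :
    (fppf k).W (unimodularToPoints (k := k) (V := V)) :=
  GrothendieckTopology.W_of_isLocallyBijective (J := fppf k) _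

/-- Morphisms from `Q` to a sheaf extend uniquely along maps in `J.W`, so `F` and `G` have the same
universal property. -/
theorem exists_iso_of_W {C : Type*} [Category C] {J : GrothendieckTopology C} {D : Type*}
    [Category D] {Q F G : Cᵒᵖ ⥤ D} {a : Q ⟶ F} {b : Q ⟶ G} (ha : J.W a) (hb : J.W b)
    (hF : Presheaf.IsSheaf J F) (hG : Presheaf.IsSheaf J G) : ∃ Φ : F ≅ G, a ≫ Φ.hom = b := by
  obtain ⟨f, hf⟩ := (ha G hG).2 b
  obtain ⟨f', hf'⟩ := (hb F hF).2 a
  dsimp only at hf hf'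
  refine ⟨⟨f, f', (ha F hF).1 ?_, (hb G hG).1 ?_⟩, hf⟩
  · dsimp only
    rw [← Category.assoc, hf, hf', Category.comp_id]
  · dsimp only
    rw [← Category.assoc, hf', hf, Category.comp_id]

theorem unimodularToModuli_mk {A : CommAlgCat.{u} k} (M : NdRep k g 2 A)
    {e : Module.Basis (Fin 2) A M.1.carrier} {l : ab k g →ₗ[k] A} (h : IsStandard e l)
    (hl : Ideal.span (Set.range l) = ⊤) :
    (unimodularToModuli k g).app (op (op A)) (unimodular.mk A l hl) = moduliSpace.mk k g 2 A M :=
  congrArg ((toSheafify (fppf k) (pi0Presheaf k g 2)).app (op (op A)))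
    (unimodularToPi0_mk k g h hl)

/-- An isomorphism sends the classes of standard representations to the corresponding points if and
only if it is compatible with the maps from unimodular functionals. -/
theorem compatible_iff (Φ : (moduliSpace k g 2).obj ≅ projSpace.points k (ab k g)) :
    (∀ (A : CommAlgCat.{u} k) (M : NdRep k g 2 A) (e : Module.Basis (Fin 2) A M.1.carrier)
      (l : ab k g →ₗ[k] A), (∀ x : g, ⁅(1 : A) ⊗ₜ[k] x, e 0⁆ = 0) →
        (∀ x : g, ⁅(1 : A) ⊗ₜ[k] x, e 1⁆ = l (LieSubmodule.Quotient.mk x) • e 0) →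
        ∃ hl : Ideal.span (Set.range l) = ⊤,
          Φ.hom.app (op (op A)) (moduliSpace.mk k g 2 A M) = projSpace.point A l hl) ↔
      unimodularToModuli k g ≫ Φ.hom = unimodularToPoints := by
  refine ⟨fun H => ?_, fun H A M e l h0 h1 => ?_⟩
  · ext U ⟨p⟩
    obtain ⟨⟨l, hl⟩, rfl⟩ := Quotient.exists_rep p
    have hs := StandardModule.isStandard (k := k) (g := g) (A := U.unop.unop) l
    obtain ⟨_, H⟩ := H U.unop.unop (standardNdRep l hl) _ l hs.lie_zero hs.lie_one
    refine Eq.trans ?_ H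
    -- Every class in the presheaf of functionals comes from the explicit standard representation,
    -- so the condition on that single representation already gives the compatibility.
    exact congrArg (Φ.hom.app U) (unimodularToModuli_mk k g (standardNdRep l hl) hs hl)
  · have hs : IsStandard e l := ⟨h0, h1⟩
    have hl := hs.span_range_eq_top M.2.1
    refine ⟨hl, ?_⟩
    rw [← unimodularToModuli_mk k g M hs hl]
    exact congrArg (fun η => η.app (op (op A)) (unimodular.mk A l hl)) H

end Comparison

end NilpotentModuli
end

theorem proposition8 (k : Type u) [Field k] (g : Type u) [LieRing g] [LieAlgebra k g]
    (hg : ∃ s : Finset g, LieSubalgebra.lieSpan k g (s : Set g) = ⊤) :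
    ∃! Φ : (NilpotentModuli.moduliSpace k g 2).obj ≅
        NilpotentModuli.projSpace.points k (NilpotentModuli.ab k g),
      ∀ (A : CommAlgCat.{u} k) (M : NilpotentModuli.NdRep k g 2 A)
        (e : Module.Basis (Fin 2) A M.1.carrier) (l : NilpotentModuli.ab k g →ₗ[k] A),
        (∀ x : g, ⁅(1 : A) ⊗ₜ[k] x, e 0⁆ = 0) →
        (∀ x : g, ⁅(1 : A) ⊗ₜ[k] x, e 1⁆ = l (LieSubmodule.Quotient.mk x) • e 0) →
        ∃ hl : Ideal.span (Set.range l) = ⊤,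
          Φ.hom.app (op (op A)) (NilpotentModuli.moduliSpace.mk k g 2 A M) =
            NilpotentModuli.projSpace.point A l hl := by
  have hW := NilpotentModuli.W_unimodularToModuli k g
  have hs := NilpotentModuli.projSpace.isSheaf_points k (NilpotentModuli.ab k g)
  obtain ⟨Φ, hΦ⟩ := NilpotentModuli.exists_iso_of_W hW
    (NilpotentModuli.W_unimodularToPoints k (NilpotentModuli.ab k g))
    (NilpotentModuli.moduliSpace k g 2).property hs
  refine ⟨Φ, (NilpotentModuli.compatible_iff k g Φ).2 hΦ, fun Ψ hΨ => Iso.ext ?_⟩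
  -- Both isomorphisms restrict to the same map on unimodular functionals, and a morphism from the
  -- moduli space to a sheaf is determined by this restriction.
  exact (hW _ hs).1 (((NilpotentModuli.compatible_iff k g Ψ).1 hΨ).trans hΦ.symm)
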